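/- Let $\sigma>0$ and let $(\omega,c)\in\mathbb R^2$ be admissible, i.e. $\omega>c^2/4$. Define $$\varphi(y)=\left(\frac{(\sigma+1)(4\omega-c^2)}{2\sqrt{\omega}\,\bigl(\cosh(\sigma\sqrt{4\omega-c^2}\,y)-\frac{c}{2\sqrt\omega}\bigr)}\right)^{\frac1{2\sigma}},\qquad \theta(y)=\frac c2\,y-\frac1{2\sigma+2}\int_{-\infty}^y\varphi(\eta)^{2\sigma}\,d\eta,\qquad \phi=\varphi e^{i\theta},$$ so that $e^{i\omega t}\phi(x-ct)$ is the solitary wave of the generalized derivative nonlinear Schrödinger equation $i\partial_t\psi+\partial_x^2\psi+i|\psi|^{2\sigma}\psi_x=0$. Let $$E(\psi)=\frac12\int_{\mathbb R}|\psi_x|^2dx+\frac1{2(\sigma+1)}\,\mathrm{Im}\int_{\mathbb R}|\psi|^{2\sigma}\bar\psi\psi_x\,dx,\quad Q(\psi)=\frac12\int_{\mathbb R}|\psi|^2dx,\quad P(\psi)=-\frac12\,\mathrm{Im}\int_{\mathbb R}\bar\psi\psi_x\,dx,$$ and let $H_\phi=E''(\phi)+\omega Q''(\phi)+cP''(\phi)$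 be the linearized operator about $\phi$, that is, the real-linear operator in $L^2(\mathbb R;\mathbb C)$ with domain $H^2(\mathbb R;\mathbb C)$ given by $$H_\phi u=-u_{xx}-i\sigma|\phi|^{2\sigma-2}\bar\phi\,\phi_x\,u-i|\phi|^{2\sigma}u_x-i\sigma|\phi|^{2\sigma-2}\phi\,\phi_x\,\bar u+\omega u+ic\,u_x .$$ Let $n(H_\phi)$ denote the number of negative eigenvalues of $H_\phi$, counted with (real) multiplicity. Then $H_\phi$ has exactly one negative eigenvalue, and $$n(H_\phi)=1 .$$ -/

import Mathlib

open MeasureTheory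
open scoped ComplexConjugate

namespace GDNLS

noncomputable section

/-! ### Unbounded real-linear operators and their negative eigenvalues -/

section Spectral

variable {E : Type*} [AddCommGroup E] [Module ℝ E]

/-- The eigenspace `ker (A - lam)` of a partially defined real-linear operator. -/
def eigenspace (A : E →ₗ.[ℝ] E) (lam : ℝ) : Submodule ℝ E where
  carrier := {u | ∃ h : u ∈ A.domain, A ⟨u, h⟩ = lam • u}
  zero_mem' := ⟨A.domain.zero_mem, by
    have : (⟨0, A.domain.zero_mem⟩ : A.domain) = 0 := rfl
    rw [this, A.map_zero, smul_zero]⟩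
  add_mem' := by
    rintro u v ⟨hu, hu'⟩ ⟨hv, hv'⟩
    refine ⟨A.domain.add_mem hu hv, ?_⟩
    have : (⟨u + v, A.domain.add_mem hu hv⟩ : A.domain) = ⟨u, hu⟩ + ⟨v, hv⟩ := rfl
    rw [this, A.map_add, hu', hv', smul_add]
  smul_mem' := by
    rintro r u ⟨hu, hu'⟩
    refine ⟨A.domain.smul_mem r hu, ?_⟩
    have : (⟨r • u, A.domain.smul_mem r hu⟩ : A.domain) = r • ⟨u, hu⟩ := rfl
    rw [this, A.map_smul, hu', smul_comm]

/-- `lam` is an eigenvalue of `A`: there is a nonzero `u` in the domain with `A u = lam u`. -/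
def IsEigenvalue (A : E →ₗ.[ℝ] E) (lam : ℝ) : Prop :=
  ∃ u : A.domain, u ≠ 0 ∧ A u = lam • (u : E)

end Spectral

/-- The number `n(A)` of negative eigenvalues of `A`, each counted with its (real) multiplicity. -/
def negCount {E : Type} [AddCommGroup E] [Module ℝ E] (A : E →ₗ.[ℝ] E) : Cardinal :=
  Cardinal.sum fun lam : Set.Iio (0 : ℝ) => Module.rank ℝ (eigenspace A lam)

/-! ### Sobolev spaces on the line through weak derivatives -/

/-- `L²(ℝ; ℂ)`, used below as a real vector space. -/
abbrev L2 : Type := Lp ℂ 2 (volume : Measure ℝ)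

/-- `v` is the weak derivative of `u`. -/
def HasWeakDeriv (u v : L2) : Prop :=
  ∀ η : ℝ → ℝ, ContDiff ℝ (⊤ : ℕ∞) η → HasCompactSupport η →
    ∫ x, deriv η x • u x = -∫ x, η x • v x

lemma integrable_smul_L2 {η : ℝ → ℝ} (h : Continuous η) (hs : HasCompactSupport η) (u : L2) :
    Integrable fun x => η x • u x :=
  memLp_one_iff_integrable.1
    ((Lp.memLp u).smul (p := 2) (q := 2) (r := 1) (h.memLp_of_hasCompactSupport hs))

lemma HasWeakDeriv.add {u v u' v' : L2} (h : HasWeakDeriv u v) (h' : HasWeakDeriv u' v') :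
    HasWeakDeriv (u + u') (v + v') := by
  intro η hη hs
  have hd : Continuous (deriv η) := hη.continuous_deriv (by simp)
  have e1 : ∫ x, deriv η x • (u + u') x = ∫ x, (deriv η x • u x + deriv η x • u' x) := by
    apply integral_congr_ae
    filter_upwards [Lp.coeFn_add u u'] with x hx
    simp only [hx, Pi.add_apply, smul_add]
  have e2 : ∫ x, η x • (v + v') x = ∫ x, (η x • v x + η x • v' x) := by
    apply integral_congr_ae
    filter_upwards [Lp.coeFn_add v v'] with x hx
    simp only [hx, Pi.add_apply, smul_add]
  rw [e1, e2, integral_add (integrable_smul_L2 hd hs.deriv u) (integrable_smul_L2 hd hs.deriv u'),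
    integral_add (integrable_smul_L2 hη.continuous hs v) (integrable_smul_L2 hη.continuous hs v'),
    h η hη hs, h' η hη hs, neg_add]

lemma HasWeakDeriv.smul {u v : L2} (r : ℝ) (h : HasWeakDeriv u v) :
    HasWeakDeriv (r • u) (r • v) := by
  intro η hη hs
  have e1 : ∫ x, deriv η x • (r • u) x = ∫ x, r • (deriv η x • u x) := by
    apply integral_congr_ae
    filter_upwards [Lp.coeFn_smul r u] with x hx
    simp only [hx, Pi.smul_apply, smul_comm r]
  have e2 : ∫ x, η x • (r • v) x = ∫ x, r • (η x • v x) := by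
    apply integral_congr_ae
    filter_upwards [Lp.coeFn_smul r v] with x hx
    simp only [hx, Pi.smul_apply, smul_comm r]
  rw [e1, e2, integral_smul, integral_smul, h η hη hs, smul_neg]

lemma HasWeakDeriv.zero : HasWeakDeriv 0 0 := by
  intro η _ _
  have e (f : ℝ → ℝ) : ∫ x, f x • (0 : L2) x = 0 := by
    rw [← integral_zero ℝ ℂ]
    apply integral_congr_ae
    filter_upwards [Lp.coeFn_zero ℂ 2 (volume : Measure ℝ)] with x hx
    simp only [hx, Pi.zero_apply, smul_zero]
  rw [e, e, neg_zero]

lemma HasWeakDeriv.unique {u v v' : L2} (h : HasWeakDeriv u v) (h' : HasWeakDeriv u v') :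
    v = v' := by
  have key : ∀ᵐ x, (v - v') x = 0 := by
    apply ae_eq_zero_of_integral_contDiff_smul_eq_zero
    · exact (Lp.memLp (v - v')).locallyIntegrable (by norm_num)
    · intro η hη hs
      have e : ∫ x, η x • (v - v') x = ∫ x, (η x • v x - η x • v' x) := by
        apply integral_congr_ae
        filter_upwards [Lp.coeFn_sub v v'] with x hx
        simp only [hx, Pi.sub_apply, smul_sub]
      rw [e, integral_sub (integrable_smul_L2 hη.continuous hs v)
        (integrable_smul_L2 hη.continuous hs v'), sub_eq_zero]
      exact neg_injective ((h η hη hs).symm.trans (h' η hη hs))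
  rw [← sub_eq_zero]
  exact (Lp.eq_zero_iff_ae_eq_zero).2 key

/-- The Sobolev space `H¹(ℝ; ℂ)`. -/
def H1 : Submodule ℝ L2 where
  carrier := {u | ∃ v, HasWeakDeriv u v}
  zero_mem' := ⟨0, HasWeakDeriv.zero⟩
  add_mem' := by
    rintro _ _ ⟨v, hv⟩ ⟨w, hw⟩
    exact ⟨v + w, hv.add hw⟩
  smul_mem' := by
    rintro r _ ⟨v, hv⟩
    exact ⟨r • v, hv.smul r⟩

/-- The weak derivative `H¹ → L²`. -/
def wderiv : H1 →ₗ[ℝ] L2 where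
  toFun u := u.2.choose
  map_add' u v := (u + v).2.choose_spec.unique (u.2.choose_spec.add v.2.choose_spec)
  map_smul' r u := (r • u).2.choose_spec.unique (u.2.choose_spec.smul r)

lemma hasWeakDeriv_wderiv (u : H1) : HasWeakDeriv u (wderiv u) := u.2.choose_spec

/-- The Sobolev space `H²(ℝ; ℂ)`: functions in `H¹` whose weak derivative is in `H¹`. -/
def H2 : Submodule ℝ L2 := (H1.comap wderiv).map H1.subtype

lemma H2_le_H1 : H2 ≤ H1 := by
  rintro _ ⟨u, _, rfl⟩
  exact u.2

/-- The first weak derivative on `H²`, as an element of `H¹`. -/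
def wderiv₁ : H2 →ₗ[ℝ] H1 :=
  (wderiv.comp (Submodule.inclusion H2_le_H1)).codRestrict H1 (by
    rintro ⟨_, u, hu, rfl⟩
    exact hu)

/-- The second weak derivative on `H²`. -/
def wderiv₂ : H2 →ₗ[ℝ] L2 := wderiv.comp wderiv₁

/-! ### The solitary wave -/

/-- `φ_{ω,c}(y)^{2σ}` for the real positive profile. -/
def profilePow (σ ω c y : ℝ) : ℝ :=
  (σ + 1) * (4 * ω - c ^ 2) /
    (2 * √ω * (Real.cosh (σ * √(4 * ω - c ^ 2) * y) - c / (2 * √ω)))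

/-- The real positive profile `varphi_{ω,c}`. -/
def profile (σ ω c y : ℝ) : ℝ := profilePow σ ω c y ^ (1 / (2 * σ))

/-- The traveling phase `θ_{ω,c}`. -/
def phase (σ ω c y : ℝ) : ℝ :=
  c / 2 * y - 1 / (2 * σ + 2) * ∫ η in Set.Iic y, profile σ ω c η ^ (2 * σ)

/-- The complex solitary wave `φ_{ω,c} = varphi_{ω,c} e^{iθ_{ω,c}}`. -/
def soliton (σ ω c y : ℝ) : ℂ :=
  profile σ ω c y * Complex.exp (Complex.I * phase σ ω c y)

section Bounds

variable {σ ω c : ℝ}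

lemma z_lt_one (hω : c ^ 2 / 4 < ω) : c / (2 * √ω) < 1 := by
  have h0 : 0 < ω := lt_of_le_of_lt (by positivity) hω
  have hs : 0 < √ω := Real.sqrt_pos.2 h0
  rw [div_lt_one (by positivity)]
  apply lt_of_pow_lt_pow_left₀ 2 (by positivity)
  rw [mul_pow, Real.sq_sqrt h0.le]
  linarith

/-- The denominator of the profile is bounded below by a multiple of `cosh`. -/
lemma exists_cosh_le (hω : c ^ 2 / 4 < ω) :
    ∃ m : ℝ, 0 < m ∧ ∀ t : ℝ, m * Real.cosh t ≤ Real.cosh t - c / (2 * √ω) := by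
  have hz := z_lt_one hω
  refine ⟨min 1 (1 - c / (2 * √ω)), lt_min one_pos (by linarith), fun t => ?_⟩
  have hc := Real.one_le_cosh t
  rcases le_total 0 (c / (2 * √ω)) with h | h
  · have := min_le_right 1 (1 - c / (2 * √ω))
    nlinarith
  · have := min_le_left 1 (1 - c / (2 * √ω))
    nlinarith

lemma den_pos (hω : c ^ 2 / 4 < ω) (t : ℝ) : 0 < Real.cosh t - c / (2 * √ω) := by
  linarith [z_lt_one hω, Real.one_le_cosh t]

lemma profilePow_pos (hσ : 0 < σ) (hω : c ^ 2 / 4 < ω) (y : ℝ) : 0 < profilePow σ ω c y := by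
  have hs : 0 < √ω := Real.sqrt_pos.2 (lt_of_le_of_lt (by positivity) hω)
  have h4 : 0 < 4 * ω - c ^ 2 := by linarith
  exact div_pos (by positivity) (mul_pos (by positivity) (den_pos hω _))

lemma profile_pos (hσ : 0 < σ) (hω : c ^ 2 / 4 < ω) (y : ℝ) : 0 < profile σ ω c y :=
  Real.rpow_pos_of_pos (profilePow_pos hσ hω y) _

lemma profile_rpow (hσ : 0 < σ) (hω : c ^ 2 / 4 < ω) (y : ℝ) :
    profile σ ω c y ^ (2 * σ) = profilePow σ ω c y := by
  rw [profile, ← Real.rpow_mul (profilePow_pos hσ hω y).le, one_div_mul_cancel (by positivity),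
    Real.rpow_one]

lemma exists_profilePow_le (hσ : 0 < σ) (hω : c ^ 2 / 4 < ω) :
    ∃ C : ℝ, 0 < C ∧ ∀ y, profilePow σ ω c y ≤
      C * (Real.cosh (σ * √(4 * ω - c ^ 2) * y))⁻¹ := by
  obtain ⟨m, hm, h⟩ := exists_cosh_le hω
  have hs : 0 < √ω := Real.sqrt_pos.2 (lt_of_le_of_lt (by positivity) hω)
  have h4 : 0 < 4 * ω - c ^ 2 := by linarith
  refine ⟨(σ + 1) * (4 * ω - c ^ 2) / (2 * √ω * m), by positivity, fun y => ?_⟩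
  have hc := Real.cosh_pos (σ * √(4 * ω - c ^ 2) * y)
  rw [profilePow, ← div_eq_mul_inv, div_div, mul_assoc (2 * √ω)]
  gcongr
  exact h _

lemma hasDerivAt_profilePow (hσ : 0 < σ) (hω : c ^ 2 / 4 < ω) (y : ℝ) :
    HasDerivAt (profilePow σ ω c) (-(profilePow σ ω c y *
      (σ * √(4 * ω - c ^ 2) * Real.sinh (σ * √(4 * ω - c ^ 2) * y) /
        (Real.cosh (σ * √(4 * ω - c ^ 2) * y) - c / (2 * √ω))))) y := by
  have hs : 0 < √ω := Real.sqrt_pos.2 (lt_of_le_of_lt (by positivity) hω)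
  have hd := den_pos hω (σ * √(4 * ω - c ^ 2) * y)
  have h1 : HasDerivAt (fun y => σ * √(4 * ω - c ^ 2) * y) (σ * √(4 * ω - c ^ 2)) y := by
    simpa using (hasDerivAt_id y).const_mul (σ * √(4 * ω - c ^ 2))
  have h2 := ((h1.cosh.sub_const (c / (2 * √ω))).const_mul (2 * √ω))
  have h3 := (hasDerivAt_const y ((σ + 1) * (4 * ω - c ^ 2))).div h2 (by positivity)
  refine h3.congr_deriv ?_
  rw [profilePow]
  generalize Real.cosh (σ * √(4 * ω - c ^ 2) * y) - c / (2 * √ω) = d at *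
  field_simp
  ring

lemma continuous_profilePow (hσ : 0 < σ) (hω : c ^ 2 / 4 < ω) :
    Continuous (profilePow σ ω c) :=
  continuous_iff_continuousAt.2 fun y => (hasDerivAt_profilePow hσ hω y).continuousAt

lemma integrableOn_profilePow (hσ : 0 < σ) (hω : c ^ 2 / 4 < ω) (y : ℝ) :
    IntegrableOn (profilePow σ ω c) (Set.Iic y) := by
  obtain ⟨C, hC, h⟩ := exists_profilePow_le hσ hω
  have h4 : 0 < 4 * ω - c ^ 2 := by linarith
  have ha : 0 < σ * √(4 * ω - c ^ 2) := by positivity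
  refine Integrable.mono' ((integrableOn_exp_mul_Iic ha y).const_mul (2 * C))
    (continuous_profilePow hσ hω).aestronglyMeasurable (Filter.Eventually.of_forall fun x => ?_)
  rw [Real.norm_of_nonneg (profilePow_pos hσ hω x).le]
  refine (h x).trans ?_
  set t := σ * √(4 * ω - c ^ 2) * x
  have e1 : Real.exp t * Real.exp (-t) = 1 := by rw [← Real.exp_add]; simp
  have : (Real.cosh t)⁻¹ ≤ 2 * Real.exp t := by
    rw [inv_le_iff_one_le_mul₀ (Real.cosh_pos t), Real.cosh_eq]
    nlinarith [Real.exp_pos t]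
  nlinarith

lemma hasDerivAt_phase (hσ : 0 < σ) (hω : c ^ 2 / 4 < ω) (y : ℝ) :
    HasDerivAt (phase σ ω c) (c / 2 - 1 / (2 * σ + 2) * profilePow σ ω c y) y := by
  have hf := continuous_profilePow hσ hω
  have e : phase σ ω c = fun y => c / 2 * y - 1 / (2 * σ + 2) *
      ((∫ η in Set.Iic 0, profilePow σ ω c η) + ∫ η in (0 : ℝ)..y, profilePow σ ω c η) := by
    funext y
    rw [phase, ← intervalIntegral.integral_Iic_sub_Iic (integrableOn_profilePow hσ hω 0)
      (integrableOn_profilePow hσ hω y)]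
    simp only [profile_rpow hσ hω, add_sub_cancel]
  rw [e]
  have h1 : HasDerivAt (fun y => ∫ η in (0 : ℝ)..y, profilePow σ ω c η) (profilePow σ ω c y) y :=
    intervalIntegral.integral_hasDerivAt_right (hf.intervalIntegrable _ _)
      (hf.stronglyMeasurableAtFilter _ _) hf.continuousAt
  have h2 : HasDerivAt (fun y => c / 2 * y) (c / 2) y := by
    simpa using (hasDerivAt_id y).const_mul (c / 2)
  exact h2.sub ((h1.const_add _).const_mul _)

lemma hasDerivAt_profile (hσ : 0 < σ) (hω : c ^ 2 / 4 < ω) (y : ℝ) :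
    HasDerivAt (profile σ ω c) (-(√(4 * ω - c ^ 2) / 2 *
      (Real.sinh (σ * √(4 * ω - c ^ 2) * y) /
        (Real.cosh (σ * √(4 * ω - c ^ 2) * y) - c / (2 * √ω))) * profile σ ω c y)) y := by
  have hp := profilePow_pos hσ hω y
  refine ((hasDerivAt_profilePow hσ hω y).rpow_const (p := 1 / (2 * σ)) (Or.inl hp.ne')).congr_deriv
    ?_
  rw [Real.rpow_sub_one hp.ne', profile]
  have hd := den_pos hω (σ * √(4 * ω - c ^ 2) * y)
  generalize Real.cosh (σ * √(4 * ω - c ^ 2) * y) - c / (2 * √ω) = d at *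
  generalize profilePow σ ω c y ^ (1 / (2 * σ)) = r at *
  field_simp

lemma hasDerivAt_soliton (hσ : 0 < σ) (hω : c ^ 2 / 4 < ω) (y : ℝ) :
    HasDerivAt (soliton σ ω c)
      ((-(√(4 * ω - c ^ 2) / 2 * (Real.sinh (σ * √(4 * ω - c ^ 2) * y) /
          (Real.cosh (σ * √(4 * ω - c ^ 2) * y) - c / (2 * √ω)))) : ℝ) * soliton σ ω c y
        + Complex.I * ((c / 2 - 1 / (2 * σ + 2) * profilePow σ ω c y : ℝ)) * soliton σ ω c y) y := by
  have h1 := (hasDerivAt_profile hσ hω y).ofReal_comp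
  have h2 := (((hasDerivAt_phase hσ hω y).ofReal_comp).const_mul Complex.I).cexp
  refine (h1.mul h2).congr_deriv ?_
  simp only [soliton]
  push_cast
  ring

lemma norm_soliton (hσ : 0 < σ) (hω : c ^ 2 / 4 < ω) (y : ℝ) :
    ‖soliton σ ω c y‖ = profile σ ω c y := by
  rw [soliton, norm_mul, mul_comm Complex.I, Complex.norm_exp_ofReal_mul_I, mul_one,
    Complex.norm_real, Real.norm_of_nonneg (profile_pos hσ hω y).le]

lemma exists_soliton_bounds (hσ : 0 < σ) (hω : c ^ 2 / 4 < ω) :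
    ∃ C : ℝ, ∀ y, ‖soliton σ ω c y‖ ^ (2 * σ) ≤ C ∧
      ‖soliton σ ω c y‖ ^ (2 * σ - 2) * ‖soliton σ ω c y‖ * ‖deriv (soliton σ ω c) y‖ ≤ C := by
  obtain ⟨B, hB, hB'⟩ := exists_profilePow_le hσ hω
  obtain ⟨m, hm, hm'⟩ := exists_cosh_le hω
  have hle (y : ℝ) : profilePow σ ω c y ≤ B := by
    refine (hB' y).trans (mul_le_of_le_one_right hB.le (inv_le_one_of_one_le₀ ?_))
    exact Real.one_le_cosh _
  set M : ℝ := √(4 * ω - c ^ 2) / 2 * m⁻¹ + (|c / 2| + 1 / (2 * σ + 2) * B) with hM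
  have hder (y : ℝ) : ‖deriv (soliton σ ω c) y‖ ≤ M * ‖soliton σ ω c y‖ := by
    rw [(hasDerivAt_soliton hσ hω y).deriv]
    refine (norm_add_le _ _).trans ?_
    rw [norm_mul, norm_mul, norm_mul, Complex.norm_I, one_mul, ← add_mul, Complex.norm_real,
      Complex.norm_real, hM]
    gcongr
    · rw [norm_neg, norm_mul, Real.norm_of_nonneg (by positivity), norm_div,
        Real.norm_of_nonneg (den_pos hω _).le]
      gcongr
      set t := σ * √(4 * ω - c ^ 2) * y
      rw [div_le_iff₀ (den_pos hω t), Real.norm_eq_abs]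
      have h1 : |Real.sinh t| ≤ Real.cosh t := by
        rw [abs_le]
        constructor
        · linarith [Real.cosh_add_sinh t, Real.exp_pos t]
        · exact (Real.sinh_lt_cosh t).le
      have h2 : m⁻¹ * (m * Real.cosh t) ≤ m⁻¹ * (Real.cosh t - c / (2 * √ω)) := by
        gcongr
        exact hm' t
      rw [inv_mul_cancel_left₀ hm.ne'] at h2
      linarith
    · refine (norm_sub_le _ _).trans ?_
      rw [norm_mul, Real.norm_of_nonneg (profilePow_pos hσ hω y).le,
        Real.norm_of_nonneg (by positivity : (0 : ℝ) ≤ 1 / (2 * σ + 2)), Real.norm_eq_abs]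
      gcongr
      exact hle y
  have hM0 : 0 ≤ M := by
    rw [hM]
    positivity
  refine ⟨max B (M * B), fun y => ?_⟩
  have hpos : 0 < ‖soliton σ ω c y‖ := by
    rw [norm_soliton hσ hω]
    exact profile_pos hσ hω y
  have hpow : ‖soliton σ ω c y‖ ^ (2 * σ) ≤ B := by
    rw [norm_soliton hσ hω, profile_rpow hσ hω]
    exact hle y
  refine ⟨hpow.trans (le_max_left _ _), le_trans ?_ (le_max_right _ _)⟩
  have hsplit : ‖soliton σ ω c y‖ ^ (2 * σ - 2) * ‖soliton σ ω c y‖ * ‖soliton σ ω c y‖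
      = ‖soliton σ ω c y‖ ^ (2 * σ) := by
    rw [mul_assoc, ← sq, ← Real.rpow_natCast, ← Real.rpow_add hpos]
    norm_num
  calc _ ≤ ‖soliton σ ω c y‖ ^ (2 * σ - 2) * ‖soliton σ ω c y‖ * (M * ‖soliton σ ω c y‖) := by
        gcongr
        exact hder y
    _ = M * ‖soliton σ ω c y‖ ^ (2 * σ) := by rw [← hsplit]; ring
    _ ≤ M * B := by gcongr

lemma measurable_soliton (hσ : 0 < σ) (hω : c ^ 2 / 4 < ω) : Measurable (soliton σ ω c) :=
  (continuous_iff_continuousAt.2 fun y => (hasDerivAt_soliton hσ hω y).continuousAt).measurable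

end Bounds

/-! ### The linearized operator -/

/-- The function `E''(φ) v`, where `v₁`, `v₂` stand for the first two derivatives of `v`. -/
def energyHess (σ : ℝ) (φ v v₁ v₂ : ℝ → ℂ) (x : ℝ) : ℂ :=
  (-v₂ x
    - Complex.I * σ * (‖φ x‖ ^ (2 * σ - 2) : ℝ) * conj (φ x) * deriv φ x * v x
    - Complex.I * (‖φ x‖ ^ (2 * σ) : ℝ) * v₁ x)
    - Complex.I * σ * (‖φ x‖ ^ (2 * σ - 2) : ℝ) * φ x * deriv φ x * conj (v x)

/-- The function `Q''(φ) v = v`. -/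
def massHess (v : ℝ → ℂ) (x : ℝ) : ℂ := v x

/-- The function `P''(φ) v = i ∂ₓ v`, where `v₁` stands for the derivative of `v`. -/
def momentumHess (v₁ : ℝ → ℂ) (x : ℝ) : ℂ := Complex.I * v₁ x

/-- The function `E''(φ) v + ω Q''(φ) v + c P''(φ) v` at the solitary wave `φ = φ_{ω,c}`. -/
def linearizedFun (σ ω c : ℝ) (v v₁ v₂ : ℝ → ℂ) (x : ℝ) : ℂ :=
  energyHess σ (soliton σ ω c) v v₁ v₂ x + ω * massHess v x + c * momentumHess v₁ x

lemma memLp_bdd_mul {f g : ℝ → ℂ} {C : ℝ} (hg : MemLp g 2) (hf : Measurable f)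
    (h : ∀ x, ‖f x‖ ≤ C) : MemLp (fun x => f x * g x) 2 :=
  hg.of_le_mul (c := C) (hf.aestronglyMeasurable.mul hg.1)
    (Filter.Eventually.of_forall fun x => by
      rw [norm_mul]
      gcongr
      exact h x)

lemma memLp_linearizedFun {σ ω c : ℝ} (hσ : 0 < σ) (hω : c ^ 2 / 4 < ω) (v v₁ v₂ : L2) :
    MemLp (linearizedFun σ ω c v v₁ v₂) 2 := by
  obtain ⟨C, hC⟩ := exists_soliton_bounds hσ hω
  have hm := measurable_soliton hσ hω
  have hd : Measurable (deriv (soliton σ ω c)) := measurable_deriv _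
  have hr (r : ℝ) : Measurable fun x => ((‖soliton σ ω c x‖ ^ r : ℝ) : ℂ) :=
    Complex.measurable_ofReal.comp (hm.norm.pow_const r)
  have hv := Lp.memLp v
  have hv₁ := Lp.memLp v₁
  have hv₂ := Lp.memLp v₂
  have hconj : MemLp (fun x => conj (v x)) 2 := hv.star
  have hC0 (x : ℝ) : 0 ≤ ‖soliton σ ω c x‖ ^ (2 * σ - 2) := by positivity
  have hC1 (x : ℝ) : 0 ≤ ‖soliton σ ω c x‖ ^ (2 * σ) := by positivity
  have t1 : MemLp (fun x => (Complex.I * σ * (‖soliton σ ω c x‖ ^ (2 * σ - 2) : ℝ)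
      * conj (soliton σ ω c x) * deriv (soliton σ ω c) x) * v x) 2 := by
    refine memLp_bdd_mul (C := |σ| * C) hv ?_ fun x => ?_
    · have := Complex.continuous_conj.measurable.comp hm
      exact ((((hr (2 * σ - 2)).const_mul (Complex.I * σ)).mul this).mul hd)
    · simp only [norm_mul, Complex.norm_I, Complex.norm_real, one_mul, RCLike.norm_conj,
        Real.norm_eq_abs σ, Real.norm_of_nonneg (hC0 x)]
      rw [mul_assoc, mul_assoc, ← mul_assoc (‖soliton σ ω c x‖ ^ (2 * σ - 2))]
      gcongr
      exact (hC x).2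
  have t2 : MemLp (fun x => (Complex.I * (‖soliton σ ω c x‖ ^ (2 * σ) : ℝ)) * v₁ x) 2 := by
    refine memLp_bdd_mul (C := C) hv₁ ?_ fun x => ?_
    · exact ((hr (2 * σ)).const_mul Complex.I)
    · simp only [norm_mul, Complex.norm_I, Complex.norm_real, one_mul, Real.norm_of_nonneg (hC1 x)]
      exact (hC x).1
  have t3 : MemLp (fun x => (Complex.I * σ * (‖soliton σ ω c x‖ ^ (2 * σ - 2) : ℝ)
      * soliton σ ω c x * deriv (soliton σ ω c) x) * conj (v x)) 2 := by
    refine memLp_bdd_mul (C := |σ| * C) hconj ?_ fun x => ?_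
    · exact ((((hr (2 * σ - 2)).const_mul (Complex.I * σ)).mul hm).mul hd)
    · simp only [norm_mul, Complex.norm_I, Complex.norm_real, one_mul,
        Real.norm_eq_abs σ, Real.norm_of_nonneg (hC0 x)]
      rw [mul_assoc, mul_assoc, ← mul_assoc (‖soliton σ ω c x‖ ^ (2 * σ - 2))]
      gcongr
      exact (hC x).2
  exact (((hv₂.neg.sub t1).sub t2).sub t3).add (hv.const_mul (ω : ℂ)) |>.add
    ((hv₁.const_mul Complex.I).const_mul (c : ℂ))

/-- The linearized operator `H_φ`, a real-linear operator in `L²(ℝ; ℂ)` with domain `H²(ℝ; ℂ)`. -/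
def linearizedOp (σ ω c : ℝ) (hσ : 0 < σ) (hω : c ^ 2 / 4 < ω) : L2 →ₗ.[ℝ] L2 where
  domain := H2
  toFun :=
    { toFun := fun u =>
        (memLp_linearizedFun hσ hω (u : L2) (wderiv₁ u : L2) (wderiv₂ u)).toLp
          (linearizedFun σ ω c (u : L2) (wderiv₁ u : L2) (wderiv₂ u))
      map_add' := by
        intro u v
        rw [← MemLp.toLp_add]
        apply MemLp.toLp_congr
        rw [map_add, map_add]
        filter_upwards [Lp.coeFn_add (u : L2) (v : L2),
          Lp.coeFn_add (wderiv₁ u : L2) (wderiv₁ v : L2),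
          Lp.coeFn_add (wderiv₂ u) (wderiv₂ v)] with x h0 h1 h2
        simp only [linearizedFun, energyHess, massHess, momentumHess, Submodule.coe_add, h0, h1, h2,
          Pi.add_apply, map_add]
        ring
      map_smul' := by
        intro r u
        rw [RingHom.id_apply, ← MemLp.toLp_const_smul]
        apply MemLp.toLp_congr
        rw [map_smul, map_smul]
        filter_upwards [Lp.coeFn_smul r (u : L2), Lp.coeFn_smul r (wderiv₁ u : L2),
          Lp.coeFn_smul r (wderiv₂ u)] with x h0 h1 h2
        simp only [linearizedFun, energyHess, massHess, momentumHess, Submodule.coe_smul, h0, h1,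
          h2, Pi.smul_apply, Complex.real_smul, map_mul, Complex.conj_ofReal]
        ring }

end

end GDNLS

/-! Write f for `profile`, p = f^(2σ), h = f'/f, k = 1/(2σ+2), m = ω - c²/4, and u = e^{iθ}(a + ib).
In this rotating frame the imaginary part enters the quadratic form of H_φ only through a completed
square: ⟨H_φ u, u⟩ = ∫ (a'² + W a²) + ∫ z², with z = b' - h b + 2σkp a = f (b/f)' + 2σkp a, where W
is `potPlus` evaluated at p (`linearizedFun_gauge`, `IsSol.form_eq`). The profile satisfies f'' = V
f with V given by `potMinus`. Differentiating once more gives f''' = W f', so -∂² + W annihilates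
f', whose only zero is 0.

At most one negative direction: dividing by f' as Jacobi did shows that the form is nonnegative on
functions with a(0) = 0 (`IsProfile.integral_nonneg_of_zero`), a condition of codimension one. Hence
an eigenfunction for a negative eigenvalue with a(0) = 0 vanishes (`IsSol.eq_zero_of_zero`), which
makes negative eigenvalues simple. Eigenfunctions for two different negative eigenvalues would be
orthogonal for the form, and a nontrivial combination with a(0) = 0 would have negative form
(`IsSol.eq_zero_or_eq_zero`).

At least one: take a = f^r and solve z = 0 for b. With r = 1 for c ≤ 0 and r = 2σ+1 for c ≥ 0 the
form is negative (`IsProfile.exists_isSol_of_memLp`). The form is then minimized on the L² sphere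
(`exists_eigenvector_of_compactness`, `IsProfile.exists_isSol`). Since W - m is bounded by a
multiple of the integrable weight p and m > 0, only ∫ p a² can lose mass, and it is controlled by
compactness in H¹ with an integrable weight. The other terms are coercive because the infimum is
negative. In particular b needs no compactness of its own.

The remaining work is regularity: eigenvectors of the unbounded operator correspond exactly to
square integrable classical solutions (`mem_eigenspace_iff`), hence to solutions of the real system
`IsSol`. -/

namespace GDNLS

open Filter Topology

/-! ### Weak derivatives of real functions -/

/-- `v` is the weak derivative of the real function `u`. -/
def WeakDeriv (u v : ℝ → ℝ) : Prop :=
  ∀ η : ℝ → ℝ, ContDiff ℝ (⊤ : ℕ∞) η → HasCompactSupport η →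
    ∫ x, deriv η x * u x = -∫ x, η x * v x

lemma WeakDeriv.congr {u v u' v' : ℝ → ℝ} (h : WeakDeriv u v) (hu : u =ᵐ[volume] u')
    (hv : v =ᵐ[volume] v') : WeakDeriv u' v' := by
  intro η hη hs
  have e1 : ∫ x, deriv η x * u' x = ∫ x, deriv η x * u x :=
    integral_congr_ae (by filter_upwards [hu] with x hx; rw [hx])
  have e2 : ∫ x, η x * v' x = ∫ x, η x * v x :=
    integral_congr_ae (by filter_upwards [hv] with x hx; rw [hx])
  rw [e1, e2, h η hη hs]

lemma exists_support_subset_Ioo {η : ℝ → ℝ} (hs : HasCompactSupport η) :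
    ∃ R : ℝ, 0 < R ∧ ∀ x, R ≤ |x| → η x = 0 := by
  obtain ⟨R, hR⟩ := hs.isCompact.isBounded.subset_closedBall 0
  refine ⟨max R 0 + 1, by positivity, fun x hx => ?_⟩
  by_contra h
  have := hR (subset_tsupport η h)
  rw [Metric.mem_closedBall, dist_zero_right, Real.norm_eq_abs] at this
  linarith [le_max_left R 0]

lemma integral_eq_intervalIntegral {f : ℝ → ℝ} {R : ℝ} (hR : 0 < R)
    (h : ∀ x, R ≤ |x| → f x = 0) : ∫ x, f x = ∫ x in (-R)..R, f x := by
  rw [intervalIntegral.integral_of_le (by linarith), setIntegral_eq_integral_of_forall_compl_eq_zero]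
  intro x hx
  apply h
  rw [Set.mem_Ioc, not_and_or, not_lt, not_le] at hx
  rcases hx with hx | hx
  · rw [abs_of_nonpos (by linarith)]; linarith
  · rw [abs_of_pos (by linarith)]; exact hx.le

/-- A test function of zero mean is the derivative of a test function. -/
lemma exists_test_primitive {ψ : ℝ → ℝ} (hψ : ContDiff ℝ (⊤ : ℕ∞) ψ) (hs : HasCompactSupport ψ)
    (h0 : ∫ x, ψ x = 0) :
    ∃ η : ℝ → ℝ, ContDiff ℝ (⊤ : ℕ∞) η ∧ HasCompactSupport η ∧ deriv η = ψ := by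
  obtain ⟨R, hR, hz⟩ := exists_support_subset_Ioo hs
  have hc := hψ.continuous
  have hd (x : ℝ) : HasDerivAt (fun y => ∫ t in (-R)..y, ψ t) (ψ x) x :=
    intervalIntegral.integral_hasDerivAt_right (hc.intervalIntegrable _ _)
      (hc.stronglyMeasurableAtFilter _ _) hc.continuousAt
  have hde : deriv (fun y => ∫ t in (-R)..y, ψ t) = ψ := funext fun x => (hd x).deriv
  refine ⟨fun y => ∫ t in (-R)..y, ψ t, ?_, ?_, hde⟩
  · refine contDiff_infty_iff_deriv.2 ⟨fun x => (hd x).differentiableAt, ?_⟩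
    rw [hde]
    exact hψ
  · refine HasCompactSupport.of_support_subset_isCompact (isCompact_Icc (a := -R) (b := R)) ?_
    intro x hx
    by_contra hxR
    apply hx
    rw [Set.mem_Icc, not_and_or, not_le, not_le] at hxR
    have key : ∀ a b : ℝ, (∀ t ∈ Set.uIcc a b, R ≤ |t|) → ∫ t in a..b, ψ t = 0 := by
      intro a b hab
      rw [intervalIntegral.integral_congr (g := fun _ => 0) (fun t ht => hz t (hab t ht))]
      simp
    rcases hxR with hxR | hxR
    · apply key
      intro t ht
      rw [Set.uIcc_of_ge hxR.le] at ht
      rw [abs_of_nonpos (by linarith [ht.2])]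
      linarith [ht.2]
    -- To the right of the support the primitive equals the total integral, and this is where the
    -- zero mean enters.
    · have h1 := intervalIntegral.integral_add_adjacent_intervals
        (hc.intervalIntegrable (μ := volume) (-R) R) (hc.intervalIntegrable (μ := volume) R x)
      have h2 : ∫ t in R..x, ψ t = 0 := by
        apply key
        intro t ht
        rw [Set.uIcc_of_le hxR.le] at ht
        exact ht.1.trans (le_abs_self t)
      show ∫ t in (-R)..x, ψ t = 0
      rw [← h1, h2, add_zero, ← integral_eq_intervalIntegral hR hz, h0]

lemma integrable_test_mul {η v : ℝ → ℝ} (hc : Continuous η) (hs : HasCompactSupport η)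
    (hv : LocallyIntegrable v) : Integrable fun x => η x * v x := by
  have := hv.integrable_smul_left_of_hasCompactSupport hc hs
  simpa [smul_eq_mul] using this

lemma locallyIntegrable_intervalIntegrable {v : ℝ → ℝ} (hv : LocallyIntegrable v) (a b : ℝ) :
    IntervalIntegrable v volume a b :=
  intervalIntegrable_iff.2
    ((hv.integrableOn_isCompact isCompact_uIcc).mono_set Set.uIoc_subset_uIcc)

lemma continuous_primitive_of_locallyIntegrable {v : ℝ → ℝ} (hv : LocallyIntegrable v) (a : ℝ) :
    Continuous fun x => ∫ t in a..x, v t :=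
  intervalIntegral.continuous_primitive (locallyIntegrable_intervalIntegrable hv) a

/-- The primitive of a locally integrable function has that function as its weak derivative. -/
lemma weakDeriv_primitive {v : ℝ → ℝ} (hv : LocallyIntegrable v) :
    WeakDeriv (fun x => ∫ t in (0 : ℝ)..x, v t) v := by
  intro η hη hs
  obtain ⟨R, hR, hz⟩ := exists_support_subset_Ioo (η := η) hs
  obtain ⟨R', hR', hz'⟩ := exists_support_subset_Ioo hs.deriv
  set S := max R R'
  have hS : 0 < S := lt_max_of_lt_left hR
  rw [integral_eq_intervalIntegral hS (f := fun x => deriv η x * ∫ t in (0 : ℝ)..x, v t),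
    integral_eq_intervalIntegral hS (f := fun x => η x * v x)]
  rotate_left
  · intro x hx; rw [hz x ((le_max_left _ _).trans hx), zero_mul]
  · intro x hx; rw [hz' x ((le_max_right _ _).trans hx), zero_mul]
  have ac1 : AbsolutelyContinuousOnInterval (fun x => ∫ t in (0 : ℝ)..x, v t) (-S) S :=
    (locallyIntegrable_intervalIntegrable hv _ _).absolutelyContinuousOnInterval_intervalIntegral
      (by rw [Set.uIcc_of_le (by linarith)]; constructor <;> linarith)
  have ac2 : AbsolutelyContinuousOnInterval η (-S) S :=
    ContDiffOn.absolutelyContinuousOnInterval (hη.of_le (by simp)).contDiffOn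
  have key := ac1.integral_mul_deriv_eq_deriv_mul ac2
  have z1 : η S = 0 := hz S ((le_max_left _ _).trans (le_abs_self _))
  have z2 : η (-S) = 0 := hz (-S) (by rw [abs_neg]; exact (le_max_left _ _).trans (le_abs_self _))
  rw [z1, z2, mul_zero, mul_zero, sub_zero, zero_sub] at key
  -- Lebesgue differentiation identifies the derivative of the absolutely continuous primitive
  -- almost everywhere.
  have e1 : ∫ x in (-S)..S, deriv (fun x => ∫ t in (0 : ℝ)..x, v t) x * η x
      = ∫ x in (-S)..S, η x * v x := by
    apply intervalIntegral.integral_congr_ae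
    filter_upwards [LocallyIntegrable.ae_hasDerivAt_integral hv] with x hx _
    rw [(hx 0).deriv, mul_comm]
  rw [← e1, ← key]
  congr 1
  funext x
  rw [mul_comm]

/-- A function with a locally integrable weak derivative is a primitive of it. -/
lemma WeakDeriv.exists_primitive {u v : ℝ → ℝ} (h : WeakDeriv u v) (hu : LocallyIntegrable u)
    (hv : LocallyIntegrable v) : ∃ a : ℝ, u =ᵐ[volume] fun x => a + ∫ t in (0 : ℝ)..x, v t := by
  set V : ℝ → ℝ := fun x => ∫ t in (0 : ℝ)..x, v t
  have hV : LocallyIntegrable V := (continuous_primitive_of_locallyIntegrable hv 0).locallyIntegrable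
  have hw : LocallyIntegrable (fun x => u x - V x) := hu.sub hV
  obtain ⟨ρ⟩ : Nonempty (ContDiffBump (0 : ℝ)) := inferInstance
  have hρ1 : ContDiff ℝ (⊤ : ℕ∞) (ρ.normed volume) := ρ.contDiff_normed
  have hρs : HasCompactSupport (ρ.normed volume) := ρ.hasCompactSupport_normed
  have hρi : ∫ x, ρ.normed volume x = 1 := ρ.integral_normed
  set r := ρ.normed (volume : Measure ℝ)
  have hri := hρ1.continuous.integrable_of_hasCompactSupport (μ := volume) hρs
  -- u - V has weak derivative zero. The constant that it must equal is its average against the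
  -- unit-mass bump r.
  refine ⟨∫ x, r x * (u x - V x), ?_⟩
  set a := ∫ x, r x * (u x - V x)
  have hconst : LocallyIntegrable (fun _ : ℝ => a) := continuous_const.locallyIntegrable
  have key := ae_eq_of_integral_contDiff_smul_eq (μ := volume) hw hconst ?_
  · filter_upwards [key] with x hx
    linarith
  intro g hg hgs
  simp only [smul_eq_mul]
  have hgi := hg.continuous.integrable_of_hasCompactSupport (μ := volume) hgs
  rw [integral_mul_const]
  -- Removing from g its mean times r leaves a test function of zero mean, hence a derivative,
  -- against which u - V integrates to zero.
  obtain ⟨η, hη, hηs, hη'⟩ := exists_test_primitive (ψ := fun x => g x - (∫ t, g t) * r x)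
    (hg.sub (contDiff_const.mul hρ1)) (hgs.sub (HasCompactSupport.mul_left hρs)) (by
      rw [integral_sub hgi (hri.const_mul _), integral_const_mul, hρi, mul_one, sub_self])
  have e1 := h η hη hηs
  have e2 := weakDeriv_primitive hv η hη hηs
  have e3 : ∫ x, deriv η x * (u x - V x) = 0 := by
    simp only [mul_sub]
    have hd : Continuous (deriv η) := hη.continuous_deriv (by simp)
    rw [integral_sub (integrable_test_mul hd hηs.deriv hu) (integrable_test_mul hd hηs.deriv hV),
      e1, e2, sub_self]
  rw [hη'] at e3
  have e4 : ∀ x, (g x - (∫ t, g t) * r x) * (u x - V x)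
      = g x * (u x - V x) - (∫ t, g t) * (r x * (u x - V x)) := fun x => by ring
  simp only [e4] at e3
  rw [integral_sub (integrable_test_mul hg.continuous hgs hw)
    ((integrable_test_mul hρ1.continuous hρs hw).const_mul _), integral_const_mul, sub_eq_zero] at e3
  exact e3

lemma weakDeriv_of_hasDerivAt {u v : ℝ → ℝ} (h : ∀ x, HasDerivAt u (v x) x) (hv : Continuous v) :
    WeakDeriv u v := by
  intro η hη hs
  have hu : Continuous u := continuous_iff_continuousAt.2 fun x => (h x).continuousAt
  have hd : Continuous (deriv η) := hη.continuous_deriv (by simp)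
  have key := integral_mul_deriv_eq_deriv_mul_of_integrable (u := u) (u' := v) (v := η)
    (v' := deriv η) (fun x _ => h x) (fun x _ => (hη.differentiable (by simp) x).hasDerivAt)
    (by simpa [mul_comm] using! integrable_test_mul hd hs.deriv hu.locallyIntegrable)
    (by simpa [mul_comm] using! integrable_test_mul hη.continuous hs hv.locallyIntegrable)
    (by simpa [mul_comm] using! integrable_test_mul hη.continuous hs hu.locallyIntegrable)
  simpa only [mul_comm] using key

/-- A function whose weak derivative agrees almost everywhere with a continuous function has a
representative of class `C¹`. -/
lemma WeakDeriv.exists_hasDerivAt {u v V : ℝ → ℝ} (h : WeakDeriv u v) (hu : LocallyIntegrable u)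
    (hV : Continuous V) (hvV : v =ᵐ[volume] V) :
    ∃ U : ℝ → ℝ, u =ᵐ[volume] U ∧ ∀ x, HasDerivAt U (V x) x := by
  obtain ⟨a, ha⟩ := (h.congr (ae_eq_refl u) hvV).exists_primitive hu hV.locallyIntegrable
  exact ⟨_, ha, fun x => (intervalIntegral.integral_hasDerivAt_right (hV.intervalIntegrable _ _)
      (hV.stronglyMeasurableAtFilter _ _) hV.continuousAt).const_add _⟩

/-! ### The reduced potentials and the logarithmic derivative of the profile -/

/-- The potential `f'' / f` of the profile `f` as a function of `s = f ^ (2σ)`. -/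
noncomputable def potMinus (k m c s : ℝ) : ℝ := m + c / 2 * s - k * (1 - k) * s ^ 2

/-- The potential of the Schrödinger operator that annihilates `f'`, as a function of
`s = f ^ (2σ)`. -/
noncomputable def potPlus (σ k m c s : ℝ) : ℝ :=
  potMinus k m c s + 2 * σ * s * (c / 2 - 2 * k * (1 - k) * s)

/-- The properties of `p = f ^ (2σ)` and `h = f' / f`, for the solitary wave profile `f`, that
the spectral analysis uses. -/
structure IsProfile (σ k m c : ℝ) (p h : ℝ → ℝ) : Prop where
  σ_pos : 0 < σ
  k_mul : k * (2 * σ + 2) = 1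
  m_pos : 0 < m
  pos : ∀ y, 0 < p y
  hasDerivAt_pow : ∀ y, HasDerivAt p (2 * σ * h y * p y) y
  hasDerivAt_log : ∀ y, HasDerivAt h (potMinus k m c (p y) - h y ^ 2) y
  log_sq : ∀ y, h y ^ 2 = m + k * c * p y - k ^ 2 * p y ^ 2
  log_zero : h 0 = 0
  log_ne_zero : ∀ y, y ≠ 0 → h y ≠ 0
  potMinus_zero : potMinus k m c (p 0) ≠ 0
  integrable : Integrable p
  tendsto_atTop : Tendsto p atTop (𝓝 0)
  tendsto_atBot : Tendsto p atBot (𝓝 0)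

namespace IsProfile

variable {σ k m c : ℝ} {p h : ℝ → ℝ}

lemma k_pos (H : IsProfile σ k m c p h) : 0 < k := by
  have := H.σ_pos
  have h1 := H.k_mul
  by_contra hk
  nlinarith

lemma continuous_pow (H : IsProfile σ k m c p h) : Continuous p :=
  continuous_iff_continuousAt.2 fun y => (H.hasDerivAt_pow y).continuousAt

lemma continuous_log (H : IsProfile σ k m c p h) : Continuous h :=
  continuous_iff_continuousAt.2 fun y => (H.hasDerivAt_log y).continuousAt

lemma continuous_potMinus (H : IsProfile σ k m c p h) :
    Continuous fun y => potMinus k m c (p y) := by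
  have := H.continuous_pow
  unfold potMinus
  fun_prop

lemma continuous_potPlus (H : IsProfile σ k m c p h) :
    Continuous fun y => potPlus σ k m c (p y) := by
  have := H.continuous_pow
  unfold potPlus potMinus
  fun_prop

/-- Since h² ≥ 0, the identity `log_sq` forces k² p² ≤ m + kcp, and the quadratic term on the left
bounds p. -/
lemma exists_pow_le (H : IsProfile σ k m c p h) : ∃ C : ℝ, 0 < C ∧ ∀ y, |p y| ≤ C := by
  have hk := H.k_pos
  have hm := H.m_pos
  refine ⟨(m + k * |c| + 1) / k ^ 2 + 1, by positivity, fun y => ?_⟩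
  have hp := H.pos y
  rw [abs_of_pos hp]
  by_contra hlt
  rw [not_le] at hlt
  have h1 : 1 < p y := lt_of_le_of_lt (le_add_of_nonneg_left (by positivity)) hlt
  have h2 : (m + k * |c| + 1) < k ^ 2 * p y := by
    rw [← div_lt_iff₀' (by positivity)]
    linarith
  have h3 := H.log_sq y
  have h4 : k * c * p y ≤ k * |c| * p y := by
    gcongr
    exact le_abs_self c
  nlinarith [sq_nonneg (h y)]

lemma exists_log_le (H : IsProfile σ k m c p h) : ∃ C : ℝ, 0 < C ∧ ∀ y, |h y| ≤ C := by
  obtain ⟨C, hC, hp⟩ := H.exists_pow_le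
  have hm := H.m_pos
  have hk := H.k_pos
  -- The bound on h² is M = m + k|c|C. The added 1 makes M ≤ (M + 1)², so no square root is needed.
  refine ⟨m + k * |c| * C + 1, by positivity, fun y => ?_⟩
  have h1 := H.log_sq y
  have h2 : k * c * p y ≤ k * |c| * C := by
    have h0 := H.pos y
    have := (le_abs_self _).trans (hp y)
    gcongr
    exact le_abs_self c
  have h3 : 0 ≤ k * |c| * C := by positivity
  apply abs_le_of_sq_le_sq _ (by positivity)
  nlinarith [sq_nonneg (k * p y)]

/-- W - m is a polynomial in p without constant term. This makes the form coercive up to a term with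
integrable weight, which the minimization relies on. -/
lemma exists_potPlus_sub_le (H : IsProfile σ k m c p h) :
    ∃ C : ℝ, 0 < C ∧ ∀ y, |potPlus σ k m c (p y) - m| ≤ C * p y := by
  obtain ⟨C, hC, hp⟩ := H.exists_pow_le
  refine ⟨|c / 2 + σ * c| + |k * (1 - k) * (1 + 4 * σ)| * C + 1, by positivity, fun y => ?_⟩
  have h0 := H.pos y
  have e : potPlus σ k m c (p y) - m
      = ((c / 2 + σ * c) - k * (1 - k) * (1 + 4 * σ) * p y) * p y := by
    unfold potPlus potMinus
    ring
  rw [e, abs_mul, abs_of_pos h0]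
  gcongr
  refine (abs_sub _ _).trans ?_
  rw [abs_mul]
  have := hp y
  have : |k * (1 - k) * (1 + 4 * σ)| * |p y| ≤ |k * (1 - k) * (1 + 4 * σ)| * C := by gcongr
  linarith

lemma exists_potPlus_le (H : IsProfile σ k m c p h) :
    ∃ C : ℝ, 0 < C ∧ ∀ y, |potPlus σ k m c (p y)| ≤ C := by
  obtain ⟨C, hC, h1⟩ := H.exists_potPlus_sub_le
  obtain ⟨D, hD, h2⟩ := H.exists_pow_le
  refine ⟨C * D + |m|, by positivity, fun y => ?_⟩
  have := h1 y
  have h3 := (le_abs_self _).trans (h2 y)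
  have h4 : C * p y ≤ C * D := by gcongr
  have h5 := abs_sub_abs_le_abs_sub (potPlus σ k m c (p y)) m
  linarith

/-- This is the boundary term of Jacobi's factorization. It vanishes at infinity because h² tends to
m > 0 where p tends to 0. -/
lemma tendsto_jacobi {l : Filter ℝ} {a : ℝ → ℝ} (H : IsProfile σ k m c p h)
    (hp : Tendsto p l (𝓝 0)) (ha : Tendsto a l (𝓝 0)) :
    Tendsto (fun x => potMinus k m c (p x) * a x ^ 2 / h x) l (𝓝 0) := by
  have hm := H.m_pos
  have h1 : Tendsto (fun x => h x ^ 2) l (𝓝 m) := by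
    simp only [H.log_sq]
    have : Tendsto (fun x => m + k * c * p x - k ^ 2 * p x ^ 2) l
        (𝓝 (m + k * c * 0 - k ^ 2 * 0 ^ 2)) :=
      (tendsto_const_nhds.add (hp.const_mul _)).sub ((hp.pow 2).const_mul _)
    simpa using this
  have h2 : Tendsto (fun x => potMinus k m c (p x) * a x ^ 2 / h x ^ 2) l (𝓝 0) := by
    have : Tendsto (fun x => (m + c / 2 * p x - k * (1 - k) * p x ^ 2) * a x ^ 2 / h x ^ 2) l
        (𝓝 ((m + c / 2 * 0 - k * (1 - k) * 0 ^ 2) * 0 ^ 2 / m)) :=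
      ((((hp.const_mul _).const_add _).sub ((hp.pow 2).const_mul _)).mul (ha.pow 2)).div h1 hm.ne'
    simpa [potMinus] using this
  obtain ⟨C, hC, hb⟩ := H.exists_log_le
  have h3 : Tendsto (fun x => C * ‖potMinus k m c (p x) * a x ^ 2 / h x ^ 2‖) l (𝓝 0) := by
    simpa using h2.norm.const_mul C
  refine squeeze_zero_norm (fun x => ?_) h3
  -- Only the limit of h² is known, so the quotient by h is written as the bounded h times the
  -- quotient by h². This also holds where h = 0, since division by zero gives zero.
  have e : potMinus k m c (p x) * a x ^ 2 / h x
      = h x * (potMinus k m c (p x) * a x ^ 2 / h x ^ 2) := by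
    by_cases hx : h x = 0
    · simp [hx]
    · field_simp
  rw [e, norm_mul]
  gcongr
  exact hb x

/-- **Jacobi's inequality**: the quadratic form of the Schrödinger operator that annihilates `f'`
is nonnegative on functions that vanish at the only zero of `f'`. -/
lemma integral_nonneg_of_zero (H : IsProfile σ k m c p h) {a a₁ : ℝ → ℝ}
    (ha : ∀ x, HasDerivAt a (a₁ x) x) (hc : Continuous a₁) (h0 : a 0 = 0)
    (hi : Integrable fun x => a₁ x ^ 2 + potPlus σ k m c (p x) * a x ^ 2)
    (htop : Tendsto a atTop (𝓝 0)) (hbot : Tendsto a atBot (𝓝 0)) :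
    0 ≤ ∫ x, (a₁ x ^ 2 + potPlus σ k m c (p x) * a x ^ 2) := by
  set I : ℝ → ℝ := fun x => a₁ x ^ 2 + potPlus σ k m c (p x) * a x ^ 2
  set G : ℝ → ℝ := fun x => potMinus k m c (p x) * a x ^ 2 / h x
  have hac : Continuous a := continuous_iff_continuousAt.2 fun y => (ha y).continuousAt
  have hIc : Continuous I := by
    have := H.continuous_potPlus
    fun_prop
  have hV (x : ℝ) : HasDerivAt (fun y => potMinus k m c (p y))
      ((c / 2 - 2 * k * (1 - k) * p x) * (2 * σ * h x * p x)) x := by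
    have hp := H.hasDerivAt_pow x
    refine (((hp.const_mul (c / 2)).const_add m).sub
      ((hp.pow 2).const_mul (k * (1 - k)))).congr_deriv ?_
    push_cast
    ring
  -- With q = f''/f' = V/h, the Riccati equation q' = W - q² gives a'² + W a² = (a' - q a)² + (q
  -- a²)'. Here G is q a².
  have hG (x : ℝ) (hx : x ≠ 0) :
      HasDerivAt G (I x - (a₁ x - potMinus k m c (p x) / h x * a x) ^ 2) x := by
    have hn := H.log_ne_zero x hx
    refine (((hV x).mul ((ha x).pow 2)).div (H.hasDerivAt_log x) hn).congr_deriv ?_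
    simp only [I, potPlus, Pi.mul_apply, Pi.pow_apply]
    field_simp
    push_cast
    ring
  -- At the zero of h, V a²/h = V · a · (a/x)/(h/x), and h/x tends to h'(0) = V(p 0) ≠ 0 while a
  -- tends to a(0) = 0. The value G 0 = 0 given by division by zero is therefore the right one.
  have hG0 : ContinuousAt G 0 := by
    rw [continuousAt_iff_punctured_nhds]
    have e0 : G 0 = 0 := by simp [G, h0]
    rw [e0]
    have s1 := (hasDerivAt_iff_tendsto_slope.1 (ha 0))
    have s2 := (hasDerivAt_iff_tendsto_slope.1 (H.hasDerivAt_log 0))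
    have hne : potMinus k m c (p 0) - h 0 ^ 2 ≠ 0 := by
      rw [H.log_zero]
      simpa using H.potMinus_zero
    have s3 : Tendsto a (𝓝[≠] 0) (𝓝 0) := by
      have := hac.continuousAt (x := 0)
      rw [ContinuousAt, h0] at this
      exact this.mono_left nhdsWithin_le_nhds
    have s4 : Tendsto (fun x => potMinus k m c (p x)) (𝓝[≠] 0) (𝓝 (potMinus k m c (p 0))) :=
      (H.continuous_potMinus.continuousAt (x := 0)).mono_left nhdsWithin_le_nhds
    have s5 := s4.mul (s3.mul (s1.div s2 hne))
    rw [zero_mul, mul_zero] at s5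
    refine s5.congr' ?_
    filter_upwards [self_mem_nhdsWithin] with x hx
    have hx' : x ≠ 0 := hx
    have hn := H.log_ne_zero x hx
    simp only [slope_def_field, h0, H.log_zero, sub_zero, G, Pi.div_apply]
    field_simp
  have hGc : Continuous G := by
    rw [continuous_iff_continuousAt]
    intro x
    by_cases hx : x = 0
    · rw [hx]; exact hG0
    · exact (hG x hx).continuousAt
  have hJ (x : ℝ) : HasDerivAt (fun y => ∫ t in (0 : ℝ)..y, I t) (I x) x :=
    intervalIntegral.integral_hasDerivAt_right (hIc.intervalIntegrable _ _)
      (hIc.stronglyMeasurableAtFilter _ _) hIc.continuousAt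
  set Φ : ℝ → ℝ := fun x => (∫ t in (0 : ℝ)..x, I t) - G x
  have hΦc : Continuous Φ :=
    (continuous_iff_continuousAt.2 fun x => (hJ x).continuousAt).sub hGc
  have hΦ (x : ℝ) (hx : x ≠ 0) :
      HasDerivAt Φ ((a₁ x - potMinus k m c (p x) / h x * a x) ^ 2) x :=
    ((hJ x).sub (hG x hx)).congr_deriv (by ring)
  -- The factorization fails at 0, so Φ is monotone on each closed half-line separately, and
  -- continuity of G joins the two.
  have mono {s : Set ℝ} (hs : Convex ℝ s) (h0s : (0 : ℝ) ∉ interior s) : MonotoneOn Φ s := by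
    have hne : ∀ x ∈ interior s, x ≠ 0 := fun x hx hx0 => h0s (hx0 ▸ hx)
    apply monotoneOn_of_deriv_nonneg hs hΦc.continuousOn
    · exact fun x hx => (hΦ x (hne x hx)).differentiableAt.differentiableWithinAt
    · intro x hx
      rw [(hΦ x (hne x hx)).deriv]
      positivity
  have hR (R : ℝ) (hR : 0 ≤ R) : G R - G (-R) ≤ ∫ t in (-R)..R, I t := by
    have m1 := mono (convex_Ici 0) (by simp) (Set.self_mem_Ici) (Set.mem_Ici.2 hR) hR
    have m2 := mono (convex_Iic 0) (by simp) (Set.mem_Iic.2 (neg_nonpos.2 hR)) (Set.self_mem_Iic)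
      (neg_nonpos.2 hR)
    have m3 := intervalIntegral.integral_interval_sub_left
      (hIc.intervalIntegrable (μ := volume) 0 R) (hIc.intervalIntegrable (μ := volume) 0 (-R))
    simp only [Φ] at m1 m2
    linarith
  have t1 : Tendsto (fun R : ℝ => ∫ t in (-R)..R, I t) atTop (𝓝 (∫ x, I x)) :=
    intervalIntegral_tendsto_integral hi tendsto_neg_atTop_atBot tendsto_id
  have t2 : Tendsto (fun R => G R - G (-R)) atTop (𝓝 (0 - 0)) :=
    (H.tendsto_jacobi H.tendsto_atTop htop).sub
      ((H.tendsto_jacobi H.tendsto_atBot hbot).comp tendsto_neg_atTop_atBot)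
  rw [sub_zero] at t2
  exact le_of_tendsto_of_tendsto t2 t1 ((eventually_ge_atTop 0).mono hR)

end IsProfile

/-! ### The real first order system behind the eigenvalue equation -/

/-- Square integrable classical solutions of the eigenvalue equation for the linearized operator,
written as a first order system for the real part `a`, the imaginary part `b` and the auxiliary
functions `a₁ = a'` and `z = b' - h b + 2 σ k p a`. -/
structure IsSol (σ k m c : ℝ) (p h : ℝ → ℝ) (lam : ℝ) (a a₁ b z : ℝ → ℝ) : Prop where
  deriv_a : ∀ x, HasDerivAt a (a₁ x) x
  deriv_a₁ : ∀ x, HasDerivAt a₁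
    (potPlus σ k m c (p x) * a x + 2 * σ * k * p x * z x - lam * a x) x
  deriv_b : ∀ x, HasDerivAt b (z x + h x * b x - 2 * σ * k * p x * a x) x
  deriv_z : ∀ x, HasDerivAt z (-(h x * z x) - lam * b x) x
  memLp_a : MemLp a 2
  memLp_a₁ : MemLp a₁ 2
  memLp_b : MemLp b 2
  memLp_z : MemLp z 2

lemma memLp_bdd_mul_real {f g : ℝ → ℝ} {C : ℝ} (hg : MemLp g 2) (hf : Continuous f)
    (h : ∀ x, |f x| ≤ C) : MemLp (fun x => f x * g x) 2 :=
  hg.of_le_mul (c := C) (hf.aestronglyMeasurable.mul hg.1)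
    (Eventually.of_forall fun x => by
      rw [norm_mul]
      gcongr
      exact h x)

lemma integrable_mul_of_memLp {f g : ℝ → ℝ} (hf : MemLp f 2) (hg : MemLp g 2) :
    Integrable fun x => f x * g x := hf.integrable_mul hg

lemma integral_comb₃ {f g u : ℝ → ℝ} (hf : Integrable f) (hg : Integrable g) (hu : Integrable u)
    (r s t : ℝ) : ∫ x, (r * f x + s * g x + t * u x)
      = r * (∫ x, f x) + s * (∫ x, g x) + t * ∫ x, u x := by
  rw [integral_add (f := fun x => r * f x + s * g x) ((hf.const_mul r).add (hg.const_mul s))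
    (hu.const_mul t), integral_add (hf.const_mul r) (hg.const_mul s), integral_const_mul,
    integral_const_mul, integral_const_mul]

/-- Both a² and its derivative 2aa' are integrable, so a² has a limit at each end and that limit is
zero. -/
lemma tendsto_zero_of_memLp {l : Filter ℝ} (hl : l = atTop ∨ l = atBot) {a a₁ : ℝ → ℝ}
    (hd : ∀ x, HasDerivAt a (a₁ x) x) (ha : MemLp a 2) (ha₁ : MemLp a₁ 2) : Tendsto a l (𝓝 0) := by
  have h1 (x : ℝ) : HasDerivAt (fun x => a x ^ 2) (2 * (a x * a₁ x)) x :=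
    ((hd x).pow 2).congr_deriv (by push_cast; ring)
  have i1 : Integrable fun x => 2 * (a x * a₁ x) := (integrable_mul_of_memLp ha ha₁).const_mul 2
  have i2 : Integrable fun x => a x ^ 2 := ha.integrable_sq
  have h2 : Tendsto (fun x => a x ^ 2) l (𝓝 0) := by
    rcases hl with rfl | rfl
    · exact tendsto_zero_of_hasDerivAt_of_integrableOn_Ioi (a := 0) (fun x _ => h1 x)
        i1.integrableOn i2.integrableOn
    · exact tendsto_zero_of_hasDerivAt_of_integrableOn_Iic (a := 0) (fun x _ => h1 x)
        i1.integrableOn i2.integrableOn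
  have h3 := h2.sqrt
  simp only [Real.sqrt_sq_eq_abs, Real.sqrt_zero] at h3
  exact tendsto_zero_iff_abs_tendsto_zero _ |>.2 h3

namespace IsSol

variable {σ k m c lam mu : ℝ} {p h a a₁ b z a' a₁' b' z' : ℝ → ℝ}

lemma comb (S : IsSol σ k m c p h lam a a₁ b z) (S' : IsSol σ k m c p h lam a' a₁' b' z')
    (s t : ℝ) : IsSol σ k m c p h lam (fun x => s * a x + t * a' x) (fun x => s * a₁ x + t * a₁' x)
      (fun x => s * b x + t * b' x) (fun x => s * z x + t * z' x) where
  deriv_a x := ((S.deriv_a x).const_mul s).add ((S'.deriv_a x).const_mul t)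
  deriv_a₁ x := (((S.deriv_a₁ x).const_mul s).add ((S'.deriv_a₁ x).const_mul t)).congr_deriv
    (by ring)
  deriv_b x := (((S.deriv_b x).const_mul s).add ((S'.deriv_b x).const_mul t)).congr_deriv
    (by ring)
  deriv_z x := (((S.deriv_z x).const_mul s).add ((S'.deriv_z x).const_mul t)).congr_deriv
    (by ring)
  memLp_a := (S.memLp_a.const_mul s).add (S'.memLp_a.const_mul t)
  memLp_a₁ := (S.memLp_a₁.const_mul s).add (S'.memLp_a₁.const_mul t)
  memLp_b := (S.memLp_b.const_mul s).add (S'.memLp_b.const_mul t)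
  memLp_z := (S.memLp_z.const_mul s).add (S'.memLp_z.const_mul t)

lemma continuous_a (S : IsSol σ k m c p h lam a a₁ b z) : Continuous a :=
  continuous_iff_continuousAt.2 fun y => (S.deriv_a y).continuousAt

lemma continuous_a₁ (S : IsSol σ k m c p h lam a a₁ b z) : Continuous a₁ :=
  continuous_iff_continuousAt.2 fun y => (S.deriv_a₁ y).continuousAt

lemma continuous_b (S : IsSol σ k m c p h lam a a₁ b z) : Continuous b :=
  continuous_iff_continuousAt.2 fun y => (S.deriv_b y).continuousAt

lemma memLp_potPlus_mul (H : IsProfile σ k m c p h) (ha : MemLp a 2) :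
    MemLp (fun x => potPlus σ k m c (p x) * a x) 2 := by
  obtain ⟨C, _, hC⟩ := H.exists_potPlus_le
  exact memLp_bdd_mul_real ha H.continuous_potPlus hC

lemma memLp_log_mul (H : IsProfile σ k m c p h) (ha : MemLp a 2) :
    MemLp (fun x => h x * a x) 2 := by
  obtain ⟨C, _, hC⟩ := H.exists_log_le
  exact memLp_bdd_mul_real ha H.continuous_log hC

lemma memLp_pow_mul (H : IsProfile σ k m c p h) (ha : MemLp a 2) :
    MemLp (fun x => p x * a x) 2 := by
  obtain ⟨C, _, hC⟩ := H.exists_pow_le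
  exact memLp_bdd_mul_real ha H.continuous_pow hC

lemma memLp_coupling_mul (H : IsProfile σ k m c p h) (ha : MemLp a 2) :
    MemLp (fun x => 2 * σ * k * p x * a x) 2 := by
  simpa only [mul_assoc] using! (memLp_pow_mul H ha).const_mul (2 * σ * k)

lemma integrable_form (H : IsProfile σ k m c p h) (ha : MemLp a 2) (ha₁ : MemLp a₁ 2)
    (hz : MemLp z 2) (ha' : MemLp a' 2) (ha₁' : MemLp a₁' 2) (hz' : MemLp z' 2) :
    Integrable fun x => a₁ x * a₁' x + potPlus σ k m c (p x) * a x * a' x + z x * z' x :=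
  ((integrable_mul_of_memLp ha₁ ha₁').add
    (integrable_mul_of_memLp (memLp_potPlus_mul H ha) ha')).add (integrable_mul_of_memLp hz hz')

/-- The quadratic form of the linearized operator, paired with an eigenfunction. -/
lemma form_eq (H : IsProfile σ k m c p h) (S : IsSol σ k m c p h lam a a₁ b z)
    (S' : IsSol σ k m c p h mu a' a₁' b' z') :
    ∫ x, (a₁ x * a₁' x + potPlus σ k m c (p x) * a x * a' x + z x * z' x)
      = lam * ∫ x, (a x * a' x + b x * b' x) := by
  -- Integration by parts: in the derivative of a₁a' + zb' (primes denote the second solution) the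
  -- two coupling terms 2σkp z a' cancel, and so do the two terms h z b'.
  have hd (x : ℝ) : HasDerivAt (fun x => a₁ x * a' x + z x * b' x)
      ((a₁ x * a₁' x + potPlus σ k m c (p x) * a x * a' x + z x * z' x)
        - lam * (a x * a' x + b x * b' x)) x :=
    (((S.deriv_a₁ x).mul (S'.deriv_a x)).add ((S.deriv_z x).mul (S'.deriv_b x))).congr_deriv
      (by ring)
  have i1 := integrable_form H S.memLp_a S.memLp_a₁ S.memLp_z S'.memLp_a S'.memLp_a₁ S'.memLp_z
  have i2 : Integrable fun x => a x * a' x + b x * b' x :=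
    (integrable_mul_of_memLp S.memLp_a S'.memLp_a).add
      (integrable_mul_of_memLp S.memLp_b S'.memLp_b)
  have i3 : Integrable fun x => a₁ x * a' x + z x * b' x :=
    (integrable_mul_of_memLp S.memLp_a₁ S'.memLp_a).add
      (integrable_mul_of_memLp S.memLp_z S'.memLp_b)
  have := integral_eq_zero_of_hasDerivAt_of_integrable hd (i1.sub (i2.const_mul lam)) i3
  rw [integral_sub i1 (i2.const_mul lam), integral_const_mul, sub_eq_zero] at this
  exact this

/-- Jacobi's inequality handles a, and z contributes a square. No equation is imposed on z, so the
bound also applies to combinations of eigenfunctions for different eigenvalues. -/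
lemma form_nonneg (H : IsProfile σ k m c p h) (hd : ∀ x, HasDerivAt a (a₁ x) x)
    (hc : Continuous a₁) (ha : MemLp a 2) (ha₁ : MemLp a₁ 2) (hz : MemLp z 2) (h0 : a 0 = 0) :
    0 ≤ ∫ x, (a₁ x * a₁ x + potPlus σ k m c (p x) * a x * a x + z x * z x) := by
  have i1 : Integrable fun x => a₁ x ^ 2 + potPlus σ k m c (p x) * a x ^ 2 := by
    refine ((integrable_mul_of_memLp ha₁ ha₁).add
      (integrable_mul_of_memLp (memLp_potPlus_mul H ha) ha)).congr (Eventually.of_forall fun x => ?_)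
    simp only [Pi.add_apply]
    ring
  have i2 : Integrable fun x => z x ^ 2 := hz.integrable_sq
  have h1 := H.integral_nonneg_of_zero hd hc h0 i1
    (tendsto_zero_of_memLp (Or.inl rfl) hd ha ha₁) (tendsto_zero_of_memLp (Or.inr rfl) hd ha ha₁)
  have h2 : 0 ≤ ∫ x, z x ^ 2 := integral_nonneg fun x => sq_nonneg _
  have e : ∀ x, a₁ x * a₁ x + potPlus σ k m c (p x) * a x * a x + z x * z x
      = (a₁ x ^ 2 + potPlus σ k m c (p x) * a x ^ 2) + z x ^ 2 := fun x => by ring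
  simp only [e]
  rw [integral_add i1 i2]
  exact add_nonneg h1 h2

lemma eq_zero_of_integral (S : IsSol σ k m c p h lam a a₁ b z)
    (h0 : ∫ x, (a x * a x + b x * b x) ≤ 0) : a = 0 ∧ b = 0 := by
  have i2 : Integrable fun x => a x * a x + b x * b x :=
    (integrable_mul_of_memLp S.memLp_a S.memLp_a).add
      (integrable_mul_of_memLp S.memLp_b S.memLp_b)
  have hnn : 0 ≤ fun x => a x * a x + b x * b x :=
    fun x => add_nonneg (mul_self_nonneg _) (mul_self_nonneg _)
  have h1 := (integral_eq_zero_iff_of_nonneg hnn i2).1 (le_antisymm h0 (integral_nonneg hnn))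
  have hca := S.continuous_a
  have hcb := S.continuous_b
  have h2 : (fun x => a x * a x + b x * b x) = 0 :=
    (Continuous.ae_eq_iff_eq volume (by fun_prop) continuous_zero).1 h1
  constructor <;>
  · funext x
    have := congrFun h2 x
    simp only [Pi.zero_apply] at this ⊢
    nlinarith [mul_self_nonneg (a x), mul_self_nonneg (b x)]

/-- On an eigenfunction the form equals lam times the squared norm, which is nonpositive, while a(0)
= 0 makes it nonnegative. Thus eigenfunctions for lam < 0 are determined by the single number a(0).
-/
lemma eq_zero_of_zero (H : IsProfile σ k m c p h) (S : IsSol σ k m c p h lam a a₁ b z)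
    (hl : lam < 0) (h0 : a 0 = 0) : a = 0 ∧ b = 0 := by
  apply S.eq_zero_of_integral
  have h1 := form_nonneg H S.deriv_a S.continuous_a₁ S.memLp_a S.memLp_a₁ S.memLp_z h0
  rw [form_eq H S S] at h1
  nlinarith

/-- Eigenfunctions for different negative eigenvalues cannot both be nonzero. -/
lemma eq_zero_or_eq_zero (H : IsProfile σ k m c p h) (S : IsSol σ k m c p h lam a a₁ b z)
    (S' : IsSol σ k m c p h mu a' a₁' b' z') (hl : lam < 0) (hm : mu < 0) (hne : lam ≠ mu) :
    (a = 0 ∧ b = 0) ∨ (a' = 0 ∧ b' = 0) := by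
  by_cases h0 : a 0 = 0
  · exact Or.inl (S.eq_zero_of_zero H hl h0)
  right
  apply S'.eq_zero_of_integral
  -- The coefficients are chosen so that s a + t a' vanishes at 0.
  set s := a' 0
  set t := -a 0
  have ht : t ≠ 0 := neg_ne_zero.2 h0
  have c1 := S.continuous_a₁
  have c2 := S'.continuous_a₁
  have h1 := form_nonneg H (a := fun x => s * a x + t * a' x) (a₁ := fun x => s * a₁ x + t * a₁' x)
    (z := fun x => s * z x + t * z' x)
    (fun x => ((S.deriv_a x).const_mul s).add ((S'.deriv_a x).const_mul t)) (by fun_prop)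
    ((S.memLp_a.const_mul s).add (S'.memLp_a.const_mul t))
    ((S.memLp_a₁.const_mul s).add (S'.memLp_a₁.const_mul t))
    ((S.memLp_z.const_mul s).add (S'.memLp_z.const_mul t)) (by simp only [s, t]; ring)
  have i11 := integrable_form H S.memLp_a S.memLp_a₁ S.memLp_z S.memLp_a S.memLp_a₁ S.memLp_z
  have i12 := integrable_form H S.memLp_a S.memLp_a₁ S.memLp_z S'.memLp_a S'.memLp_a₁ S'.memLp_z
  have i22 := integrable_form H S'.memLp_a S'.memLp_a₁ S'.memLp_z S'.memLp_a S'.memLp_a₁ S'.memLp_z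
  have e : ∀ x, (s * a₁ x + t * a₁' x) * (s * a₁ x + t * a₁' x)
        + potPlus σ k m c (p x) * (s * a x + t * a' x) * (s * a x + t * a' x)
        + (s * z x + t * z' x) * (s * z x + t * z' x)
      = s ^ 2 * (a₁ x * a₁ x + potPlus σ k m c (p x) * a x * a x + z x * z x)
        + 2 * s * t * (a₁ x * a₁' x + potPlus σ k m c (p x) * a x * a' x + z x * z' x)
        + t ^ 2 * (a₁' x * a₁' x + potPlus σ k m c (p x) * a' x * a' x + z' x * z' x) :=
    fun x => by ring
  simp only [e] at h1
  rw [integral_comb₃ i11 i12 i22, form_eq H S S, form_eq H S S', form_eq H S' S'] at h1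
  -- The form is symmetric, so eigenfunctions for lam ≠ mu are orthogonal and the cross term drops
  -- out.
  have hsymm : lam * ∫ x, (a x * a' x + b x * b' x) = mu * ∫ x, (a x * a' x + b x * b' x) := by
    rw [← form_eq H S S']
    have := form_eq H S' S
    simp only [mul_comm (a' _) (a _), mul_comm (b' _) (b _)] at this
    rw [← this]
    congr 1
    funext x
    ring
  have h12 : ∫ x, (a x * a' x + b x * b' x) = 0 := by
    have : (lam - mu) * ∫ x, (a x * a' x + b x * b' x) = 0 := by linarith
    exact (mul_eq_zero.1 this).resolve_left (sub_ne_zero.2 hne)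
  rw [h12] at h1
  have n1 : 0 ≤ ∫ x, (a x * a x + b x * b x) :=
    integral_nonneg fun x => add_nonneg (mul_self_nonneg _) (mul_self_nonneg _)
  by_contra hcon
  rw [not_le] at hcon
  have ht2 : 0 < t ^ 2 := by positivity
  have q1 : s ^ 2 * (lam * ∫ x, (a x * a x + b x * b x)) ≤ 0 :=
    mul_nonpos_of_nonneg_of_nonpos (sq_nonneg s) (mul_nonpos_of_nonpos_of_nonneg hl.le n1)
  have q2 : t ^ 2 * (mu * ∫ x, (a' x * a' x + b' x * b' x)) < 0 :=
    mul_neg_of_pos_of_neg ht2 (mul_neg_of_neg_of_pos hm hcon)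
  linarith

end IsSol

/-! ### Minimization of a quadratic form -/

/-- If a symmetric bilinear form is negative somewhere, bounded below relative to a positive
semidefinite form and satisfies a compactness condition of Palais-Smale type, then it attains its
minimum on the unit sphere, and the minimizer satisfies the Euler-Lagrange equation. -/
lemma exists_eigenvector_of_compactness {V : Type*} [AddCommGroup V] [Module ℝ V]
    (F N : V →ₗ[ℝ] V →ₗ[ℝ] ℝ) (hF : ∀ v w, F v w = F w v) (hN : ∀ v w, N v w = N w v)
    (hN0 : ∀ v, 0 ≤ N v v) (hneg : ∃ v, F v v < 0) (hbdd : ∃ C, ∀ v, -(C * N v v) ≤ F v v)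
    (hcpt : ∀ lam : ℝ, lam < 0 → ∀ v : ℕ → V, (∀ n, N (v n) (v n) = 1) →
      (∃ B, ∀ n, F (v n) (v n) ≤ B) →
      (∀ ε > 0, ∃ n₀, ∀ i ≥ n₀, ∀ j ≥ n₀,
        F (v i - v j) (v i - v j) - lam * N (v i - v j) (v i - v j) < ε) →
      ∃ φ : ℕ → ℕ, StrictMono φ ∧ ∃ u, N u u = 1 ∧
        Tendsto (fun n => F (v (φ n)) (v (φ n))) atTop (𝓝 (F u u))) :
    ∃ lam < 0, ∃ u, N u u = 1 ∧ ∀ w, F u w = lam * N u w := by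
  obtain ⟨C, hC⟩ := hbdd
  obtain ⟨v₀, hv₀⟩ := hneg
  set S : Set ℝ := {x | ∃ v, N v v = 1 ∧ F v v = x}
  have scale (v : V) (hv : 0 < N v v) : F v v / N v v ∈ S := by
    have hs : √(N v v) ≠ 0 := (Real.sqrt_pos.2 hv).ne'
    have h2 : √(N v v) * √(N v v) = N v v := Real.mul_self_sqrt hv.le
    refine ⟨(√(N v v))⁻¹ • v, ?_, ?_⟩
    · simp only [map_smul, LinearMap.smul_apply, smul_eq_mul]
      rw [← h2]
      field_simp
      rw [Real.sqrt_sq (Real.sqrt_nonneg _)]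
    · simp only [map_smul, LinearMap.smul_apply, smul_eq_mul]
      nth_rw 3 [← h2]
      field_simp
  have hN₀ : 0 < N v₀ v₀ := by
    refine lt_of_le_of_ne (hN0 _) fun h => ?_
    have := hC v₀
    rw [← h] at this
    linarith
  have hbelow : BddBelow S := by
    refine ⟨-C, ?_⟩
    rintro _ ⟨v, hv, rfl⟩
    have := hC v
    rw [hv] at this
    linarith
  set lam := sInf S
  have hlam : lam < 0 := (csInf_le hbelow (scale v₀ hN₀)).trans_lt (div_neg_of_neg_of_pos hv₀ hN₀)
  -- When N v v = 0 the quotient is meaningless, but the lower bound relative to N still gives F v v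
  -- ≥ 0.
  have hG (v : V) : 0 ≤ F v v - lam * N v v := by
    rcases (hN0 v).eq_or_lt with h | h
    · have := hC v
      rw [← h] at this ⊢
      linarith
    · have := csInf_le hbelow (scale v h)
      rw [le_div_iff₀ h] at this
      linarith
  obtain ⟨s, _, hs, hsS⟩ := exists_seq_tendsto_sInf ⟨_, scale v₀ hN₀⟩ hbelow
  choose v hv1 hv2 using hsS
  -- Parallelogram identity for G = F - lam N: G(v_i - v_j) = 2G(v_i) + 2G(v_j) - G(v_i + v_j),
  -- where the last term is nonpositive and the first two tend to zero along a minimizing sequence.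
  have hps : ∀ ε > 0, ∃ n₀, ∀ i ≥ n₀, ∀ j ≥ n₀,
      F (v i - v j) (v i - v j) - lam * N (v i - v j) (v i - v j) < ε := by
    intro ε hε
    obtain ⟨n₀, hn₀⟩ := eventually_atTop.1 (hs.eventually (gt_mem_nhds (show lam < lam + ε / 4 by
      linarith)))
    refine ⟨n₀, fun i hi j hj => ?_⟩
    have h1 := hn₀ i hi
    have h2 := hn₀ j hj
    rw [← hv2] at h1 h2
    have h3 := hG (v i + v j)
    simp only [map_add, map_sub, LinearMap.add_apply, LinearMap.sub_apply, hv1] at h3 ⊢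
    linarith
  obtain ⟨B, hB⟩ := hs.bddAbove_range
  obtain ⟨φ, hφ, u, hu1, hu2⟩ := hcpt lam hlam v hv1
    ⟨B, fun n => by rw [hv2]; exact hB (Set.mem_range_self n)⟩ hps
  have hFu : F u u = lam := by
    refine tendsto_nhds_unique hu2 ?_
    simp only [hv2]
    exact hs.comp hφ.tendsto_atTop
  refine ⟨lam, hlam, u, hu1, fun w => ?_⟩
  have key (t : ℝ) : 0 ≤ t * (2 * (F u w - lam * N u w)) + t ^ 2 * (F w w - lam * N w w) := by
    have := hG (u + t • w)
    simp only [map_add, LinearMap.add_apply, map_smul, LinearMap.smul_apply, smul_eq_mul, hFu, hu1,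
      hF w u, hN w u] at this
    linarith
  set β := F u w - lam * N u w
  set γ := F w w - lam * N w w
  have hγ : 0 ≤ γ := hG w
  have hβ : β = 0 := by
    by_contra hb
    -- The quadratic 2βt + γt² is negative at this t unless β = 0. The optimal t would be -β/γ, and
    -- γ + 1 avoids the case γ = 0.
    have h1 := key (-β / (γ + 1))
    have e : -β / (γ + 1) * (2 * β) + (-β / (γ + 1)) ^ 2 * γ
        = -(β ^ 2 * (γ + 2)) / (γ + 1) ^ 2 := by
      field_simp
      ring
    rw [e] at h1
    have : -(β ^ 2 * (γ + 2)) / (γ + 1) ^ 2 < 0 := by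
      apply div_neg_of_neg_of_pos _ (by positivity)
      have : 0 < β ^ 2 * (γ + 2) := by positivity
      linarith
    linarith
  exact sub_eq_zero.1 hβ

/-! ### Local compactness of bounded sequences in `H¹` -/

/-- `L²(ℝ; ℝ)`. -/
abbrev L2R : Type := Lp ℝ 2 (volume : Measure ℝ)

lemma locallyIntegrable_L2R (f : L2R) : LocallyIntegrable f :=
  (Lp.memLp f).locallyIntegrable (by norm_num)

lemma norm_sq_L2R (f : L2R) : ‖f‖ ^ 2 = ∫ x, f x ^ 2 := by
  rw [← real_inner_self_eq_norm_sq, L2.inner_def]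
  congr 1
  funext x
  simp [sq]

/-- Cauchy–Schwarz against the indicator of the interval. It makes functions in H¹ Hölder continuous
of exponent 1/2. -/
lemma abs_intervalIntegral_le (f : L2R) (x y : ℝ) :
    |∫ t in x..y, f t| ≤ ‖f‖ * √|y - x| := by
  rw [intervalIntegral.abs_intervalIntegral_eq]
  have hfin : volume (Set.uIoc x y) ≠ ⊤ := by
    rw [Set.uIoc, Real.volume_Ioc]
    exact ENNReal.ofReal_ne_top
  rw [← L2.inner_indicatorConstLp_one (𝕜 := ℝ) measurableSet_uIoc hfin f]
  refine (abs_real_inner_le_norm _ _).trans ?_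
  rw [mul_comm]
  gcongr
  rw [norm_indicatorConstLp (by norm_num) (by norm_num)]
  simp only [norm_one, one_mul, ENNReal.toReal_ofNat]
  rw [← Real.sqrt_eq_rpow, measureReal_def, Set.uIoc, Real.volume_Ioc,
    ENNReal.toReal_ofReal (by simp), max_sub_min_eq_abs]

/-- A continuous representative of a function in `H¹`, with the usual bounds. -/
lemma exists_continuous_rep {u v : L2R} (h : WeakDeriv u v) {A : ℝ} (hu : ‖u‖ ≤ A) (hv : ‖v‖ ≤ A) :
    ∃ U : ℝ → ℝ, (u : ℝ → ℝ) =ᵐ[volume] U ∧ (∀ x y, |U y - U x| ≤ A * √|y - x|) ∧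
      Continuous U ∧ ∀ x, |U x| ≤ 2 * A := by
  obtain ⟨a, ha⟩ := h.exists_primitive (locallyIntegrable_L2R u) (locallyIntegrable_L2R v)
  have hA : 0 ≤ A := (norm_nonneg _).trans hu
  set U : ℝ → ℝ := fun x => a + ∫ t in (0 : ℝ)..x, v t
  have hUc : Continuous U :=
    (continuous_primitive_of_locallyIntegrable (locallyIntegrable_L2R v) 0).const_add a
  have hH (x y : ℝ) : |U y - U x| ≤ A * √|y - x| := by
    have e : U y - U x = ∫ t in x..y, v t := by
      have := intervalIntegral.integral_interval_sub_left
        (locallyIntegrable_intervalIntegrable (locallyIntegrable_L2R v) 0 y)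
        (locallyIntegrable_intervalIntegrable (locallyIntegrable_L2R v) 0 x)
      rw [← this]
      ring
    rw [e]
    refine (abs_intervalIntegral_le v x y).trans ?_
    gcongr
  refine ⟨U, ha, hH, hUc, fun x => ?_⟩
  have hU2 : Integrable fun y => U y ^ 2 :=
    (Lp.memLp u).integrable_sq.congr (by filter_upwards [ha] with y hy; rw [hy])
  have hUn : ∫ y, U y ^ 2 ≤ A ^ 2 := by
    have : ∫ y, U y ^ 2 = ‖u‖ ^ 2 := by
      rw [norm_sq_L2R]
      exact integral_congr_ae (by filter_upwards [ha] with y hy; rw [hy])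
    rw [this]
    gcongr
  -- On an interval of length one U varies by at most A, so averaging U(x)² ≤ 2U(y)² + 2A² over it
  -- gives U(x)² ≤ 4A².
  have h1 : ∫ y in x..(x + 1), U x ^ 2 ≤ ∫ y in x..(x + 1), (2 * U y ^ 2 + 2 * A ^ 2) := by
    apply intervalIntegral.integral_mono_on (by linarith) (by simp)
    · apply Continuous.intervalIntegrable
      fun_prop
    · intro y hy
      have h2 := hH x y
      have h3 : √|y - x| ≤ 1 := by
        rw [Real.sqrt_le_one, abs_of_nonneg (by linarith [hy.1])]
        linarith [hy.2]
      have h4 : |U y - U x| ≤ A := h2.trans (mul_le_of_le_one_right hA h3)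
      have h5 : (U y - U x) ^ 2 ≤ A ^ 2 := sq_le_sq' (abs_le.1 h4).1 (abs_le.1 h4).2
      nlinarith [sq_nonneg (2 * U y - U x)]
  have h2 : ∫ y in x..(x + 1), U y ^ 2 ≤ ∫ y, U y ^ 2 := by
    rw [intervalIntegral.integral_of_le (by linarith)]
    exact setIntegral_le_integral hU2 (Eventually.of_forall fun y => sq_nonneg _)
  rw [intervalIntegral.integral_add (by apply Continuous.intervalIntegrable; fun_prop) (by simp),
    intervalIntegral.integral_const_mul] at h1
  simp only [intervalIntegral.integral_const, add_sub_cancel_left, one_smul] at h1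
  apply abs_le_of_sq_le_sq _ (by positivity)
  nlinarith

/-- A sequence bounded in `H¹` has a subsequence that converges in `L²` with an integrable
weight. -/
lemma exists_subseq_weighted_cauchy {p : ℝ → ℝ} (hpc : Continuous p) (hp0 : ∀ x, 0 < p x)
    (hpi : Integrable p) {u v : ℕ → L2R} (h : ∀ n, WeakDeriv (u n) (v n)) {A : ℝ}
    (hu : ∀ n, ‖u n‖ ≤ A) (hv : ∀ n, ‖v n‖ ≤ A) :
    ∃ φ : ℕ → ℕ, StrictMono φ ∧ ∀ ε > 0, ∃ n₀, ∀ i ≥ n₀, ∀ j ≥ n₀,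
      ∫ x, p x * (u (φ i) x - u (φ j) x) ^ 2 < ε := by
  choose U hU hH hUc hUb using fun n => exists_continuous_rep (h n) (hu n) (hv n)
  have hA : 0 ≤ A := (norm_nonneg _).trans (hu 0)
  -- Compactness of a countable product replaces the diagonal argument and gives a subsequence
  -- converging at every rational. The uniform Hölder bound extends the convergence to every real.
  have hcomp : IsCompact (Set.univ.pi fun _ : ℚ => Set.Icc (-(2 * A)) (2 * A)) :=
    isCompact_univ_pi fun _ => isCompact_Icc
  obtain ⟨g, _, φ, hφ, hg⟩ := hcomp.tendsto_subseq (x := fun n (q : ℚ) => U n q)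
    fun n q _ => abs_le.1 (hUb n q)
  have hgq (q : ℚ) : Tendsto (fun n => U (φ n) q) atTop (𝓝 (g q)) := (tendsto_pi_nhds.1 hg) q
  have hcau (x : ℝ) : ∃ l, Tendsto (fun n => U (φ n) x) atTop (𝓝 l) := by
    refine cauchySeq_tendsto_of_complete (Metric.cauchySeq_iff'.2 fun ε hε => ?_)
    have hδ : 0 < (ε / (4 * (A + 1))) ^ 2 := by positivity
    obtain ⟨q, hq1, hq2⟩ := exists_rat_btwn (show x < x + (ε / (4 * (A + 1))) ^ 2 by linarith)
    have hbd (n : ℕ) : |U n q - U n x| < ε / 4 := by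
      refine (hH n x q).trans_lt ?_
      have h1 : √|(q : ℝ) - x| ≤ ε / (4 * (A + 1)) := by
        rw [Real.sqrt_le_left (by positivity), abs_of_pos (by linarith)]
        linarith
      calc A * √|(q : ℝ) - x| ≤ A * (ε / (4 * (A + 1))) := by gcongr
        _ < (A + 1) * (ε / (4 * (A + 1))) := by
          apply mul_lt_mul_of_pos_right (by linarith) (by positivity)
        _ = ε / 4 := by field_simp
    obtain ⟨n₀, hn₀⟩ := Metric.cauchySeq_iff'.1 (hgq q).cauchySeq (ε / 4) (by positivity)
    refine ⟨n₀, fun n hn => ?_⟩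
    have h1 := hn₀ n hn
    have h2 := hbd (φ n)
    have h3 := hbd (φ n₀)
    rw [Real.dist_eq] at h1 ⊢
    rw [abs_lt] at *
    constructor <;> linarith [h1.1, h1.2, h2.1, h2.2, h3.1, h3.2]
  choose l hl using hcau
  have hlb (x : ℝ) : |l x| ≤ 2 * A :=
    le_of_tendsto (hl x).abs (Eventually.of_forall fun n => hUb _ x)
  have hlm : Measurable l :=
    measurable_of_tendsto_metrizable (fun n => (hUc (φ n)).measurable) (tendsto_pi_nhds.2 hl)
  have hdom (n : ℕ) (x : ℝ) : ‖p x * (U (φ n) x - l x) ^ 2‖ ≤ p x * (4 * A) ^ 2 := by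
    rw [norm_mul, Real.norm_of_nonneg (hp0 x).le, norm_pow]
    have h1 := (hp0 x).le
    gcongr
    rw [Real.norm_eq_abs]
    refine (abs_sub _ _).trans ?_
    linarith [hUb (φ n) x, hlb x]
  have hmeas (n : ℕ) : AEStronglyMeasurable (fun x => p x * (U (φ n) x - l x) ^ 2) volume :=
    (hpc.measurable.mul (((hUc (φ n)).measurable.sub hlm).pow_const 2)).aestronglyMeasurable
  have hint (n : ℕ) : Integrable fun x => p x * (U (φ n) x - l x) ^ 2 :=
    (hpi.mul_const _).mono' (hmeas n) (Eventually.of_forall (hdom n))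
  -- Dominated convergence with majorant p (4A)², integrable because p is.
  have hlim : Tendsto (fun n => ∫ x, p x * (U (φ n) x - l x) ^ 2) atTop (𝓝 0) := by
    have := tendsto_integral_of_dominated_convergence (F := fun n x => p x * (U (φ n) x - l x) ^ 2)
      (f := fun _ => 0) (fun x => p x * (4 * A) ^ 2) hmeas (hpi.mul_const _)
      (fun n => Eventually.of_forall (hdom n)) (Eventually.of_forall fun x => by
        have : Tendsto (fun n => p x * (U (φ n) x - l x) ^ 2) atTop
            (𝓝 (p x * (l x - l x) ^ 2)) := (((hl x).sub_const _).pow 2).const_mul _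
        simpa using this)
    simpa using this
  refine ⟨φ, hφ, fun ε hε => ?_⟩
  obtain ⟨n₀, hn₀⟩ := eventually_atTop.1 (hlim.eventually (gt_mem_nhds (show 0 < ε / 4 by
    linarith)))
  refine ⟨n₀, fun i hi j hj => ?_⟩
  have e : ∫ x, p x * (u (φ i) x - u (φ j) x) ^ 2 = ∫ x, p x * (U (φ i) x - U (φ j) x) ^ 2 :=
    integral_congr_ae (by filter_upwards [hU (φ i), hU (φ j)] with x h1 h2; rw [h1, h2])
  rw [e]
  have hle : ∫ x, p x * (U (φ i) x - U (φ j) x) ^ 2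
      ≤ ∫ x, (2 * (p x * (U (φ i) x - l x) ^ 2) + 2 * (p x * (U (φ j) x - l x) ^ 2)) := by
    apply integral_mono_of_nonneg
    · exact Eventually.of_forall fun x => mul_nonneg (hp0 x).le (sq_nonneg _)
    · exact ((hint i).const_mul 2).add ((hint j).const_mul 2)
    · refine Eventually.of_forall fun x => ?_
      have := mul_nonneg (hp0 x).le (sq_nonneg ((U (φ i) x - l x) + (U (φ j) x - l x)))
      simp only
      nlinarith
  rw [integral_add ((hint i).const_mul 2) ((hint j).const_mul 2), integral_const_mul,
    integral_const_mul] at hle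
  linarith [hn₀ i hi, hn₀ j hj]

/-! ### Existence of a negative eigenvalue -/

/-- Multiplication by a bounded continuous function on `L²`. -/
noncomputable def mulOp (g : ℝ → ℝ) (hg : Continuous g) (C : ℝ) (hC : ∀ x, |g x| ≤ C) :
    L2R →L[ℝ] L2R :=
  LinearMap.mkContinuous
    { toFun := fun f => (memLp_bdd_mul_real (Lp.memLp f) hg hC).toLp fun x => g x * f x
      map_add' := by
        intro u v
        rw [← MemLp.toLp_add]
        apply MemLp.toLp_congr
        filter_upwards [Lp.coeFn_add u v] with x hx
        simp only [hx, Pi.add_apply, mul_add]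
      map_smul' := by
        intro r u
        rw [RingHom.id_apply, ← MemLp.toLp_const_smul]
        apply MemLp.toLp_congr
        filter_upwards [Lp.coeFn_smul r u] with x hx
        simp only [hx, Pi.smul_apply, smul_eq_mul]
        ring } C (fun f => by
      refine Lp.norm_le_mul_norm_of_ae_le_mul ?_
      filter_upwards [(memLp_bdd_mul_real (Lp.memLp f) hg hC).coeFn_toLp] with x hx
      simp only [LinearMap.coe_mk, AddHom.coe_mk, hx, norm_mul]
      gcongr
      exact hC x)

lemma coeFn_mulOp {g : ℝ → ℝ} (hg : Continuous g) {C : ℝ} (hC : ∀ x, |g x| ≤ C) (f : L2R) :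
    (mulOp g hg C hC f : ℝ → ℝ) =ᵐ[volume] fun x => g x * f x :=
  (memLp_bdd_mul_real (Lp.memLp f) hg hC).coeFn_toLp

lemma inner_L2R (f g : L2R) : inner ℝ f g = ∫ x, f x * g x := by
  rw [L2.inner_def]
  congr 1
  funext x
  simp [mul_comm]

/-- Pairing with fixed L² vectors turns the condition into continuous linear equations, so the graph
of the weak derivative is a closed subspace. -/
lemma weakDeriv_iff_inner (u v : L2R) : WeakDeriv u v ↔
    ∀ (η : ℝ → ℝ) (hη : ContDiff ℝ (⊤ : ℕ∞) η) (hs : HasCompactSupport η),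
      inner ℝ (((hη.continuous_deriv (by simp)).memLp_of_hasCompactSupport (p := 2)
        (μ := volume) hs.deriv).toLp (deriv η)) u
      = -inner ℝ ((hη.continuous.memLp_of_hasCompactSupport (p := 2) (μ := volume) hs).toLp η) v := by
  have e {η : ℝ → ℝ} (h : MemLp η 2) (w : L2R) : inner ℝ (h.toLp η) w = ∫ x, η x * w x := by
    rw [inner_L2R]
    exact integral_congr_ae (by filter_upwards [h.coeFn_toLp] with x hx; rw [hx])
  simp only [e, WeakDeriv]

/-- The graph of the weak derivative in `L² × L²`. -/
def weakGraph : Submodule ℝ (L2R × L2R) where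
  carrier := {w | WeakDeriv w.1 w.2}
  zero_mem' := by
    simp only [Set.mem_ofPred_eq, weakDeriv_iff_inner]
    intros
    simp
  add_mem' := by
    intro u v hu hv
    simp only [Set.mem_ofPred_eq, weakDeriv_iff_inner] at *
    intro η hη hs
    rw [Prod.fst_add, Prod.snd_add, inner_add_right, inner_add_right, hu η hη hs, hv η hη hs,
      neg_add]
  smul_mem' := by
    intro r u hu
    simp only [Set.mem_ofPred_eq, weakDeriv_iff_inner] at *
    intro η hη hs
    rw [Prod.smul_fst, Prod.smul_snd, inner_smul_right, inner_smul_right, hu η hη hs, mul_neg]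

lemma isClosed_weakGraph : IsClosed (weakGraph : Set (L2R × L2R)) := by
  have e : (weakGraph : Set (L2R × L2R)) = {w | WeakDeriv w.1 w.2} := rfl
  rw [e]
  simp only [weakDeriv_iff_inner, Set.ofPred_forall]
  refine isClosed_iInter fun η => isClosed_iInter fun hη => isClosed_iInter fun hs => ?_
  exact isClosed_eq (by fun_prop) (by fun_prop)

lemma WeakDeriv.exists_continuous {u v : ℝ → ℝ} (h : WeakDeriv u v) (hu : LocallyIntegrable u)
    (hv : LocallyIntegrable v) : ∃ U : ℝ → ℝ, u =ᵐ[volume] U ∧ Continuous U := by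
  obtain ⟨a, ha⟩ := h.exists_primitive hu hv
  exact ⟨_, ha, (continuous_primitive_of_locallyIntegrable hv 0).const_add a⟩

lemma WeakDeriv.hasDerivAt {u v U V : ℝ → ℝ} (h : WeakDeriv u v) (hu : u =ᵐ[volume] U)
    (hU : Continuous U) (hv : v =ᵐ[volume] V) (hV : Continuous V) (x : ℝ) :
    HasDerivAt U (V x) x := by
  obtain ⟨U', h1, h2⟩ := (h.congr hu hv).exists_hasDerivAt hU.locallyIntegrable hV (ae_eq_refl V)
  have hc : Continuous U' := continuous_iff_continuousAt.2 fun y => (h2 y).continuousAt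
  rw [(Continuous.ae_eq_iff_eq volume hU hc).1 h1]
  exact h2 x

namespace IsProfile

variable {σ k m c : ℝ} {p h : ℝ → ℝ}

/-- A trial state of negative energy yields a negative eigenvalue. -/
lemma exists_isSol (H : IsProfile σ k m c p h) {a a₁ b z : ℝ → ℝ}
    (ha : ∀ x, HasDerivAt a (a₁ x) x)
    (hb : ∀ x, HasDerivAt b (z x + h x * b x - 2 * σ * k * p x * a x) x)
    (hca : Continuous a₁) (hcz : Continuous z) (hLa : MemLp a 2) (hLa₁ : MemLp a₁ 2)
    (hLb : MemLp b 2) (hLz : MemLp z 2)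
    (hneg : ∫ x, (a₁ x * a₁ x + potPlus σ k m c (p x) * a x * a x + z x * z x) < 0) :
    ∃ lam < 0, ∃ a a₁ b z : ℝ → ℝ, IsSol σ k m c p h lam a a₁ b z ∧ ¬(a = 0 ∧ b = 0) := by
  obtain ⟨Ch, _, hCh⟩ := H.exists_log_le
  obtain ⟨Cp, hCp0, hCp⟩ := H.exists_pow_le
  obtain ⟨CW, hCW0, hCW⟩ := H.exists_potPlus_le
  obtain ⟨CD, hCD0, hCD⟩ := H.exists_potPlus_sub_le
  have hm := H.m_pos
  set Mh := mulOp h H.continuous_log Ch hCh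
  set Mp := mulOp p H.continuous_pow Cp hCp
  set MW := mulOp (fun x => potPlus σ k m c (p x)) H.continuous_potPlus CW hCW
  let X := L2R × L2R × L2R × L2R
  let π₁ : X →L[ℝ] L2R := ContinuousLinearMap.fst ℝ _ _
  let π₂ : X →L[ℝ] L2R := (ContinuousLinearMap.fst ℝ _ _).comp (ContinuousLinearMap.snd ℝ _ _)
  let π₃ : X →L[ℝ] L2R := (ContinuousLinearMap.fst ℝ _ _).comp
    ((ContinuousLinearMap.snd ℝ _ _).comp (ContinuousLinearMap.snd ℝ _ _))
  let π₄ : X →L[ℝ] L2R := (ContinuousLinearMap.snd ℝ _ _).comp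
    ((ContinuousLinearMap.snd ℝ _ _).comp (ContinuousLinearMap.snd ℝ _ _))
  let D₁ : X →L[ℝ] L2R × L2R := π₁.prod π₂
  let D₂ : X →L[ℝ] L2R × L2R :=
    π₃.prod (π₄ + Mh.comp π₃ - (2 * σ * k) • Mp.comp π₁)
  -- The form domain, with coordinates (a, a₁, b, z) subject to a' = a₁ and b' = z + h b - 2σkp a
  -- weakly. Keeping all four coordinates makes the form continuous and the constraint set closed.
  let V : Submodule ℝ X := weakGraph.comap (D₁ : X →ₗ[ℝ] L2R × L2R) ⊓
    weakGraph.comap (D₂ : X →ₗ[ℝ] L2R × L2R)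
  have memV (a a₁ b z : L2R) : (a, a₁, b, z) ∈ V ↔ WeakDeriv a a₁ ∧
      WeakDeriv b ((z + Mh b - (2 * σ * k) • Mp a : L2R)) := Iff.rfl
  have hVc : IsClosed (V : Set X) :=
    (isClosed_weakGraph.preimage D₁.continuous).inter (isClosed_weakGraph.preimage D₂.continuous)
  have hsub (r s t : L2R) : ((r + Mh s - (2 * σ * k) • Mp t : L2R) : ℝ → ℝ) =ᵐ[volume]
      fun x => r x + h x * s x - 2 * σ * k * p x * t x := by
    filter_upwards [Lp.coeFn_sub (r + Mh s) ((2 * σ * k) • Mp t), Lp.coeFn_add r (Mh s),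
      Lp.coeFn_smul (2 * σ * k) (Mp t), coeFn_mulOp H.continuous_log hCh s,
      coeFn_mulOp H.continuous_pow hCp t] with x h1 h2 h3 h4 h5
    rw [h1, Pi.sub_apply, h2, h3, Pi.add_apply, Pi.smul_apply, h4, h5, smul_eq_mul]
    ring
  let F₀ : X →ₗ[ℝ] X →ₗ[ℝ] ℝ := (innerₗ L2R).compl₁₂ (π₂ : X →ₗ[ℝ] L2R) (π₂ : X →ₗ[ℝ] L2R)
    + (innerₗ L2R).compl₁₂ (MW.comp π₁ : X →ₗ[ℝ] L2R) (π₁ : X →ₗ[ℝ] L2R)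
    + (innerₗ L2R).compl₁₂ (π₄ : X →ₗ[ℝ] L2R) (π₄ : X →ₗ[ℝ] L2R)
  let N₀ : X →ₗ[ℝ] X →ₗ[ℝ] ℝ := (innerₗ L2R).compl₁₂ (π₁ : X →ₗ[ℝ] L2R) (π₁ : X →ₗ[ℝ] L2R)
    + (innerₗ L2R).compl₁₂ (π₃ : X →ₗ[ℝ] L2R) (π₃ : X →ₗ[ℝ] L2R)
  have hF₀ (u v : X) : F₀ u v = inner ℝ u.2.1 v.2.1 + inner ℝ (MW u.1) v.1
      + inner ℝ u.2.2.2 v.2.2.2 := rfl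
  have hN₀ (u v : X) : N₀ u v = inner ℝ u.1 v.1 + inner ℝ u.2.2.1 v.2.2.1 := rfl
  let F : V →ₗ[ℝ] V →ₗ[ℝ] ℝ := F₀.compl₁₂ V.subtype V.subtype
  let N : V →ₗ[ℝ] V →ₗ[ℝ] ℝ := N₀.compl₁₂ V.subtype V.subtype
  have hF (u v : V) : F u v = F₀ u v := rfl
  have hN (u v : V) : N u v = N₀ u v := rfl
  have hMW (f g : L2R) : inner ℝ (MW f) g = ∫ x, potPlus σ k m c (p x) * f x * g x := by
    rw [inner_L2R]
    exact integral_congr_ae (by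
      filter_upwards [coeFn_mulOp H.continuous_potPlus hCW f] with x hx
      rw [hx])
  have hMWs (f g : L2R) : inner ℝ (MW f) g = inner ℝ (MW g) f := by
    rw [hMW, hMW]
    congr 1
    funext x
    ring
  have hMWb (f : L2R) : -(CW * ‖f‖ ^ 2) ≤ inner ℝ (MW f) f := by
    have h1 := abs_real_inner_le_norm (MW f) f
    have h2 : ‖MW f‖ ≤ CW * ‖f‖ := by
      refine (MW.le_opNorm f).trans ?_
      gcongr
      exact LinearMap.mkContinuous_norm_le _ hCW0.le _
    have h3 : ‖MW f‖ * ‖f‖ ≤ CW * ‖f‖ * ‖f‖ := by gcongr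
    linarith [(abs_le.1 h1).1]
  -- Coercivity up to the compact part, from W ≥ m - CD p.
  have hMWp (f : L2R) : m * ‖f‖ ^ 2 - CD * ∫ x, p x * f x ^ 2 ≤ inner ℝ (MW f) f := by
    have i1 : Integrable fun x => f x ^ 2 := (Lp.memLp f).integrable_sq
    have i2 : Integrable fun x => p x * f x ^ 2 := by
      refine (integrable_mul_of_memLp (IsSol.memLp_pow_mul H (Lp.memLp f)) (Lp.memLp f)).congr
        (Eventually.of_forall fun x => ?_)
      simp only
      ring
    rw [norm_sq_L2R, hMW, ← integral_const_mul, ← integral_const_mul,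
      ← integral_sub (i1.const_mul m) (i2.const_mul CD)]
    apply integral_mono ((i1.const_mul m).sub (i2.const_mul CD))
      (integrable_mul_of_memLp (IsSol.memLp_potPlus_mul H (Lp.memLp f)) (Lp.memLp f))
    intro x
    have := (abs_le.1 (hCD x)).1
    simp only [Pi.sub_apply]
    nlinarith [sq_nonneg (f x)]
  have s₁ (u v : X) : (u - v).1 = u.1 - v.1 := rfl
  have s₂ (u v : X) : (u - v).2.1 = u.2.1 - v.2.1 := rfl
  have s₃ (u v : X) : (u - v).2.2.1 = u.2.2.1 - v.2.2.1 := rfl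
  have s₄ (u v : X) : (u - v).2.2.2 = u.2.2.2 - v.2.2.2 := rfl
  have main : ∃ lam < 0, ∃ u : V, N u u = 1 ∧ ∀ w, F u w = lam * N u w := by
    apply exists_eigenvector_of_compactness F N
    · intro u v
      rw [hF, hF, hF₀, hF₀, hMWs, real_inner_comm, real_inner_comm (u : X).2.2.2]
    · intro u v
      rw [hN, hN, hN₀, hN₀, real_inner_comm, real_inner_comm (u : X).2.2.1]
    · intro u
      rw [hN, hN₀]
      exact add_nonneg real_inner_self_nonneg real_inner_self_nonneg
    · have hmem : (hLa.toLp a, hLa₁.toLp a₁, hLb.toLp b, hLz.toLp z) ∈ V := by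
        rw [memV]
        have cb : Continuous b := continuous_iff_continuousAt.2 fun y => (hb y).continuousAt
        have ca : Continuous a := continuous_iff_continuousAt.2 fun y => (ha y).continuousAt
        have cp := H.continuous_pow
        have ch := H.continuous_log
        constructor
        · exact (weakDeriv_of_hasDerivAt ha hca).congr hLa.coeFn_toLp.symm hLa₁.coeFn_toLp.symm
        · refine (weakDeriv_of_hasDerivAt hb (by fun_prop)).congr hLb.coeFn_toLp.symm ?_
          filter_upwards [hsub (hLz.toLp z) (hLb.toLp b) (hLa.toLp a), hLz.coeFn_toLp,
            hLb.coeFn_toLp, hLa.coeFn_toLp] with x h1 h2 h3 h4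
          rw [h1, h2, h3, h4]
      refine ⟨⟨_, hmem⟩, ?_⟩
      rw [hF, hF₀]
      simp only
      rw [hMW, inner_L2R, inner_L2R]
      have i1 := integrable_mul_of_memLp hLa₁ hLa₁
      have i2 := integrable_mul_of_memLp (IsSol.memLp_potPlus_mul H hLa) hLa
      have i3 := integrable_mul_of_memLp hLz hLz
      rw [integral_add (f := fun x => a₁ x * a₁ x + potPlus σ k m c (p x) * a x * a x)
        (i1.add i2) i3, integral_add i1 i2] at hneg
      refine lt_of_eq_of_lt ?_ hneg
      congr 1
      · congr 1
        · exact integral_congr_ae (by filter_upwards [hLa₁.coeFn_toLp] with x hx; rw [hx])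
        · exact integral_congr_ae (by filter_upwards [hLa.coeFn_toLp] with x hx; rw [hx])
      · exact integral_congr_ae (by filter_upwards [hLz.coeFn_toLp] with x hx; rw [hx])
    · refine ⟨CW, fun u => ?_⟩
      rw [hF, hF₀, hN, hN₀]
      simp only [real_inner_self_eq_norm_sq]
      have := hMWb (u : X).1
      have h2 : 0 ≤ CW * ‖(u : X).2.2.1‖ ^ 2 := by positivity
      linarith [sq_nonneg ‖(u : X).2.1‖, sq_nonneg ‖(u : X).2.2.2‖]
    · intro lam hlam v hv1 ⟨B, hB⟩ hps
      simp only [hN, hN₀, real_inner_self_eq_norm_sq] at hv1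
      simp only [hF, hF₀, hN, hN₀, real_inner_self_eq_norm_sq, Submodule.coe_sub, s₁, s₂, s₃,
        s₄] at hB hps ⊢
      have b1 (n : ℕ) : ‖(v n : X).1‖ ^ 2 ≤ 1 := by
        linarith [hv1 n, sq_nonneg ‖(v n : X).2.2.1‖]
      have b2 (n : ℕ) : ‖(v n : X).2.1‖ ^ 2 ≤ B + CW := by
        have h1 := hB n
        have h2 := hMWb (v n : X).1
        have h3 : CW * ‖(v n : X).1‖ ^ 2 ≤ CW * 1 := by
          gcongr
          exact b1 n
        linarith [sq_nonneg ‖(v n : X).2.2.2‖]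
      have hBC : 0 ≤ B + CW := (sq_nonneg _).trans (b2 0)
      obtain ⟨φ, hφ, hφc⟩ := exists_subseq_weighted_cauchy H.continuous_pow H.pos H.integrable
        (u := fun n => (v n : X).1) (v := fun n => (v n : X).2.1) (A := B + CW + 1)
        (fun n => (v n).2.1)
        (fun n => abs_le_of_sq_le_sq' (by nlinarith [b1 n]) (by positivity) |>.2)
        (fun n => abs_le_of_sq_le_sq' (by nlinarith [b2 n]) (by positivity) |>.2)
      -- The weighted term is small along the subsequence and m‖a_i - a_j‖² ≥ 0 is dropped. Since
      -- -lam > 0, the remaining terms are all nonnegative, and each coordinate is Cauchy.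
      have hsm (ε : ℝ) (hε : 0 < ε) : ∃ n₀, ∀ i ≥ n₀, ∀ j ≥ n₀,
          ‖(v (φ i) : X).2.1 - (v (φ j) : X).2.1‖ ^ 2
          + ‖(v (φ i) : X).2.2.2 - (v (φ j) : X).2.2.2‖ ^ 2
          + -lam * (‖(v (φ i) : X).1 - (v (φ j) : X).1‖ ^ 2
            + ‖(v (φ i) : X).2.2.1 - (v (φ j) : X).2.2.1‖ ^ 2) < ε := by
        obtain ⟨n₁, hn₁⟩ := hps (ε / 2) (by positivity)
        obtain ⟨n₂, hn₂⟩ := hφc (ε / (2 * CD)) (by positivity)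
        refine ⟨max n₁ n₂, fun i hi j hj => ?_⟩
        have h1 := hn₁ (φ i) ((le_of_max_le_left hi).trans hφ.le_apply) (φ j)
          ((le_of_max_le_left hj).trans hφ.le_apply)
        have h2 := hn₂ i (le_of_max_le_right hi) j (le_of_max_le_right hj)
        have h3 := hMWp ((v (φ i) : X).1 - (v (φ j) : X).1)
        have h4 : ∫ x, p x * ((v (φ i) : X).1 - (v (φ j) : X).1 : L2R) x ^ 2
            = ∫ x, p x * ((v (φ i) : X).1 x - (v (φ j) : X).1 x) ^ 2 :=
          integral_congr_ae (by
            filter_upwards [Lp.coeFn_sub (v (φ i) : X).1 (v (φ j) : X).1] with x hx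
            rw [hx, Pi.sub_apply])
        rw [h4] at h3
        rw [lt_div_iff₀ (by positivity)] at h2
        have h5 : 0 ≤ m * ‖(v (φ i) : X).1 - (v (φ j) : X).1‖ ^ 2 := by positivity
        linarith
      have hcau (g : ℕ → L2R) (r : ℝ) (hr : 0 < r) (hg : ∀ i j, r * ‖g i - g j‖ ^ 2 ≤
          ‖(v (φ i) : X).2.1 - (v (φ j) : X).2.1‖ ^ 2
          + ‖(v (φ i) : X).2.2.2 - (v (φ j) : X).2.2.2‖ ^ 2
          + -lam * (‖(v (φ i) : X).1 - (v (φ j) : X).1‖ ^ 2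
            + ‖(v (φ i) : X).2.2.1 - (v (φ j) : X).2.2.1‖ ^ 2)) :
          ∃ l, Tendsto g atTop (𝓝 l) := by
        refine cauchySeq_tendsto_of_complete (Metric.cauchySeq_iff.2 fun ε hε => ?_)
        obtain ⟨n₀, hn₀⟩ := hsm (r * ε ^ 2) (by positivity)
        refine ⟨n₀, fun i hi j hj => ?_⟩
        rw [dist_eq_norm]
        have := (hg i j).trans_lt (hn₀ i hi j hj)
        exact lt_of_pow_lt_pow_left₀ 2 hε.le (lt_of_mul_lt_mul_left this hr.le)
      have hpos (i j : ℕ) : 0 ≤ -lam * ‖(v (φ i) : X).1 - (v (φ j) : X).1‖ ^ 2 ∧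
          0 ≤ -lam * ‖(v (φ i) : X).2.2.1 - (v (φ j) : X).2.2.1‖ ^ 2 := by
        have : 0 < -lam := by linarith
        constructor <;> positivity
      obtain ⟨l₁, hl₁⟩ := hcau (fun n => (v (φ n) : X).1) (-lam) (by linarith) fun i j => by
        have := hpos i j
        nlinarith [sq_nonneg ‖(v (φ i) : X).2.1 - (v (φ j) : X).2.1‖,
          sq_nonneg ‖(v (φ i) : X).2.2.2 - (v (φ j) : X).2.2.2‖]
      obtain ⟨l₂, hl₂⟩ := hcau (fun n => (v (φ n) : X).2.1) 1 one_pos fun i j => by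
        have := hpos i j
        nlinarith [sq_nonneg ‖(v (φ i) : X).2.1 - (v (φ j) : X).2.1‖,
          sq_nonneg ‖(v (φ i) : X).2.2.2 - (v (φ j) : X).2.2.2‖]
      obtain ⟨l₃, hl₃⟩ := hcau (fun n => (v (φ n) : X).2.2.1) (-lam) (by linarith) fun i j => by
        have := hpos i j
        nlinarith [sq_nonneg ‖(v (φ i) : X).2.1 - (v (φ j) : X).2.1‖,
          sq_nonneg ‖(v (φ i) : X).2.2.2 - (v (φ j) : X).2.2.2‖]
      obtain ⟨l₄, hl₄⟩ := hcau (fun n => (v (φ n) : X).2.2.2) 1 one_pos fun i j => by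
        have := hpos i j
        nlinarith [sq_nonneg ‖(v (φ i) : X).2.1 - (v (φ j) : X).2.1‖,
          sq_nonneg ‖(v (φ i) : X).2.2.2 - (v (φ j) : X).2.2.2‖]
      have hlim : Tendsto (fun n => (v (φ n) : X)) atTop (𝓝 (l₁, l₂, l₃, l₄)) :=
        hl₁.prodMk_nhds (hl₂.prodMk_nhds (hl₃.prodMk_nhds hl₄))
      refine ⟨φ, hφ, ⟨_, hVc.mem_of_tendsto hlim (Eventually.of_forall fun n => (v (φ n)).2)⟩,
        ?_, ?_⟩
      · have t : Tendsto (fun n => ‖(v (φ n) : X).1‖ ^ 2 + ‖(v (φ n) : X).2.2.1‖ ^ 2) atTop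
            (𝓝 (‖l₁‖ ^ 2 + ‖l₃‖ ^ 2)) := (hl₁.norm.pow 2).add (hl₃.norm.pow 2)
        simp only [hv1] at t
        exact tendsto_nhds_unique t tendsto_const_nhds
      · exact ((hl₂.norm.pow 2).add (((MW.continuous.tendsto _).comp hl₁).inner hl₁)).add
          (hl₄.norm.pow 2)
  obtain ⟨lam, hlam, ⟨⟨A, A₁, B, Z⟩, hu⟩, hu1, hEL⟩ := main
  obtain ⟨hA, hB⟩ := (memV _ _ _ _).1 hu
  have hEL' (w : X) (hw : w ∈ V) : inner ℝ A₁ w.2.1 + inner ℝ (MW A) w.1 + inner ℝ Z w.2.2.2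
      = lam * (inner ℝ A w.1 + inner ℝ B w.2.2.1) := hEL ⟨w, hw⟩
  have et {η : ℝ → ℝ} (h : MemLp η 2) (w : L2R) : inner ℝ w (h.toLp η) = ∫ x, η x * w x := by
    rw [inner_L2R]
    exact integral_congr_ae (by
      filter_upwards [h.coeFn_toLp] with x hx
      rw [hx, mul_comm])
  have cp := H.continuous_pow
  have ch := H.continuous_log
  have cW := H.continuous_potPlus
  have lA := Lp.memLp A
  have lB := Lp.memLp B
  have lZ := Lp.memLp Z
  -- Variation in a alone: a = η and b = 0 force z = 2σkp η.
  have wA₁ : WeakDeriv A₁ fun x =>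
      potPlus σ k m c (p x) * A x + 2 * σ * k * p x * Z x - lam * A x := by
    intro η hη hs
    have cη := hη.continuous
    have cη' : Continuous (deriv η) := hη.continuous_deriv (by simp)
    have m0 : MemLp η 2 := cη.memLp_of_hasCompactSupport hs
    have m1 : MemLp (deriv η) 2 := cη'.memLp_of_hasCompactSupport hs.deriv
    have mq := IsSol.memLp_coupling_mul H m0
    have mem : (m0.toLp η, m1.toLp (deriv η), (0 : L2R), mq.toLp _) ∈ V := by
      rw [memV]
      refine ⟨(weakDeriv_of_hasDerivAt (fun x => (hη.differentiable (by simp) x).hasDerivAt)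
        cη').congr m0.coeFn_toLp.symm m1.coeFn_toLp.symm, ?_⟩
      refine (weakDeriv_of_hasDerivAt (u := 0) (v := 0) (fun x => hasDerivAt_const x 0)
        continuous_zero).congr (Lp.coeFn_zero _ _ _).symm ?_
      filter_upwards [hsub (mq.toLp _) 0 (m0.toLp η), mq.coeFn_toLp, m0.coeFn_toLp,
        Lp.coeFn_zero ℝ 2 (volume : Measure ℝ)] with x h1 h2 h3 h4
      rw [h1, h2, h3, h4]
      simp
    have key := hEL' _ mem
    simp only [inner_zero_right, add_zero, et] at key
    have e1 : ∫ x, η x * (MW A) x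
        = ∫ x, η x * (potPlus σ k m c (p x) * A x) :=
      integral_congr_ae (by
        filter_upwards [coeFn_mulOp H.continuous_potPlus hCW A] with x hx
        rw [hx])
    have e2 : ∫ x, 2 * σ * k * p x * η x * Z x = ∫ x, η x * (2 * σ * k * p x * Z x) := by
      congr 1
      funext x
      ring
    have i1 := integrable_mul_of_memLp m0 (IsSol.memLp_potPlus_mul H lA)
    have i2 := integrable_mul_of_memLp m0 (IsSol.memLp_coupling_mul H lZ)
    have i3 := integrable_mul_of_memLp m0 lA
    have e3 : ∀ x, η x * (potPlus σ k m c (p x) * A x + 2 * σ * k * p x * Z x - lam * A x)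
        = 1 * (η x * (potPlus σ k m c (p x) * A x)) + 1 * (η x * (2 * σ * k * p x * Z x))
          + -lam * (η x * A x) := fun x => by ring
    simp only [e3]
    rw [integral_comb₃ i1 i2 i3]
    rw [e1, e2] at key
    linarith
  -- Variation in b alone: a = 0 and b = η force z = η' - h η.
  have wZ : WeakDeriv Z fun x => -(h x * Z x) - lam * B x := by
    intro η hη hs
    have cη := hη.continuous
    have cη' : Continuous (deriv η) := hη.continuous_deriv (by simp)
    have m0 : MemLp η 2 := cη.memLp_of_hasCompactSupport hs
    have m1 : MemLp (deriv η) 2 := cη'.memLp_of_hasCompactSupport hs.deriv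
    have mh := IsSol.memLp_log_mul H m0
    have mz : MemLp (fun x => deriv η x - h x * η x) 2 := m1.sub mh
    have mem : ((0 : L2R), (0 : L2R), m0.toLp η, mz.toLp _) ∈ V := by
      rw [memV]
      refine ⟨weakGraph.zero_mem, ?_⟩
      refine (weakDeriv_of_hasDerivAt (fun x => (hη.differentiable (by simp) x).hasDerivAt)
        cη').congr m0.coeFn_toLp.symm ?_
      filter_upwards [hsub (mz.toLp _) (m0.toLp η) 0, mz.coeFn_toLp, m0.coeFn_toLp,
        Lp.coeFn_zero ℝ 2 (volume : Measure ℝ)] with x h1 h2 h3 h4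
      rw [h1, h2, h3, h4]
      simp
    have key := hEL' _ mem
    simp only [inner_zero_right, add_zero, zero_add, et] at key
    have i1 := integrable_mul_of_memLp m1 lZ
    have i2 := integrable_mul_of_memLp m0 (IsSol.memLp_log_mul H lZ)
    have i3 := integrable_mul_of_memLp m0 lB
    have e1 : ∀ x, (deriv η x - h x * η x) * Z x
        = deriv η x * Z x - η x * (h x * Z x) := fun x => by ring
    have e2 : ∀ x, η x * (-(h x * Z x) - lam * B x)
        = -1 * (η x * (h x * Z x)) + -lam * (η x * B x) + 0 * (η x * B x) := fun x => by ring
    simp only [e1] at key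
    rw [integral_sub i1 i2] at key
    simp only [e2]
    rw [integral_comb₃ i2 i3 i3]
    linarith
  have lA₁' : MemLp (fun x => potPlus σ k m c (p x) * A x + 2 * σ * k * p x * Z x - lam * A x) 2 :=
    ((IsSol.memLp_potPlus_mul H lA).add (IsSol.memLp_coupling_mul H lZ)).sub (lA.const_mul lam)
  have lZ' : MemLp (fun x => -(h x * Z x) - lam * B x) 2 :=
    (IsSol.memLp_log_mul H lZ).neg.sub (lB.const_mul lam)
  -- All four coordinates have continuous representatives. The right-hand sides of the system are
  -- then continuous, so the weak equations hold classically.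
  obtain ⟨A', eA, cA⟩ := WeakDeriv.exists_continuous hA (locallyIntegrable_L2R _)
    (locallyIntegrable_L2R _)
  obtain ⟨B', eB, cB⟩ := WeakDeriv.exists_continuous hB (locallyIntegrable_L2R _)
    (locallyIntegrable_L2R _)
  obtain ⟨A₁', eA₁, cA₁⟩ := wA₁.exists_continuous (locallyIntegrable_L2R _)
    (lA₁'.locallyIntegrable (by norm_num))
  obtain ⟨Z', eZ, cZ⟩ := wZ.exists_continuous (locallyIntegrable_L2R _)
    (lZ'.locallyIntegrable (by norm_num))
  refine ⟨lam, hlam, A', A₁', B', Z', ⟨hA.hasDerivAt eA cA eA₁ cA₁,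
    wA₁.hasDerivAt eA₁ cA₁ ?_ (by fun_prop), hB.hasDerivAt eB cB ?_ (by fun_prop),
    wZ.hasDerivAt eZ cZ ?_ (by fun_prop), lA.ae_eq eA, (Lp.memLp A₁).ae_eq eA₁,
    lB.ae_eq eB, lZ.ae_eq eZ⟩, ?_⟩
  · filter_upwards [eA, eZ] with x h1 h2
    rw [h1, h2]
  · filter_upwards [hsub Z B A, eZ, eB, eA] with x h1 h2 h3 h4
    rw [h1, h2, h3, h4]
  · filter_upwards [eZ, eB] with x h1 h2
    rw [h1, h2]
  · rintro ⟨rfl, rfl⟩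
    rw [hN, hN₀] at hu1
    have zA : A = 0 := (Lp.eq_zero_iff_ae_eq_zero).2 eA
    have zB : B = 0 := (Lp.eq_zero_iff_ae_eq_zero).2 eB
    simp [zA, zB] at hu1

end IsProfile

/-! ### Trial states of negative energy -/

namespace IsProfile

variable {σ k m c : ℝ} {p h : ℝ → ℝ}

/-- The trial state `a = g f` with `g = f ^ (r - 1)`, completed by the imaginary part that makes
the auxiliary function `z` vanish. -/
lemma exists_isSol_of_trial (H : IsProfile σ k m c p h) {f g : ℝ → ℝ} {r C : ℝ}
    (hf0 : ∀ x, 0 < f x) (hfd : ∀ x, HasDerivAt f (h x * f x) x) (hf : MemLp f 2)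
    (hg0 : ∀ x, 0 < g x) (hgd : ∀ x, HasDerivAt g ((r - 1) * h x * g x) x)
    (hgC : ∀ x, |g x| ≤ C)
    (hD : ∀ x, 0 < r * potMinus k m c (p x) + (r ^ 2 - r) * h x ^ 2 - potPlus σ k m c (p x)) :
    ∃ lam < 0, ∃ a a₁ b z : ℝ → ℝ, IsSol σ k m c p h lam a a₁ b z ∧ ¬(a = 0 ∧ b = 0) := by
  have cf : Continuous f := continuous_iff_continuousAt.2 fun y => (hfd y).continuousAt
  have cg : Continuous g := continuous_iff_continuousAt.2 fun y => (hgd y).continuousAt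
  have cp := H.continuous_pow
  have ch := H.continuous_log
  have hσ := H.σ_pos
  have hk := H.k_pos
  have cW := H.continuous_potPlus
  have cV := H.continuous_potMinus
  have cG : Continuous fun x => 2 * σ * k * p x * g x := by fun_prop
  have hGd (x : ℝ) : HasDerivAt (fun y => ∫ t in (0 : ℝ)..y, 2 * σ * k * p t * g t)
      (2 * σ * k * p x * g x) x :=
    intervalIntegral.integral_hasDerivAt_right (cG.intervalIntegrable _ _)
      (cG.stronglyMeasurableAtFilter _ _) cG.continuousAt
  have iG : Integrable fun x => 2 * σ * k * p x * g x := by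
    refine ((H.integrable.const_mul (2 * σ * k)).mul_const C).mono' cG.aestronglyMeasurable
      (Eventually.of_forall fun x => ?_)
    have := H.pos x
    rw [norm_mul, Real.norm_of_nonneg (by positivity)]
    gcongr
    exact hgC x
  -- Solving z = 0 gives b = -f G with G' = 2σkp g. Since p is integrable and g bounded, G is
  -- bounded, hence b is in L².
  have bG (y : ℝ) : |∫ t in (0 : ℝ)..y, 2 * σ * k * p t * g t|
      ≤ ∫ t, |2 * σ * k * p t * g t| := by
    rw [intervalIntegral.abs_intervalIntegral_eq]
    refine (abs_integral_le_integral_abs).trans ?_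
    exact setIntegral_le_integral iG.abs (Eventually.of_forall fun x => abs_nonneg _)
  set G : ℝ → ℝ := fun y => ∫ t in (0 : ℝ)..y, 2 * σ * k * p t * g t
  have cGi : Continuous G := continuous_iff_continuousAt.2 fun y => (hGd y).continuousAt
  have had (x : ℝ) : HasDerivAt (fun x => g x * f x) (r * (h x * (g x * f x))) x :=
    ((hgd x).mul (hfd x)).congr_deriv (by ring)
  have ma : MemLp (fun x => g x * f x) 2 := memLp_bdd_mul_real hf cg hgC
  have ma₁ : MemLp (fun x => r * (h x * (g x * f x))) 2 := (IsSol.memLp_log_mul H ma).const_mul r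
  refine H.exists_isSol (a := fun x => g x * f x) (a₁ := fun x => r * (h x * (g x * f x)))
    (b := fun x => -(G x * f x)) (z := fun _ => 0) had (fun x => ?_) (by fun_prop)
    continuous_const ma ma₁ (memLp_bdd_mul_real hf cGi bG).neg MemLp.zero' ?_
  · exact ((hGd x).mul (hfd x)).neg.congr_deriv (by ring)
  have i1 := integrable_mul_of_memLp ma₁ ma₁
  have i2 := integrable_mul_of_memLp (IsSol.memLp_potPlus_mul H ma) ma
  -- For a = f^r one has a''/a = rV + (r² - r)h². Integrating (aa')' = a'² + W a² + (a''/a - W)a²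
  -- shows that the form equals -∫ (a''/a - W)a².
  have hd (x : ℝ) : HasDerivAt (fun x => (g x * f x) * (r * (h x * (g x * f x))))
      ((r * (h x * (g x * f x)) * (r * (h x * (g x * f x)))
          + potPlus σ k m c (p x) * (g x * f x) * (g x * f x) + 0 * 0)
        + (r * potMinus k m c (p x) + (r ^ 2 - r) * h x ^ 2 - potPlus σ k m c (p x))
          * ((g x * f x) * (g x * f x))) x :=
    ((had x).mul (((H.hasDerivAt_log x).mul (had x)).const_mul r)).congr_deriv (by
      simp only [Pi.mul_apply]
      ring)
  have iD : Integrable fun x => (r * potMinus k m c (p x) + (r ^ 2 - r) * h x ^ 2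
      - potPlus σ k m c (p x)) * ((g x * f x) * (g x * f x)) := by
    have i3 : Integrable fun x => potMinus k m c (p x) * (g x * f x) * (g x * f x) := by
      have hV : ∃ B, ∀ x, |potMinus k m c (p x)| ≤ B := by
        obtain ⟨B, _, hB⟩ := H.exists_pow_le
        refine ⟨|m| + |c / 2| * B + |k * (1 - k)| * B ^ 2, fun x => ?_⟩
        unfold potMinus
        refine (abs_sub _ _).trans ?_
        refine add_le_add ((abs_add_le _ _).trans ?_) ?_
        · rw [abs_mul]
          gcongr
          exact hB x
        · rw [abs_mul, abs_pow]
          gcongr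
          exact hB x
      obtain ⟨B, hB⟩ := hV
      exact integrable_mul_of_memLp (memLp_bdd_mul_real ma cV hB) ma
    have i4 := integrable_mul_of_memLp (IsSol.memLp_log_mul H ma) (IsSol.memLp_log_mul H ma)
    refine (((i3.const_mul r).add (i4.const_mul (r ^ 2 - r))).sub i2).congr
      (Eventually.of_forall fun x => ?_)
    simp only [Pi.add_apply, Pi.sub_apply]
    ring
  have i5 : Integrable fun x => r * (h x * (g x * f x)) * (r * (h x * (g x * f x)))
          + potPlus σ k m c (p x) * (g x * f x) * (g x * f x) + 0 * 0 := by
    simpa using! i1.add i2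
  have key := integral_eq_zero_of_hasDerivAt_of_integrable hd (i5.add iD)
    (integrable_mul_of_memLp ma ma₁)
  rw [integral_add i5 iD] at key
  have hpos (x : ℝ) : 0 < (r * potMinus k m c (p x) + (r ^ 2 - r) * h x ^ 2
      - potPlus σ k m c (p x)) * ((g x * f x) * (g x * f x)) := by
    have := hf0 x
    have := hg0 x
    have := hD x
    positivity
  have : 0 < ∫ x, (r * potMinus k m c (p x) + (r ^ 2 - r) * h x ^ 2
      - potPlus σ k m c (p x)) * ((g x * f x) * (g x * f x)) := by
    rw [integral_pos_iff_support_of_nonneg (fun x => (hpos x).le) iD]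
    have e : Function.support (fun x => (r * potMinus k m c (p x) + (r ^ 2 - r) * h x ^ 2
      - potPlus σ k m c (p x)) * ((g x * f x) * (g x * f x))) = Set.univ :=
      Set.eq_univ_of_forall fun x => (hpos x).ne'
    rw [e]
    simp
  linarith

/-- There is a square integrable solution with a negative eigenvalue. -/
lemma exists_isSol_of_memLp (H : IsProfile σ k m c p h) {f : ℝ → ℝ}
    (hf0 : ∀ x, 0 < f x) (hfd : ∀ x, HasDerivAt f (h x * f x) x) (hf : MemLp f 2) :
    ∃ lam < 0, ∃ a a₁ b z : ℝ → ℝ, IsSol σ k m c p h lam a a₁ b z ∧ ¬(a = 0 ∧ b = 0) := by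
  have hσ := H.σ_pos
  have hk := H.k_pos
  have hm := H.m_pos
  have hk1 : 0 < 1 - k := by
    have := H.k_mul
    nlinarith
  -- With r = 1 the quantity a''/a - W is -2σp V'(p), positive for c ≤ 0. With r = 2σ+1 the p² terms
  -- cancel, by 1 - k = (2σ+1)k, and what is left is positive for c ≥ 0.
  rcases le_total c 0 with hc | hc
  · refine H.exists_isSol_of_trial (g := fun _ => 1) (r := 1) (C := 1) hf0 hfd hf
      (fun _ => one_pos) (fun x => (hasDerivAt_const x 1).congr_deriv (by ring)) (by simp)
      fun x => ?_
    have hp := H.pos x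
    have e : 1 * potMinus k m c (p x) + (1 ^ 2 - 1) * h x ^ 2 - potPlus σ k m c (p x)
        = 4 * σ * k * (1 - k) * p x ^ 2 + σ * p x * (-c) := by
      unfold potPlus
      ring
    rw [e]
    have h1 : 0 < 4 * σ * k * (1 - k) * p x ^ 2 := by positivity
    have h2 : 0 ≤ σ * p x * (-c) := mul_nonneg (by positivity) (by linarith)
    linarith
  · obtain ⟨C, _, hC⟩ := H.exists_pow_le
    refine H.exists_isSol_of_trial (g := p) (r := 2 * σ + 1) (C := C) hf0 hfd hf H.pos
      (fun x => (H.hasDerivAt_pow x).congr_deriv (by ring)) hC fun x => ?_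
    have hp := H.pos x
    have e : (2 * σ + 1) * potMinus k m c (p x) + ((2 * σ + 1) ^ 2 - (2 * σ + 1)) * h x ^ 2
        - potPlus σ k m c (p x)
        = m * (4 * σ * (σ + 1)) + c * (p x * ((2 * σ + 1) * (2 * σ * k))) := by
      rw [H.log_sq]
      unfold potPlus potMinus
      have hk2 : 1 - k = (2 * σ + 1) * k := by linarith [H.k_mul]
      rw [hk2]
      ring
    rw [e]
    positivity

end IsProfile

/-! ### The solitary wave profile -/

section Profile

variable {σ ω c : ℝ}

/-- The logarithmic derivative of the profile. -/
noncomputable def profileLog (σ ω c y : ℝ) : ℝ :=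
  -(√(4 * ω - c ^ 2) / 2 * (Real.sinh (σ * √(4 * ω - c ^ 2) * y) /
    (Real.cosh (σ * √(4 * ω - c ^ 2) * y) - c / (2 * √ω))))

lemma hasDerivAt_profile' (hσ : 0 < σ) (hω : c ^ 2 / 4 < ω) (y : ℝ) :
    HasDerivAt (profile σ ω c) (profileLog σ ω c y * profile σ ω c y) y :=
  (hasDerivAt_profile hσ hω y).congr_deriv (by rw [profileLog]; ring)

lemma exists_profilePow_le_exp (hσ : 0 < σ) (hω : c ^ 2 / 4 < ω) :
    ∃ C : ℝ, 0 < C ∧ ∀ y, profilePow σ ω c y ≤ C * Real.exp (-(σ * √(4 * ω - c ^ 2)) * |y|) := by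
  obtain ⟨C, hC, h⟩ := exists_profilePow_le hσ hω
  have h4 : 0 < 4 * ω - c ^ 2 := by linarith
  refine ⟨2 * C, by positivity, fun y => (h y).trans ?_⟩
  rw [mul_comm 2 C, mul_assoc C]
  gcongr
  rw [← Real.cosh_abs, abs_mul, abs_of_pos (by positivity : 0 < σ * √(4 * ω - c ^ 2)), neg_mul]
  set t := σ * √(4 * ω - c ^ 2) * |y|
  rw [inv_le_iff_one_le_mul₀ (Real.cosh_pos t), Real.cosh_eq]
  have e1 : Real.exp t * Real.exp (-t) = 1 := by rw [← Real.exp_add]; simp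
  nlinarith [Real.exp_pos t, Real.exp_pos (-t)]

lemma integrable_exp_neg_abs {a : ℝ} (ha : 0 < a) :
    Integrable fun x : ℝ => Real.exp (-a * |x|) := by
  rw [← integrableOn_univ, ← Set.Iic_union_Ioi (a := (0 : ℝ))]
  refine IntegrableOn.union ?_ ?_
  · refine (integrableOn_exp_mul_Iic ha 0).congr_fun (fun x hx => ?_) measurableSet_Iic
    simp only
    rw [abs_of_nonpos hx]
    ring_nf
  · refine (integrableOn_exp_mul_Ioi (neg_lt_zero.2 ha) 0).congr_fun (fun x hx => ?_)
      measurableSet_Ioi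
    simp only
    rw [abs_of_pos hx]

/-- f² = p^{1/σ}, so the decay rate σ√(4ω - c²) of p becomes √(4ω - c²), whatever σ is. -/
lemma memLp_profile (hσ : 0 < σ) (hω : c ^ 2 / 4 < ω) : MemLp (profile σ ω c) 2 := by
  have hc : Continuous (profile σ ω c) :=
    continuous_iff_continuousAt.2 fun y => (hasDerivAt_profile hσ hω y).continuousAt
  rw [memLp_two_iff_integrable_sq hc.aestronglyMeasurable]
  obtain ⟨C, hC, h⟩ := exists_profilePow_le_exp hσ hω
  have h4 : 0 < √(4 * ω - c ^ 2) := Real.sqrt_pos.2 (by linarith)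
  refine ((integrable_exp_neg_abs h4).const_mul (C ^ (1 / σ))).mono'
    (hc.pow 2).aestronglyMeasurable (Eventually.of_forall fun y => ?_)
  have hp := profilePow_pos hσ hω y
  rw [Real.norm_of_nonneg (sq_nonneg _), profile, ← Real.rpow_natCast, ← Real.rpow_mul hp.le]
  have e : 1 / (2 * σ) * ((2 : ℕ) : ℝ) = 1 / σ := by
    push_cast
    field_simp
  rw [e]
  refine (Real.rpow_le_rpow hp.le (h y) (by positivity)).trans_eq ?_
  rw [Real.mul_rpow hC.le (Real.exp_pos _).le, ← Real.exp_mul]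
  congr 2
  field_simp

/-- With d = cosh - c/(2√ω), p is a constant over d. Eliminating sinh by cosh² - sinh² = 1 reduces
the differential identities to rational ones in d and √ω. -/
lemma isProfile_profilePow (hσ : 0 < σ) (hω : c ^ 2 / 4 < ω) :
    IsProfile σ (1 / (2 * σ + 2)) (ω - c ^ 2 / 4) c (profilePow σ ω c) (profileLog σ ω c) := by
  have h0 : 0 < ω := lt_of_le_of_lt (by positivity) hω
  have hs : 0 < √ω := Real.sqrt_pos.2 h0
  have hs2 : √ω ^ 2 = ω := Real.sq_sqrt h0.le
  have h4 : 0 < 4 * ω - c ^ 2 := by linarith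
  have hκ : 0 < √(4 * ω - c ^ 2) := Real.sqrt_pos.2 h4
  have hκ2 : √(4 * ω - c ^ 2) ^ 2 = 4 * ω - c ^ 2 := Real.sq_sqrt h4.le
  obtain ⟨C, hC, hle⟩ := exists_profilePow_le_exp hσ hω
  have hpos := profilePow_pos hσ hω
  have ha : 0 < σ * √(4 * ω - c ^ 2) := by positivity
  have hsq (y : ℝ) : profileLog σ ω c y ^ 2 = ω - c ^ 2 / 4 + 1 / (2 * σ + 2) * c * profilePow σ ω c y
      - (1 / (2 * σ + 2)) ^ 2 * profilePow σ ω c y ^ 2 := by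
    have hd := den_pos hω (σ * √(4 * ω - c ^ 2) * y)
    have hcs := Real.cosh_sq (σ * √(4 * ω - c ^ 2) * y)
    rw [profileLog, profilePow, neg_sq, mul_pow, div_pow, hκ2]
    set d := Real.cosh (σ * √(4 * ω - c ^ 2) * y) - c / (2 * √ω)
    have hcd : Real.cosh (σ * √(4 * ω - c ^ 2) * y) = d + c / (2 * √ω) := by simp [d]
    rw [div_pow, show Real.sinh (σ * √(4 * ω - c ^ 2) * y) ^ 2 = (d + c / (2 * √ω)) ^ 2 - 1 by
      rw [← hcd]; linarith]
    set s := √ω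
    rw [← hs2]
    field_simp
    ring
  have hlim {l : Filter ℝ} (hl : Tendsto (fun y : ℝ => |y|) l atTop) :
      Tendsto (profilePow σ ω c) l (𝓝 0) := by
    have t : Tendsto (fun y : ℝ => C * Real.exp (-(σ * √(4 * ω - c ^ 2)) * |y|)) l (𝓝 (C * 0)) :=
      (Real.tendsto_exp_atBot.comp (hl.const_mul_atTop_of_neg (neg_lt_zero.2 ha))).const_mul C
    rw [mul_zero] at t
    exact squeeze_zero (fun y => (hpos y).le) hle t
  refine ⟨hσ, by field_simp, by linarith, hpos, fun y => ?_, fun y => ?_, hsq, ?_, fun y hy => ?_,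
    ?_, ?_, hlim tendsto_abs_atTop_atTop, hlim tendsto_abs_atBot_atTop⟩
  · refine (hasDerivAt_profilePow hσ hω y).congr_deriv ?_
    rw [profileLog]
    ring
  · have hd := den_pos hω (σ * √(4 * ω - c ^ 2) * y)
    have h1 : HasDerivAt (fun y => σ * √(4 * ω - c ^ 2) * y) (σ * √(4 * ω - c ^ 2)) y := by
      simpa using (hasDerivAt_id y).const_mul (σ * √(4 * ω - c ^ 2))
    refine (((h1.sinh.div (h1.cosh.sub_const (c / (2 * √ω))) hd.ne').const_mul
      (√(4 * ω - c ^ 2) / 2)).neg).congr_deriv ?_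
    rw [hsq, potMinus, profilePow]
    have hcs := Real.cosh_sq (σ * √(4 * ω - c ^ 2) * y)
    set d := Real.cosh (σ * √(4 * ω - c ^ 2) * y) - c / (2 * √ω)
    have hcd : Real.cosh (σ * √(4 * ω - c ^ 2) * y) = d + c / (2 * √ω) := by simp [d]
    set S := Real.sinh (σ * √(4 * ω - c ^ 2) * y)
    have hS : S * (S * (σ * √(4 * ω - c ^ 2)))
        = ((d + c / (2 * √ω)) ^ 2 - 1) * (σ * √(4 * ω - c ^ 2)) := by
      rw [← hcd]
      linear_combination (-(σ * √(4 * ω - c ^ 2))) * hcs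
    rw [hS, hcd]
    clear_value d
    have e : -(√(4 * ω - c ^ 2) / 2 * (((d + c / (2 * √ω)) * (σ * √(4 * ω - c ^ 2)) * d
          - ((d + c / (2 * √ω)) ^ 2 - 1) * (σ * √(4 * ω - c ^ 2))) / d ^ 2))
        = -(σ * (4 * ω - c ^ 2) / 2 * ((d + c / (2 * √ω)) * d
          - ((d + c / (2 * √ω)) ^ 2 - 1)) / d ^ 2) := by
      linear_combination (-(σ * ((d + c / (2 * √ω)) * d - ((d + c / (2 * √ω)) ^ 2 - 1))
        / 2 / d ^ 2)) * hκ2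
    rw [e]
    set s := √ω
    rw [← hs2]
    field_simp
    ring
  · simp [profileLog]
  · have hd := den_pos hω (σ * √(4 * ω - c ^ 2) * y)
    have : Real.sinh (σ * √(4 * ω - c ^ 2) * y) ≠ 0 := by
      rw [Real.sinh_ne_zero]
      positivity
    rw [profileLog]
    exact neg_ne_zero.2 (mul_ne_zero (by positivity) (div_ne_zero this hd.ne'))
  -- Factoring 4ω - c² = (2√ω - c)(2√ω + c) gives p(0) = (σ+1)(2√ω + c), and then V(p(0)) = -σ√ω(2√ω
  -- + c) < 0.
  · have h1 := hsq 0
    have hd := den_pos hω 0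
    rw [profilePow, mul_zero] at *
    simp only [profileLog, mul_zero, Real.sinh_zero, zero_div, neg_zero] at h1
    rw [potMinus]
    rw [Real.cosh_zero] at *
    have hz : 1 - c / (2 * √ω) = (2 * √ω - c) / (2 * √ω) := by field_simp
    rw [hz] at hd ⊢
    have hd' : 0 < 2 * √ω - c := by
      rw [div_pos_iff_of_pos_right (by positivity)] at hd
      exact hd
    have e4 : 4 * ω - c ^ 2 = (2 * √ω - c) * (2 * √ω + c) := by
      linear_combination (-4) * hs2
    have hc' : 0 < 2 * √ω + c := by
      rw [e4] at h4
      exact pos_of_mul_pos_right h4 hd'.le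
    have eP : (σ + 1) * (4 * ω - c ^ 2) / (2 * √ω * ((2 * √ω - c) / (2 * √ω)))
        = (σ + 1) * (2 * √ω + c) := by
      rw [e4]
      field_simp
    rw [eP, show ω - c ^ 2 / 4 = (4 * ω - c ^ 2) / 4 by ring, e4]
    have : (2 * √ω - c) * (2 * √ω + c) / 4 + c / 2 * ((σ + 1) * (2 * √ω + c))
        - 1 / (2 * σ + 2) * (1 - 1 / (2 * σ + 2)) * ((σ + 1) * (2 * √ω + c)) ^ 2
        = -(σ * √ω * (2 * √ω + c)) := by
      field_simp
      ring
    rw [this]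
    exact neg_ne_zero.2 (by positivity)
  · exact ((integrable_exp_neg_abs ha).const_mul C).mono'
      (continuous_profilePow hσ hω).aestronglyMeasurable (Eventually.of_forall fun y => by
        rw [Real.norm_of_nonneg (hpos y).le]
        exact hle y)

end Profile

/-! ### Eigenfunctions of the linearized operator are classical -/

lemma hasWeakDeriv_iff (u v : L2) : HasWeakDeriv u v ↔
    WeakDeriv (fun x => (u x).re) (fun x => (v x).re) ∧
      WeakDeriv (fun x => (u x).im) (fun x => (v x).im) := by
  have hre {f : ℝ → ℝ} {w : L2} (hi : Integrable fun x => f x • w x) :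
      (∫ x, f x • w x).re = ∫ x, f x * (w x).re := by
    have := Complex.reCLM.integral_comp_comm hi
    simpa using this.symm
  have him {f : ℝ → ℝ} {w : L2} (hi : Integrable fun x => f x • w x) :
      (∫ x, f x • w x).im = ∫ x, f x * (w x).im := by
    have := Complex.imCLM.integral_comp_comm hi
    simpa using this.symm
  have key (η : ℝ → ℝ) (hη : ContDiff ℝ (⊤ : ℕ∞) η) (hs : HasCompactSupport η) :
      ∫ x, deriv η x • u x = -∫ x, η x • v x ↔
        (∫ x, deriv η x * (u x).re = -∫ x, η x * (v x).re) ∧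
          ∫ x, deriv η x * (u x).im = -∫ x, η x * (v x).im := by
    have i1 := integrable_smul_L2 (hη.continuous_deriv (by simp)) hs.deriv u
    have i2 := integrable_smul_L2 hη.continuous hs v
    rw [Complex.ext_iff, Complex.neg_re, Complex.neg_im, hre i1, hre i2, him i1, him i2]
  exact ⟨fun h => ⟨fun η hη hs => ((key η hη hs).1 (h η hη hs)).1,
    fun η hη hs => ((key η hη hs).1 (h η hη hs)).2⟩,
    fun h η hη hs => (key η hη hs).2 ⟨h.1 η hη hs, h.2 η hη hs⟩⟩

lemma hasDerivAt_re {U V : ℝ → ℂ} {x : ℝ} (h : HasDerivAt U (V x) x) :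
    HasDerivAt (fun x => (U x).re) (V x).re x :=
  Complex.reCLM.hasFDerivAt.comp_hasDerivAt x h

lemma hasDerivAt_im {U V : ℝ → ℂ} {x : ℝ} (h : HasDerivAt U (V x) x) :
    HasDerivAt (fun x => (U x).im) (V x).im x :=
  Complex.imCLM.hasFDerivAt.comp_hasDerivAt x h

lemma hasWeakDeriv_of_hasDerivAt {u v : L2} {U V : ℝ → ℂ} (hu : u =ᵐ[volume] U)
    (hv : v =ᵐ[volume] V) (h : ∀ x, HasDerivAt U (V x) x) (hV : Continuous V) :
    HasWeakDeriv u v := by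
  rw [hasWeakDeriv_iff]
  constructor
  · refine (weakDeriv_of_hasDerivAt (fun x => hasDerivAt_re (h x)) (by fun_prop)).congr ?_ ?_
    · filter_upwards [hu] with x hx; rw [hx]
    · filter_upwards [hv] with x hx; rw [hx]
  · refine (weakDeriv_of_hasDerivAt (fun x => hasDerivAt_im (h x)) (by fun_prop)).congr ?_ ?_
    · filter_upwards [hu] with x hx; rw [hx]
    · filter_upwards [hv] with x hx; rw [hx]

lemma memLp_re {U : ℝ → ℂ} (h : MemLp U 2) : MemLp (fun x => (U x).re) 2 := h.re

lemma memLp_im {U : ℝ → ℂ} (h : MemLp U 2) : MemLp (fun x => (U x).im) 2 := h.im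

lemma HasWeakDeriv.exists_continuous {u v : L2} (h : HasWeakDeriv u v) :
    ∃ U : ℝ → ℂ, u =ᵐ[volume] U ∧ Continuous U := by
  obtain ⟨h1, h2⟩ := (hasWeakDeriv_iff u v).1 h
  have hl {w : ℝ → ℝ} (hw : MemLp w 2) : LocallyIntegrable w := hw.locallyIntegrable (by norm_num)
  obtain ⟨A, hA, cA⟩ := h1.exists_continuous (hl (memLp_re (Lp.memLp u)))
    (hl (memLp_re (Lp.memLp v)))
  obtain ⟨B, hB, cB⟩ := h2.exists_continuous (hl (memLp_im (Lp.memLp u)))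
    (hl (memLp_im (Lp.memLp v)))
  refine ⟨fun x => A x + B x * Complex.I, ?_, by fun_prop⟩
  filter_upwards [hA, hB] with x h1 h2
  rw [← h1, ← h2, Complex.re_add_im]

lemma HasWeakDeriv.hasDerivAt {u v : L2} (h : HasWeakDeriv u v) {U V : ℝ → ℂ}
    (hu : u =ᵐ[volume] U) (cU : Continuous U) (hv : v =ᵐ[volume] V) (cV : Continuous V) (x : ℝ) :
    HasDerivAt U (V x) x := by
  obtain ⟨h1, h2⟩ := (hasWeakDeriv_iff u v).1 h
  have d1 := h1.hasDerivAt (U := fun x => (U x).re) (V := fun x => (V x).re)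
    (by filter_upwards [hu] with x hx; rw [hx]) (by fun_prop)
    (by filter_upwards [hv] with x hx; rw [hx]) (by fun_prop) x
  have d2 := h2.hasDerivAt (U := fun x => (U x).im) (V := fun x => (V x).im)
    (by filter_upwards [hu] with x hx; rw [hx]) (by fun_prop)
    (by filter_upwards [hv] with x hx; rw [hx]) (by fun_prop) x
  have d3 := d1.ofReal_comp.add (d2.ofReal_comp.mul_const Complex.I)
  rw [Complex.re_add_im] at d3
  refine d3.congr_of_eventuallyEq (Eventually.of_forall fun y => ?_)
  exact (Complex.re_add_im (U y)).symm

/-- By uniqueness of weak derivatives, the ones chosen in `wderiv₁` and `wderiv₂` are the given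
ones. -/
lemma exists_mem_H2 {u u₁ u₂ : L2} (h₁ : HasWeakDeriv u u₁) (h₂ : HasWeakDeriv u₁ u₂) :
    ∃ h : u ∈ H2, (wderiv₁ ⟨u, h⟩ : L2) = u₁ ∧ wderiv₂ ⟨u, h⟩ = u₂ := by
  have e1 : wderiv ⟨u, u₁, h₁⟩ = u₁ := (hasWeakDeriv_wderiv ⟨u, u₁, h₁⟩).unique h₁
  have hu : u ∈ H2 := ⟨⟨u, u₁, h₁⟩, by
    show wderiv ⟨u, u₁, h₁⟩ ∈ H1
    rw [e1]
    exact ⟨u₂, h₂⟩, rfl⟩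
  have e2 : (wderiv₁ ⟨u, hu⟩ : L2) = u₁ := e1
  refine ⟨hu, e2, ?_⟩
  have := hasWeakDeriv_wderiv (wderiv₁ ⟨u, hu⟩)
  rw [e2] at this
  exact this.unique h₂

section

variable {σ ω c : ℝ}

lemma continuous_soliton (hσ : 0 < σ) (hω : c ^ 2 / 4 < ω) : Continuous (soliton σ ω c) :=
  continuous_iff_continuousAt.2 fun y => (hasDerivAt_soliton hσ hω y).continuousAt

lemma deriv_soliton (hσ : 0 < σ) (hω : c ^ 2 / 4 < ω) (y : ℝ) :
    deriv (soliton σ ω c) y = ((profileLog σ ω c y : ℝ)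
      + Complex.I * ((c / 2 - 1 / (2 * σ + 2) * profilePow σ ω c y : ℝ))) * soliton σ ω c y := by
  rw [(hasDerivAt_soliton hσ hω y).deriv, profileLog]
  ring

lemma continuous_linearizedFun (hσ : 0 < σ) (hω : c ^ 2 / 4 < ω) {v v₁ v₂ : ℝ → ℂ}
    (h : Continuous v) (h₁ : Continuous v₁) (h₂ : Continuous v₂) :
    Continuous (linearizedFun σ ω c v v₁ v₂) := by
  have hs := continuous_soliton hσ hω
  have H := isProfile_profilePow hσ hω
  have cp := H.continuous_pow
  have ch := H.continuous_log
  have hd : Continuous (deriv (soliton σ ω c)) := by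
    rw [funext (deriv_soliton hσ hω)]
    fun_prop
  -- The exponent 2σ - 2 may be negative, so continuity of the power needs a nonvanishing wave.
  have hn (y : ℝ) : ‖soliton σ ω c y‖ ≠ 0 := by
    rw [norm_soliton hσ hω]
    exact (profile_pos hσ hω y).ne'
  have hr (r : ℝ) : Continuous fun y => ‖soliton σ ω c y‖ ^ r :=
    hs.norm.rpow_const fun y => Or.inl (hn y)
  have hr1 := hr (2 * σ - 2)
  have hr2 := hr (2 * σ)
  unfold linearizedFun energyHess massHess momentumHess
  fun_prop

/-- Solves the eigenvalue equation for the second derivative in terms of lower order data, for use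
in elliptic regularity. -/
lemma linearizedFun_zero (v v₁ v₂ : ℝ → ℂ) (x : ℝ) :
    linearizedFun σ ω c v v₁ v₂ x = linearizedFun σ ω c v v₁ 0 x - v₂ x := by
  simp only [linearizedFun, energyHess, Pi.zero_apply]
  ring

/-- Eigenvectors of the linearized operator are the square integrable classical solutions of the
eigenvalue equation. -/
lemma mem_eigenspace_iff (hσ : 0 < σ) (hω : c ^ 2 / 4 < ω) (lam : ℝ) (u : L2) :
    u ∈ eigenspace (linearizedOp σ ω c hσ hω) lam ↔ ∃ U U₁ U₂ : ℝ → ℂ, u =ᵐ[volume] U ∧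
      (∀ x, HasDerivAt U (U₁ x) x) ∧ (∀ x, HasDerivAt U₁ (U₂ x) x) ∧
      MemLp U 2 ∧ MemLp U₁ 2 ∧ MemLp U₂ 2 ∧
      ∀ x, linearizedFun σ ω c U U₁ U₂ x = lam * U x := by
  constructor
  · rintro ⟨h, hu⟩
    set u₁ : L2 := ((wderiv₁ ⟨u, h⟩ : H1) : L2)
    set u₂ : L2 := wderiv₂ ⟨u, h⟩
    have w₂ : HasWeakDeriv u₁ u₂ := hasWeakDeriv_wderiv (wderiv₁ ⟨u, h⟩)
    have w₁ : HasWeakDeriv u u₁ := by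
      exact hasWeakDeriv_wderiv ⟨u, H2_le_H1 h⟩
    have heq : linearizedFun σ ω c u u₁ u₂ =ᵐ[volume] fun x => lam * u x := by
      have e1 : (linearizedOp σ ω c hσ hω ⟨u, h⟩ : ℝ → ℂ) =ᵐ[volume]
          linearizedFun σ ω c u u₁ u₂ :=
        (memLp_linearizedFun hσ hω _ _ _).coeFn_toLp
      rw [hu] at e1
      filter_upwards [e1, Lp.coeFn_smul lam u] with x h1 h2
      rw [← h1, h2, Pi.smul_apply, Complex.real_smul]
    obtain ⟨U, hU, cU⟩ := w₁.exists_continuous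
    obtain ⟨U₁, hU₁, cU₁⟩ := w₂.exists_continuous
    -- The equation itself supplies a continuous representative of the second weak derivative, so
    -- the representative of u is of class C².
    set U₂ : ℝ → ℂ := fun x => linearizedFun σ ω c U U₁ 0 x - lam * U x
    have cU₂ : Continuous U₂ :=
      (continuous_linearizedFun hσ hω cU cU₁ continuous_zero).sub (by fun_prop)
    have hU₂ : u₂ =ᵐ[volume] U₂ := by
      filter_upwards [heq, hU, hU₁] with x h1 h2 h3
      rw [linearizedFun_zero] at h1
      have h4 : linearizedFun σ ω c u u₁ 0 x = linearizedFun σ ω c U U₁ 0 x := by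
        simp only [linearizedFun, energyHess, massHess, momentumHess, h2, h3]
      simp only [U₂]
      rw [← h4, ← h2, ← h1]
      ring
    refine ⟨U, U₁, U₂, hU, w₁.hasDerivAt hU cU hU₁ cU₁, w₂.hasDerivAt hU₁ cU₁ hU₂ cU₂,
      (Lp.memLp u).ae_eq hU, (Lp.memLp u₁).ae_eq hU₁, (Lp.memLp u₂).ae_eq hU₂, fun x => ?_⟩
    rw [linearizedFun_zero]
    simp only [U₂]
    ring
  · rintro ⟨U, U₁, U₂, hU, d, d₁, m, m₁, m₂, heq⟩
    have cU : Continuous U := continuous_iff_continuousAt.2 fun y => (d y).continuousAt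
    have cU₁ : Continuous U₁ := continuous_iff_continuousAt.2 fun y => (d₁ y).continuousAt
    have cU₂ : Continuous U₂ := by
      have e : U₂ = fun x => linearizedFun σ ω c U U₁ 0 x - lam * U x := by
        funext x
        rw [← heq, linearizedFun_zero U U₁ U₂]
        ring
      rw [e]
      exact (continuous_linearizedFun hσ hω cU cU₁ continuous_zero).sub (by fun_prop)
    obtain ⟨h, e₁, e₂⟩ := exists_mem_H2 (hasWeakDeriv_of_hasDerivAt hU m₁.coeFn_toLp d cU₁)
      (hasWeakDeriv_of_hasDerivAt m₁.coeFn_toLp m₂.coeFn_toLp d₁ cU₂)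
    refine ⟨h, Lp.ext ?_⟩
    have e3 : (linearizedOp σ ω c hσ hω ⟨u, h⟩ : ℝ → ℂ) =ᵐ[volume]
        linearizedFun σ ω c u (wderiv₁ ⟨u, h⟩ : L2) (wderiv₂ ⟨u, h⟩) :=
        (memLp_linearizedFun hσ hω _ _ _).coeFn_toLp
    rw [e₁, e₂] at e3
    filter_upwards [e3, Lp.coeFn_smul lam u, hU, m₁.coeFn_toLp, m₂.coeFn_toLp] with x h1 h2 h3 h4 h5
    rw [h1, h2, Pi.smul_apply, Complex.real_smul, h3, ← heq]
    simp only [linearizedFun, energyHess, massHess, momentumHess, h3, h4, h5]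

end

/-! ### The linearized operator in the rotating frame -/

section

variable {σ ω c : ℝ}

/-- The phase factor of the solitary wave. -/
noncomputable def gauge (σ ω c y : ℝ) : ℂ := Complex.exp (Complex.I * phase σ ω c y)

/-- The derivative of the phase of the solitary wave. -/
noncomputable def phaseDeriv (σ ω c y : ℝ) : ℝ := c / 2 - 1 / (2 * σ + 2) * profilePow σ ω c y

lemma norm_gauge (y : ℝ) : ‖gauge σ ω c y‖ = 1 := by
  rw [gauge, mul_comm, Complex.norm_exp_ofReal_mul_I]

lemma gauge_ne_zero (y : ℝ) : gauge σ ω c y ≠ 0 := Complex.exp_ne_zero _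

lemma gauge_mul_conj (y : ℝ) : gauge σ ω c y * conj (gauge σ ω c y) = 1 := by
  rw [Complex.mul_conj, Complex.normSq_eq_norm_sq, norm_gauge]
  simp

lemma hasDerivAt_gauge (hσ : 0 < σ) (hω : c ^ 2 / 4 < ω) (y : ℝ) :
    HasDerivAt (gauge σ ω c) (Complex.I * phaseDeriv σ ω c y * gauge σ ω c y) y := by
  refine (((hasDerivAt_phase hσ hω y).ofReal_comp).const_mul Complex.I).cexp.congr_deriv ?_
  rw [gauge, phaseDeriv]
  ring

lemma hasDerivAt_phaseDeriv (hσ : 0 < σ) (hω : c ^ 2 / 4 < ω) (y : ℝ) :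
    HasDerivAt (phaseDeriv σ ω c)
      (-(1 / (2 * σ + 2) * (2 * σ * profileLog σ ω c y * profilePow σ ω c y))) y := by
  have := ((isProfile_profilePow hσ hω).hasDerivAt_pow y).const_mul (1 / (2 * σ + 2))
  exact (this.const_sub (c / 2)).congr_deriv rfl

/-- The linearized operator in the frame that rotates with the phase of the solitary wave. -/
lemma linearizedFun_gauge (hσ : 0 < σ) (hω : c ^ 2 / 4 < ω) {v v₁ v₂ : ℝ → ℂ} {x : ℝ}
    {a b a₁ b₁ a₂ b₂ : ℝ} (hv : v x = gauge σ ω c x * (a + b * Complex.I))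
    (hv₁ : v₁ x = gauge σ ω c x * (a₁ + b₁ * Complex.I
      + Complex.I * phaseDeriv σ ω c x * (a + b * Complex.I)))
    (hv₂ : v₂ x = gauge σ ω c x * (a₂ + b₂ * Complex.I
      + 2 * Complex.I * phaseDeriv σ ω c x * (a₁ + b₁ * Complex.I)
      + (Complex.I * (-(1 / (2 * σ + 2) * (2 * σ * profileLog σ ω c x * profilePow σ ω c x)) : ℝ)
        - phaseDeriv σ ω c x ^ 2) * (a + b * Complex.I))) :
    linearizedFun σ ω c v v₁ v₂ x = gauge σ ω c x *
      (((-a₂ + potPlus σ (1 / (2 * σ + 2)) (ω - c ^ 2 / 4) c (profilePow σ ω c x) * a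
          + 2 * σ * (1 / (2 * σ + 2)) * profilePow σ ω c x * (b₁ - profileLog σ ω c x * b
            + 2 * σ * (1 / (2 * σ + 2)) * profilePow σ ω c x * a) : ℝ) : ℂ)
        + ((-(b₂ - (potMinus (1 / (2 * σ + 2)) (ω - c ^ 2 / 4) c (profilePow σ ω c x)
              - profileLog σ ω c x ^ 2) * b - profileLog σ ω c x * b₁
            + 2 * σ * (1 / (2 * σ + 2)) * (2 * σ * profileLog σ ω c x * profilePow σ ω c x) * a
            + 2 * σ * (1 / (2 * σ + 2)) * profilePow σ ω c x * a₁)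
          - profileLog σ ω c x * (b₁ - profileLog σ ω c x * b
            + 2 * σ * (1 / (2 * σ + 2)) * profilePow σ ω c x * a) : ℝ) : ℂ) * Complex.I) := by
  have hf := profile_pos hσ hω x
  have hn := norm_soliton hσ hω x
  have hp : ‖soliton σ ω c x‖ ^ (2 * σ) = profilePow σ ω c x := by
    rw [hn, profile_rpow hσ hω]
  have hp2 : (‖soliton σ ω c x‖ ^ (2 * σ - 2)) * (profile σ ω c x * profile σ ω c x)
      = profilePow σ ω c x := by
    rw [hn, ← profile_rpow hσ hω, ← sq, ← Real.rpow_natCast, ← Real.rpow_add hf]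
    norm_num
  have hφ : soliton σ ω c x = profile σ ω c x * gauge σ ω c x := rfl
  have hg := gauge_mul_conj (σ := σ) (ω := ω) (c := c) x
  have hd : deriv (soliton σ ω c) x = ((profileLog σ ω c x : ℝ)
      + Complex.I * (phaseDeriv σ ω c x : ℝ)) * soliton σ ω c x := deriv_soliton hσ hω x
  have hk : (1 / (2 * σ + 2)) * (2 * σ + 2) = 1 := by field_simp
  have hθ : phaseDeriv σ ω c x = c / 2 - 1 / (2 * σ + 2) * profilePow σ ω c x := rfl
  simp only [linearizedFun, energyHess, massHess, momentumHess, hp]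
  rw [hv, hv₁, hv₂, hd]
  generalize (‖soliton σ ω c x‖ ^ (2 * σ - 2) : ℝ) = N at *
  rw [hφ]
  simp only [map_mul, map_add, Complex.conj_ofReal, Complex.conj_I]
  rw [hθ, potPlus, potMinus]
  clear hv hv₁ hv₂ hφ hd hθ hp hn hf
  generalize 1 / (2 * σ + 2) = k at *
  generalize gauge σ ω c x = E at *
  generalize conj E = F at *
  generalize profilePow σ ω c x = p at *
  generalize profile σ ω c x = f at *
  generalize profileLog σ ω c x = h at *
  have hp2' : (N : ℂ) * (f * f) = p := by exact_mod_cast hp2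
  push_cast
  -- In the two potential terms the singular power recombines through |φ|^{2σ-2} f² = p, and E ·
  -- conj E = 1 leaves exactly one factor E.
  have t1 : Complex.I * σ * N * (f * F) * ((h + Complex.I * (c / 2 - k * p)) * (f * E))
      * (E * (a + b * Complex.I)) = Complex.I * σ * p * (h + Complex.I * (c / 2 - k * p))
      * (E * (a + b * Complex.I)) := by
    linear_combination (Complex.I * σ * (h + Complex.I * (c / 2 - k * p))
      * (E * (a + b * Complex.I))) * (N * (f * f) * hg + hp2')
  have t2 : Complex.I * σ * N * (f * E) * ((h + Complex.I * (c / 2 - k * p)) * (f * E))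
      * (F * (a + b * -Complex.I)) = Complex.I * σ * p * (h + Complex.I * (c / 2 - k * p))
      * (E * (a + b * -Complex.I)) := by
    linear_combination (Complex.I * σ * (h + Complex.I * (c / 2 - k * p))
      * (E * (a + b * -Complex.I))) * (N * (f * f) * hg + hp2')
  rw [t1, t2]
  set w : ℂ := a + b * Complex.I with hw
  set w₁ : ℂ := a₁ + b₁ * Complex.I with hw₁
  set θ : ℂ := c / 2 - k * p with hθ
  trans E * (-(a₂ + b₂ * Complex.I + 2 * Complex.I * θ * w₁
      + (Complex.I * -(k * (2 * σ * h * p)) - θ ^ 2) * w)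
    - Complex.I * σ * p * (h + Complex.I * θ) * w
    - Complex.I * p * (w₁ + Complex.I * θ * w)
    - Complex.I * σ * p * (h + Complex.I * θ) * (a + b * -Complex.I)
    + ω * w + c * (Complex.I * (w₁ + Complex.I * θ * w)))
  · ring
  congr 1
  rw [hw, hw₁, hθ]
  -- After the common phase is cancelled, real and imaginary parts are polynomial identities that
  -- need only k(2σ+2) = 1.
  apply Complex.ext
  · simp [sq]
    linear_combination (-(b₁ * p) - 2 * σ * k * p ^ 2 * a) * hk
  · simp [sq]
    linear_combination (a₁ * p + 2 * σ * h * p * a) * hk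

end

/-! ### Eigenvectors as solutions of the real first order system -/

section

variable {σ ω c : ℝ}

lemma continuous_gauge (hσ : 0 < σ) (hω : c ^ 2 / 4 < ω) : Continuous (gauge σ ω c) :=
  continuous_iff_continuousAt.2 fun y => (hasDerivAt_gauge hσ hω y).continuousAt

lemma continuous_phaseDeriv (hσ : 0 < σ) (hω : c ^ 2 / 4 < ω) : Continuous (phaseDeriv σ ω c) :=
  continuous_iff_continuousAt.2 fun y => (hasDerivAt_phaseDeriv hσ hω y).continuousAt

lemma exists_phaseDeriv_le (hσ : 0 < σ) (hω : c ^ 2 / 4 < ω) :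
    ∃ C, ∀ y, ‖(phaseDeriv σ ω c y : ℂ)‖ ≤ C := by
  obtain ⟨C, _, hC⟩ := (isProfile_profilePow hσ hω).exists_pow_le
  refine ⟨|c / 2| + 1 / (2 * σ + 2) * C, fun y => ?_⟩
  rw [Complex.norm_real, Real.norm_eq_abs, phaseDeriv]
  refine (abs_sub _ _).trans ?_
  rw [abs_mul, abs_of_pos (by positivity : 0 < 1 / (2 * σ + 2))]
  gcongr
  exact hC y

lemma memLp_gauge_mul (hσ : 0 < σ) (hω : c ^ 2 / 4 < ω) {w : ℝ → ℂ} (hw : MemLp w 2) :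
    MemLp (fun x => gauge σ ω c x * w x) 2 :=
  memLp_bdd_mul hw (continuous_gauge hσ hω).measurable fun x => (norm_gauge x).le

lemma memLp_phaseDeriv_mul (hσ : 0 < σ) (hω : c ^ 2 / 4 < ω) {w : ℝ → ℂ} (hw : MemLp w 2) :
    MemLp (fun x => (phaseDeriv σ ω c x : ℂ) * w x) 2 := by
  obtain ⟨C, hC⟩ := exists_phaseDeriv_le hσ hω
  exact memLp_bdd_mul hw
    (Complex.measurable_ofReal.comp (continuous_phaseDeriv hσ hω).measurable) hC

lemma eq_of_ofReal_add_eq {r s t q lam : ℝ}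
    (h : (r : ℂ) + s * Complex.I = lam * (t + q * Complex.I)) : r = lam * t ∧ s = lam * q :=
  ⟨by simpa using congrArg Complex.re h, by simpa using congrArg Complex.im h⟩

lemma memLp_ofReal_add {a b : ℝ → ℝ} (ha : MemLp a 2) (hb : MemLp b 2) :
    MemLp (fun x => (a x : ℂ) + b x * Complex.I) 2 := by
  have h1 : MemLp (fun x => (a x : ℂ)) 2 := ha.ofReal
  have h2 : MemLp (fun x => (b x : ℂ)) 2 := hb.ofReal
  exact h1.add (h2.mul_const _)

/-- The system `IsSol` for the profile of the solitary wave. -/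
abbrev IsWaveSol (σ ω c lam : ℝ) (a a₁ b z : ℝ → ℝ) : Prop :=
  IsSol σ (1 / (2 * σ + 2)) (ω - c ^ 2 / 4) c (profilePow σ ω c) (profileLog σ ω c) lam a a₁ b z

lemma hasDerivAt_gauge_mul (hσ : 0 < σ) (hω : c ^ 2 / 4 < ω) {w w₁ : ℝ → ℂ} {x : ℝ}
    (hw : HasDerivAt w (w₁ x) x) : HasDerivAt (fun x => gauge σ ω c x * w x)
      (gauge σ ω c x * (w₁ x + Complex.I * phaseDeriv σ ω c x * w x)) x :=
  ((hasDerivAt_gauge hσ hω x).mul hw).congr_deriv (by ring)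

/-- The definition of z recovers b', and differentiating once more recovers b''. All coefficients
are bounded, so every derivative stays in L² after multiplication by the phase. -/
lemma mem_eigenspace_of_isWaveSol (hσ : 0 < σ) (hω : c ^ 2 / 4 < ω) {lam : ℝ} {a a₁ b z : ℝ → ℝ}
    (S : IsWaveSol σ ω c lam a a₁ b z) {u : L2}
    (hu : u =ᵐ[volume] fun x => gauge σ ω c x * (a x + b x * Complex.I)) :
    u ∈ eigenspace (linearizedOp σ ω c hσ hω) lam := by
  have H := isProfile_profilePow hσ hω
  rw [mem_eigenspace_iff]
  set k : ℝ := 1 / (2 * σ + 2) with hk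
  set p := profilePow σ ω c
  set h := profileLog σ ω c
  set m := ω - c ^ 2 / 4
  set b₁ : ℝ → ℝ := fun x => z x + h x * b x - 2 * σ * k * p x * a x
  set a₂ : ℝ → ℝ := fun x => potPlus σ k m c (p x) * a x + 2 * σ * k * p x * z x - lam * a x
  set b₂ : ℝ → ℝ := fun x => (-(h x * z x) - lam * b x)
    + ((potMinus k m c (p x) - h x ^ 2) * b x + h x * b₁ x)
    - (2 * σ * k * (2 * σ * h x * p x) * a x + 2 * σ * k * p x * a₁ x)
  have hb₁ (x : ℝ) : HasDerivAt b₁ (b₂ x) x :=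
    (((S.deriv_z x).add ((H.hasDerivAt_log x).mul (S.deriv_b x))).sub
      (((H.hasDerivAt_pow x).const_mul (2 * σ * k)).mul (S.deriv_a x)))
  set w : ℝ → ℂ := fun x => a x + b x * Complex.I
  set w₁ : ℝ → ℂ := fun x => a₁ x + b₁ x * Complex.I
  set w₂ : ℝ → ℂ := fun x => a₂ x + b₂ x * Complex.I
  have hw (x : ℝ) : HasDerivAt w (w₁ x) x :=
    (S.deriv_a x).ofReal_comp.add ((S.deriv_b x).ofReal_comp.mul_const _)
  have hw₁ (x : ℝ) : HasDerivAt w₁ (w₂ x) x :=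
    (S.deriv_a₁ x).ofReal_comp.add ((hb₁ x).ofReal_comp.mul_const _)
  set Θ : ℝ → ℂ := fun x => phaseDeriv σ ω c x
  set Θ' : ℝ → ℝ := fun x => -(k * (2 * σ * h x * p x))
  have hΘ (x : ℝ) : HasDerivAt Θ (Θ' x) x := (hasDerivAt_phaseDeriv hσ hω x).ofReal_comp
  have mb₁ : MemLp b₁ 2 :=
    (S.memLp_z.add (IsSol.memLp_log_mul H S.memLp_b)).sub (IsSol.memLp_coupling_mul H S.memLp_a)
  have ma₂ : MemLp a₂ 2 := ((IsSol.memLp_potPlus_mul H S.memLp_a).add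
    (IsSol.memLp_coupling_mul H S.memLp_z)).sub (S.memLp_a.const_mul lam)
  have mb₂ : MemLp b₂ 2 := by
    have t1 := (IsSol.memLp_log_mul H S.memLp_z).neg.sub (S.memLp_b.const_mul lam)
    -- By `log_sq` the constant m cancels in h' = V - h², leaving a polynomial in the bounded
    -- function p.
    have t2 : MemLp (fun x => (potMinus k m c (p x) - h x ^ 2) * b x) 2 := by
      have e : (fun x => (potMinus k m c (p x) - h x ^ 2) * b x) = fun x =>
          (c / 2 - k * c) * (p x * b x) + (k ^ 2 - k * (1 - k)) * (p x * (p x * b x)) := by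
        funext x
        rw [H.log_sq, potMinus]
        ring
      rw [e]
      have := IsSol.memLp_pow_mul H S.memLp_b
      exact (this.const_mul _).add ((IsSol.memLp_pow_mul H this).const_mul _)
    have t3 := IsSol.memLp_log_mul H mb₁
    have t4 : MemLp (fun x => 2 * σ * k * (2 * σ * h x * p x) * a x) 2 := by
      have := (IsSol.memLp_log_mul H (IsSol.memLp_pow_mul H S.memLp_a)).const_mul
        (2 * σ * k * (2 * σ))
      refine this.congr_norm (by
        have := H.continuous_log
        have := H.continuous_pow
        have := S.continuous_a
        fun_prop) (Eventually.of_forall fun x => ?_)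
      congr 1
      ring
    have t5 := IsSol.memLp_coupling_mul H S.memLp_a₁
    exact (t1.add (t2.add t3)).sub (t4.add t5)
  have mw : MemLp w 2 := memLp_ofReal_add S.memLp_a S.memLp_b
  have mw₁ : MemLp w₁ 2 := memLp_ofReal_add S.memLp_a₁ mb₁
  have mw₂ : MemLp w₂ 2 := memLp_ofReal_add ma₂ mb₂
  have mΘ' : MemLp (fun x => (Θ' x : ℂ) * w x) 2 := by
    obtain ⟨C, hC0, hC⟩ := H.exists_pow_le
    obtain ⟨D, _, hD⟩ := H.exists_log_le
    have hkp := H.k_pos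
    refine memLp_bdd_mul (C := k * (2 * σ * D * C)) mw ?_ fun x => ?_
    · have := H.continuous_log.measurable
      have := H.continuous_pow.measurable
      exact Complex.measurable_ofReal.comp (by fun_prop)
    · rw [Complex.norm_real, Real.norm_eq_abs, abs_neg, abs_mul, abs_mul, abs_mul,
        abs_of_pos hkp, abs_of_pos (by positivity : 0 < 2 * σ)]
      gcongr
      · exact hD x
      · exact hC x
  refine ⟨fun x => gauge σ ω c x * w x,
    fun x => gauge σ ω c x * (w₁ x + Complex.I * Θ x * w x),
    fun x => gauge σ ω c x * (w₂ x + 2 * Complex.I * Θ x * w₁ x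
      + (Complex.I * Θ' x - Θ x ^ 2) * w x), hu, fun x => hasDerivAt_gauge_mul hσ hω (hw x),
    fun x => ?_, memLp_gauge_mul hσ hω mw, memLp_gauge_mul hσ hω ?_, memLp_gauge_mul hσ hω ?_,
    fun x => ?_⟩
  · refine (hasDerivAt_gauge_mul hσ hω (w := fun x => w₁ x + Complex.I * Θ x * w x)
      (w₁ := fun x => w₂ x + (Complex.I * Θ' x * w x + Complex.I * Θ x * w₁ x))
      ((hw₁ x).add (((hΘ x).const_mul Complex.I).mul (hw x)))).congr_deriv ?_
    simp only [Θ]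
    linear_combination (gauge σ ω c x * phaseDeriv σ ω c x ^ 2 * w x) * Complex.I_sq
  · have := (memLp_phaseDeriv_mul hσ hω mw).const_mul Complex.I
    simpa only [mul_assoc] using! mw₁.add this
  · have t1 := (memLp_phaseDeriv_mul hσ hω mw₁).const_mul (2 * Complex.I)
    have t2 := mΘ'.const_mul Complex.I
    have t3 := memLp_phaseDeriv_mul hσ hω (memLp_phaseDeriv_mul hσ hω mw)
    refine ((mw₂.add t1).add (t2.sub t3)).ae_eq (Eventually.of_forall fun x => ?_)
    simp only [Pi.add_apply, Pi.sub_apply, Θ]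
    ring
  · rw [linearizedFun_gauge hσ hω (a := a x) (b := b x) (a₁ := a₁ x) (b₁ := b₁ x) (a₂ := a₂ x)
      (b₂ := b₂ x) rfl rfl rfl, ← hk]
    have e1 : -a₂ x + potPlus σ k m c (p x) * a x
        + 2 * σ * k * p x * (b₁ x - h x * b x + 2 * σ * k * p x * a x) = lam * a x := by
      simp only [a₂, b₁]
      ring
    have e2 : -(b₂ x - (potMinus k m c (p x) - h x ^ 2) * b x - h x * b₁ x
        + 2 * σ * k * (2 * σ * h x * p x) * a x + 2 * σ * k * p x * a₁ x)
        - h x * (b₁ x - h x * b x + 2 * σ * k * p x * a x) = lam * b x := by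
      simp only [b₂, b₁]
      ring
    rw [e1, e2]
    simp only [w]
    push_cast
    ring

/-- Multiplying by the conjugate phase undoes the rotation. The real and imaginary parts of the
result solve the system, with z defined from b'. -/
lemma exists_isWaveSol_of_mem_eigenspace (hσ : 0 < σ) (hω : c ^ 2 / 4 < ω) {lam : ℝ} {u : L2}
    (hu : u ∈ eigenspace (linearizedOp σ ω c hσ hω) lam) :
    ∃ a a₁ b z : ℝ → ℝ, IsWaveSol σ ω c lam a a₁ b z ∧
      u =ᵐ[volume] fun x => gauge σ ω c x * (a x + b x * Complex.I) := by
  have H := isProfile_profilePow hσ hω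
  rw [mem_eigenspace_iff] at hu
  obtain ⟨U, U₁, U₂, hU, d, d₁, mU, mU₁, mU₂, heq⟩ := hu
  set k : ℝ := 1 / (2 * σ + 2) with hk
  set p := profilePow σ ω c
  set h := profileLog σ ω c
  set m := ω - c ^ 2 / 4
  set Θ : ℝ → ℂ := fun x => phaseDeriv σ ω c x
  set Θ' : ℝ → ℝ := fun x => -(k * (2 * σ * h x * p x))
  have hΘ (x : ℝ) : HasDerivAt Θ (Θ' x) x := (hasDerivAt_phaseDeriv hσ hω x).ofReal_comp
  set F : ℝ → ℂ := fun x => conj (gauge σ ω c x)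
  have hgF (x : ℝ) : gauge σ ω c x * F x = 1 := gauge_mul_conj x
  have hF (x : ℝ) : HasDerivAt F (-(Complex.I * Θ x * F x)) x := by
    have h1 : HasDerivAt F (conj (Complex.I * phaseDeriv σ ω c x * gauge σ ω c x)) x :=
      (hasDerivAt_gauge hσ hω x).star
    refine h1.congr_deriv ?_
    simp only [map_mul, Complex.conj_I, Complex.conj_ofReal, F, Θ]
    ring
  have mF {v : ℝ → ℂ} (hv : MemLp v 2) : MemLp (fun x => F x * v x) 2 := by
    refine memLp_bdd_mul (C := 1) hv ?_ fun x => ?_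
    · exact (Complex.continuous_conj.comp (continuous_gauge hσ hω)).measurable
    · simp only [F, RCLike.norm_conj]
      exact (norm_gauge x).le
  set w : ℝ → ℂ := fun x => F x * U x
  set w₁ : ℝ → ℂ := fun x => F x * (U₁ x - Complex.I * Θ x * U x)
  set w₂ : ℝ → ℂ := fun x => F x * (U₂ x - 2 * Complex.I * Θ x * U₁ x
    - (Complex.I * Θ' x + Θ x ^ 2) * U x)
  have hw (x : ℝ) : HasDerivAt w (w₁ x) x :=
    ((hF x).mul (d x)).congr_deriv (by simp only [w₁]; ring)
  have hw₁ (x : ℝ) : HasDerivAt w₁ (w₂ x) x := by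
    refine ((hF x).mul ((d₁ x).sub (((hΘ x).const_mul Complex.I).mul (d x)))).congr_deriv ?_
    simp only [w₂, Pi.sub_apply, Pi.mul_apply]
    linear_combination (F x * Θ x ^ 2 * U x) * Complex.I_sq
  have mw : MemLp w 2 := mF mU
  have mw₁ : MemLp w₁ 2 := by
    have := (memLp_phaseDeriv_mul hσ hω mU).const_mul Complex.I
    refine mF ((mU₁.sub this).ae_eq (Eventually.of_forall fun x => ?_))
    simp only [Pi.sub_apply, Θ]
    ring
  have eU (x : ℝ) : U x = gauge σ ω c x * w x := by
    linear_combination (-U x) * hgF x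
  have eU₁ (x : ℝ) : U₁ x = gauge σ ω c x * (w₁ x + Complex.I * Θ x * w x) := by
    linear_combination (-U₁ x) * hgF x
  have eU₂ (x : ℝ) : U₂ x = gauge σ ω c x * (w₂ x + 2 * Complex.I * Θ x * w₁ x
      + (Complex.I * Θ' x - Θ x ^ 2) * w x) := by
    simp only [w, w₁, w₂]
    linear_combination (-U₂ x) * hgF x
      + (2 * gauge σ ω c x * F x * Θ x ^ 2 * U x) * Complex.I_sq
  set a : ℝ → ℝ := fun x => (w x).re
  set b : ℝ → ℝ := fun x => (w x).im
  set a₁ : ℝ → ℝ := fun x => (w₁ x).re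
  set b₁ : ℝ → ℝ := fun x => (w₁ x).im
  set a₂ : ℝ → ℝ := fun x => (w₂ x).re
  set b₂ : ℝ → ℝ := fun x => (w₂ x).im
  have ew (x : ℝ) : w x = a x + b x * Complex.I := (Complex.re_add_im _).symm
  have ew₁ (x : ℝ) : w₁ x = a₁ x + b₁ x * Complex.I := (Complex.re_add_im _).symm
  have ew₂ (x : ℝ) : w₂ x = a₂ x + b₂ x * Complex.I := (Complex.re_add_im _).symm
  have key (x : ℝ) : (-a₂ x + potPlus σ k m c (p x) * a x
        + 2 * σ * k * p x * (b₁ x - h x * b x + 2 * σ * k * p x * a x) = lam * a x) ∧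
      -(b₂ x - (potMinus k m c (p x) - h x ^ 2) * b x - h x * b₁ x
        + 2 * σ * k * (2 * σ * h x * p x) * a x + 2 * σ * k * p x * a₁ x)
        - h x * (b₁ x - h x * b x + 2 * σ * k * p x * a x) = lam * b x := by
    have h1 := heq x
    rw [linearizedFun_gauge hσ hω (a := a x) (b := b x) (a₁ := a₁ x) (b₁ := b₁ x) (a₂ := a₂ x)
      (b₂ := b₂ x) (by rw [eU, ew]) (by rw [eU₁, ew, ew₁]) (by rw [eU₂, ew, ew₁, ew₂]), eU,
      mul_left_comm (lam : ℂ)] at h1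
    have h2 := mul_left_cancel₀ (gauge_ne_zero x) h1
    rw [ew] at h2
    exact eq_of_ofReal_add_eq h2
  have da (x : ℝ) : HasDerivAt a (a₁ x) x := hasDerivAt_re (hw x)
  have db (x : ℝ) : HasDerivAt b (b₁ x) x := hasDerivAt_im (hw x)
  refine ⟨a, a₁, b, fun x => b₁ x - h x * b x + 2 * σ * k * p x * a x,
    ⟨da, fun x => (hasDerivAt_re (hw₁ x)).congr_deriv ?_, fun x => (db x).congr_deriv ?_,
      fun x => ?_, memLp_re mw, memLp_re mw₁, memLp_im mw, ?_⟩, ?_⟩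
  · have := (key x).1
    linarith
  · ring
  · have db₁ : HasDerivAt b₁ (b₂ x) x := hasDerivAt_im (hw₁ x)
    refine ((db₁.sub ((H.hasDerivAt_log x).mul (db x))).add
      (((H.hasDerivAt_pow x).const_mul (2 * σ * k)).mul (da x))).congr_deriv ?_
    have := (key x).2
    linarith
  · exact ((memLp_im mw₁).sub (IsSol.memLp_log_mul H (memLp_im mw))).add
      (IsSol.memLp_coupling_mul H (memLp_re mw))
  · filter_upwards [hU] with x hx
    rw [hx, eU, ew]

end

/-! ### Counting the negative eigenvalues -/

lemma cardinal_sum_eq_single {ι : Type} (f : ι → Cardinal.{0}) (i₀ : ι)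
    (h : ∀ i, i ≠ i₀ → f i = 0) : Cardinal.sum f = f i₀ := by
  have hb : Function.Bijective (fun x : (f i₀).out => (⟨i₀, x⟩ : Σ i, (f i).out)) := by
    refine ⟨fun x y hxy => by simpa using hxy, ?_⟩
    rintro ⟨i, y⟩
    by_cases hi : i = i₀
    · subst hi
      exact ⟨y, rfl⟩
    · have : IsEmpty (f i).out := by
        rw [← Cardinal.mk_eq_zero_iff, Cardinal.mk_out, h i hi]
      exact isEmptyElim y
  have := Cardinal.mk_congr (Equiv.ofBijective _ hb)
  rw [Cardinal.mk_out, Cardinal.mk_sigma] at this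
  rw [this]
  simp

section

variable {E : Type*} [AddCommGroup E] [Module ℝ E]

lemma isEigenvalue_iff (A : E →ₗ.[ℝ] E) (lam : ℝ) :
    IsEigenvalue A lam ↔ ∃ u ∈ eigenspace A lam, u ≠ 0 := by
  constructor
  · rintro ⟨u, hu0, hu⟩
    exact ⟨u, ⟨u.2, hu⟩, by simpa using hu0⟩
  · rintro ⟨u, ⟨h, hu⟩, hu0⟩
    exact ⟨⟨u, h⟩, by simpa using hu0, hu⟩

end

/-! ### Existence, uniqueness and simplicity of the negative eigenvalue -/

section

variable {σ ω c : ℝ}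

lemma eq_zero_of_ae_eq {u : L2} {a b : ℝ → ℝ}
    (hu : u =ᵐ[volume] fun x => gauge σ ω c x * (a x + b x * Complex.I)) (h : a = 0 ∧ b = 0) :
    u = 0 := by
  rw [Lp.eq_zero_iff_ae_eq_zero]
  filter_upwards [hu] with x hx
  rw [hx, h.1, h.2]
  simp

lemma exists_negative_eigenvalue (hσ : 0 < σ) (hω : c ^ 2 / 4 < ω) :
    ∃ lam < 0, IsEigenvalue (linearizedOp σ ω c hσ hω) lam := by
  obtain ⟨lam, hlam, a, a₁, b, z, S, hne⟩ := (isProfile_profilePow hσ hω).exists_isSol_of_memLp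
    (profile_pos hσ hω) (hasDerivAt_profile' hσ hω) (memLp_profile hσ hω)
  have m : MemLp (fun x => gauge σ ω c x * ((a x : ℂ) + b x * Complex.I)) 2 :=
    memLp_gauge_mul hσ hω (memLp_ofReal_add S.memLp_a S.memLp_b)
  refine ⟨lam, hlam, (isEigenvalue_iff _ _).2
    ⟨m.toLp _, mem_eigenspace_of_isWaveSol hσ hω S m.coeFn_toLp, fun h0 => hne ?_⟩⟩
  have h1 : (fun x => gauge σ ω c x * ((a x : ℂ) + b x * Complex.I)) =ᵐ[volume] 0 :=
    m.coeFn_toLp.symm.trans ((Lp.eq_zero_iff_ae_eq_zero).1 h0)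
  have ca := S.continuous_a
  have cb := S.continuous_b
  have cg := continuous_gauge hσ hω
  have h2 := (Continuous.ae_eq_iff_eq volume (by fun_prop) continuous_zero).1 h1
  have h3 (x : ℝ) : (a x : ℂ) + b x * Complex.I = (0 : ℝ) * ((0 : ℝ) + (0 : ℝ) * Complex.I) := by
    have := (mul_eq_zero.1 (congrFun h2 x)).resolve_left (gauge_ne_zero x)
    rw [this]
    simp
  constructor
  · funext x
    simpa using (eq_of_ofReal_add_eq (h3 x)).1
  · funext x
    simpa using (eq_of_ofReal_add_eq (h3 x)).2

lemma negative_eigenvalue_unique (hσ : 0 < σ) (hω : c ^ 2 / 4 < ω) {lam mu : ℝ} (hl : lam < 0)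
    (hm : mu < 0) (h₁ : IsEigenvalue (linearizedOp σ ω c hσ hω) lam)
    (h₂ : IsEigenvalue (linearizedOp σ ω c hσ hω) mu) : lam = mu := by
  by_contra hne
  obtain ⟨u, hu, hu0⟩ := (isEigenvalue_iff _ _).1 h₁
  obtain ⟨v, hv, hv0⟩ := (isEigenvalue_iff _ _).1 h₂
  obtain ⟨a, a₁, b, z, S, hS⟩ := exists_isWaveSol_of_mem_eigenspace hσ hω hu
  obtain ⟨a', a₁', b', z', S', hS'⟩ := exists_isWaveSol_of_mem_eigenspace hσ hω hv
  rcases S.eq_zero_or_eq_zero (isProfile_profilePow hσ hω) S' hl hm hne with h | h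
  · exact hu0 (eq_zero_of_ae_eq hS h)
  · exact hv0 (eq_zero_of_ae_eq hS' h)

/-- A negative eigenvalue is simple. -/
lemma rank_eigenspace_eq_one (hσ : 0 < σ) (hω : c ^ 2 / 4 < ω) {lam : ℝ} (hl : lam < 0)
    (h : IsEigenvalue (linearizedOp σ ω c hσ hω) lam) :
    Module.rank ℝ (eigenspace (linearizedOp σ ω c hσ hω) lam) = 1 := by
  have H := isProfile_profilePow hσ hω
  obtain ⟨u, hu, hu0⟩ := (isEigenvalue_iff _ _).1 h
  obtain ⟨a, a₁, b, z, S, hS⟩ := exists_isWaveSol_of_mem_eigenspace hσ hω hu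
  have ha0 : a 0 ≠ 0 := fun h0 => hu0 (eq_zero_of_ae_eq hS (S.eq_zero_of_zero H hl h0))
  rw [Module.rank_eq_one_iff_finrank_eq_one,
    finrank_eq_one_iff_of_nonzero' (⟨u, hu⟩ : eigenspace (linearizedOp σ ω c hσ hω) lam)
      (by simpa using hu0)]
  rintro ⟨v, hv⟩
  obtain ⟨a', a₁', b', z', S', hS'⟩ := exists_isWaveSol_of_mem_eigenspace hσ hω hv
  refine ⟨a' 0 / a 0, Subtype.ext ?_⟩
  -- The real part of this combination vanishes at 0, so the combination is zero and v is a real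
  -- multiple of u.
  have hz := (S.comb S' (a' 0 / a 0) (-1)).eq_zero_of_zero H hl (by field_simp; ring)
  show (a' 0 / a 0) • u = v
  refine Lp.ext ?_
  filter_upwards [Lp.coeFn_smul (a' 0 / a 0) u, hS, hS'] with x h1 h2 h3
  have e1 := congrFun hz.1 x
  have e2 := congrFun hz.2 x
  simp only [Pi.zero_apply] at e1 e2
  rw [h1, Pi.smul_apply, h2, h3, show a' x = a' 0 / a 0 * a x by linarith,
    show b' x = a' 0 / a 0 * b x by linarith, Complex.real_smul]
  push_cast
  ring

end

end GDNLS

theorem mainTheorem3 (σ ω c : ℝ) (hσ : 0 < σ) (hω : c ^ 2 / 4 < ω) :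
    (∃! lam : ℝ, lam < 0 ∧ GDNLS.IsEigenvalue (GDNLS.linearizedOp σ ω c hσ hω) lam) ∧
      GDNLS.negCount (GDNLS.linearizedOp σ ω c hσ hω) = 1 := by
  obtain ⟨lam, hl, h⟩ := GDNLS.exists_negative_eigenvalue hσ hω
  refine ⟨⟨lam, ⟨hl, h⟩, fun mu hmu => GDNLS.negative_eigenvalue_unique hσ hω hmu.1 hl hmu.2 h⟩, ?_⟩
  -- The sum runs over all negative reals. Away from the unique eigenvalue the eigenspace is trivial
  -- and contributes rank zero.
  rw [GDNLS.negCount, GDNLS.cardinal_sum_eq_single _ (⟨lam, hl⟩ : Set.Iio (0 : ℝ))]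
  · exact GDNLS.rank_eigenspace_eq_one hσ hω hl h
  · rintro ⟨mu, hmu⟩ hne
    have hbot : GDNLS.eigenspace (GDNLS.linearizedOp σ ω c hσ hω) mu = ⊥ := by
      by_contra hb
      obtain ⟨u, hu, hu0⟩ := Submodule.exists_mem_ne_zero_of_ne_bot hb
      exact hne (Subtype.ext (GDNLS.negative_eigenvalue_unique hσ hω hmu hl
        ((GDNLS.isEigenvalue_iff _ _).2 ⟨u, hu, hu0⟩) h))
    exact Submodule.rank_eq_zero.2 hbot
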